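/- **Setting.** Let $\mathbb F$ be a field. For a finite dimensional $\mathbb F$-algebra $B$ let $G_0(B)$ be the Grothendieck group of finitely generated left $B$-modules (relations from short exact sequences), let $K_0(B)$ be the split Grothendieck group of finitely generated projective left $B$-modules, and put $\langle [P],[M]\rangle=\dim_{\mathbb F}\operatorname{Hom}_B(P,M)$. A *tower of algebras* is a unital associative graded $\mathbb F$-algebra $A=\bigoplus_{n\ge 0}A_n$ with multiplication $\rho$ such that: each $A_n$ is a finite dimensional $\mathbb F$-algebra with its own multiplication and unit $1_n$, and $A_0\cong\mathbb F$; each $\rho_{m,n}\colon A_m\otimes A_n\to A_{m+n}$ is a homomorphism of unital algebras; via $\rho_{m,n}$, $A_{m+n}$ is projective as a left and as a right $(A_m\otimes A_n)$-module; and for every $n$ the pairing $K_0(A_n)\times G_0(A_n)\to\mathbb Z$ is perfect, i.e. it induces an isomorphism $K_0(A_n)\to\operatorname{Hom}(G_0(A_n),\mathbb Z)$. Write $A\text{-mod}^{\otimes r}=\bigoplus_{n_1,\dots,n_r}(A_{n_1}\otimes\cdots\otimes A_{n_r})\text{-mod}$ (finitely generated left modules). Let $\nabla\colon A\text{-mod}^{\otimes2}\to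 A\text{-mod}$ be induction, with components $\operatorname{Ind}_{A_m\otimes A_n}^{A_{m+n}}$, and $\Delta\colon A\text{-mod}\to A\text{-mod}^{\otimes 2}$ restriction, $\Delta|_{A_n\text{-mod}}=\bigoplus_{k+\ell=n}\operatorname{Res}^{A_n}_{A_k\otimes A_\ell}$. Let $\eta(V)=V\in A_0\text{-mod}$ for a finite dimensional vector space $V$, and let $\varepsilon$ be the identity on $A_0\text{-mod}$ and $0$ on $A_n\text{-mod}$, $n>0$. Algebra automorphisms $\psi_n$ of $A_n$ ($n\ge0$) define, by twisting actions, an automorphism $\Psi$ of $A\text{-mod}$, preserving projectives, and similarly $\Psi^{\otimes 2}$. The tower is *strong with conjugation $\Psi$* if $\nabla$ is right adjoint to $\Psi^{\otimes2}\Delta\Psi^{-1}$ and there is an isomorphism of functors $\Delta\nabla\cong\nabla^{\otimes2}S_{23}\Delta^{\otimes2}$, where $S_{23}$ interchanges the second and third tensor factors. Let $\mathcal G(A)=\bigoplus_nG_0(A_n)$ and $\mathcal K(A)=\bigoplus_nK_0(A_n)$, with the multiplication, comultiplication, unit and counit induced by $\nabla,\Delta,\eta,\varepsilon$ (using $G_0(A_k)\otimes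 G_0(A_\ell)\cong G_0(A_k\otimes A_\ell)$ and likewise for $K_0$), and with the form $\langle\cdot,\cdot\rangle\colon\mathcal K(A)\times\mathcal G(A)\to\mathbb Z$ given by the pairings above, classes in different degrees being orthogonal. The tower is *dualizing* if $\mathcal K(A)$ and $\mathcal G(A)$, with these operations, are graded connected Hopf algebras over $\mathbb Z$ (with finitely generated free graded pieces) and the form is a Hopf pairing that identifies each of them with the graded dual of the other. **Proposition.** Suppose $A$ is a strong tower of algebras with conjugation $\Psi$. Then the following are equivalent: 1. the tower $A$ is dualizing; 2. $\Psi^{\otimes2}\Delta\Psi^{-1}(P)\cong\Delta(P)$ for every finitely generated projective $P\in A\text{-mod}$; 3. $\Psi^{\otimes2}\Delta\Psi^{-1}=\Delta$ as maps $\mathcal K(A)\to\mathcal K(A)\otimes\mathcal K(A)$. In particular, $A$ is dualizing if each $A_n$ is a symmetric algebra; also if every $\psi_n$ is the identity; and, more generally, if $\Psi$ acts trivially on $\mathcal K(A)$. -/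

import Mathlib

open CategoryTheory TensorProduct

universe u

namespace AlgTower

noncomputable section

section Balanced

variable {B A : Type u} [Ring B] [Ring A] (φ : B →+* A)

/-- The `A`-submodule of `A ⊗[ℤ] N` generated by the elements `a φ(b) ⊗ n - a ⊗ b n`. -/
def balancedRel (N : Type u) [AddCommGroup N] [Module B N] : Submodule A (A ⊗[ℤ] N) :=
  Submodule.span A {x | ∃ (a : A) (b : B) (n : N), x = (a * φ b) ⊗ₜ[ℤ] n - a ⊗ₜ[ℤ] (b • n)}

/-- The left `A`-module `A ⊗_B N`, where `A` is a right `B`-module through `φ : B → A`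
(the rings need not be commutative). -/
def BalancedTensor (N : Type u) [AddCommGroup N] [Module B N] : Type u :=
  (A ⊗[ℤ] N) ⧸ balancedRel φ N

variable {N N' N'' M : Type u} [AddCommGroup N] [Module B N] [AddCommGroup N'] [Module B N']
  [AddCommGroup N''] [Module B N''] [AddCommGroup M] [Module A M]

instance : AddCommGroup (BalancedTensor φ N) :=
  inferInstanceAs (AddCommGroup ((A ⊗[ℤ] N) ⧸ balancedRel φ N))

instance : Module A (BalancedTensor φ N) :=
  inferInstanceAs (Module A ((A ⊗[ℤ] N) ⧸ balancedRel φ N))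

namespace BalancedTensor

/-- The class of `a ⊗ n` in `A ⊗_B N`. -/
def tmul (a : A) (n : N) : BalancedTensor φ N := (balancedRel φ N).mkQ (a ⊗ₜ[ℤ] n)

theorem tmul_add (a : A) (n n' : N) : tmul φ a (n + n') = tmul φ a n + tmul φ a n' := by
  simp only [tmul, TensorProduct.tmul_add, map_add]; rfl

theorem add_tmul (a a' : A) (n : N) : tmul φ (a + a') n = tmul φ a n + tmul φ a' n := by
  simp only [tmul, TensorProduct.add_tmul, map_add]; rfl

theorem smul_tmul' (c a : A) (n : N) : c • tmul φ a n = tmul φ (c * a) n := by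
  have : (c * a) ⊗ₜ[ℤ] n = c • (a ⊗ₜ[ℤ] n) := by rw [TensorProduct.smul_tmul', smul_eq_mul]
  rw [tmul, tmul, this, map_smul]; rfl

theorem mul_tmul (a : A) (b : B) (n : N) : tmul φ (a * φ b) n = tmul φ a (b • n) := by
  have h : (a * φ b) ⊗ₜ[ℤ] n - a ⊗ₜ[ℤ] (b • n) ∈ balancedRel φ N :=
    Submodule.subset_span ⟨a, b, n, rfl⟩
  exact (Submodule.Quotient.eq _).2 h

@[elab_as_elim]
theorem induction_on {P : BalancedTensor φ N → Prop} (x : BalancedTensor φ N)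
    (zero : P 0) (tm : ∀ a n, P (tmul φ a n)) (add : ∀ x y, P x → P y → P (x + y)) : P x := by
  obtain ⟨y, rfl⟩ := Submodule.mkQ_surjective (balancedRel φ N) x
  induction y with
  | zero => rw [map_zero]; exact zero
  | tmul a n => exact tm a n
  | add y z hy hz => rw [map_add]; exact add _ _ hy hz

/-- Universal property: a `φ`-semilinear map `N → M` into an `A`-module extends to `A ⊗_B N`. -/
def lift (g : N →+ M) (hg : ∀ b n, g (b • n) = φ b • g n) : BalancedTensor φ N →ₗ[A] M :=
  (balancedRel φ N).liftQ
    (TensorProduct.AlgebraTensorModule.lift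
      { toFun := fun a => a • g.toIntLinearMap
        map_add' := fun a a' => by ext n; simp [add_smul]
        map_smul' := fun c a => by ext n; simp [mul_smul] })
    (by
      rw [balancedRel, Submodule.span_le]
      rintro _ ⟨a, b, n, rfl⟩
      simp [hg, mul_smul])

@[simp] theorem lift_tmul (g : N →+ M) (hg : ∀ b n, g (b • n) = φ b • g n) (a : A) (n : N) :
    lift φ g hg (tmul φ a n) = a • g n := by
  rfl

/-- Functoriality of `A ⊗_B N` in `N`. -/
def map (f : N →ₗ[B] N') : BalancedTensor φ N →ₗ[A] BalancedTensor φ N' :=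
  lift φ
    { toFun := fun n => tmul φ 1 (f n)
      map_zero' := by
        have := tmul_add φ (1 : A) (0 : N') 0
        simpa using this
      map_add' := fun n n' => by rw [map_add, tmul_add] }
    (fun b n => by
      change tmul φ 1 (f (b • n)) = φ b • tmul φ 1 (f n)
      rw [map_smul, ← mul_tmul, smul_tmul', one_mul, mul_one])

@[simp] theorem map_tmul (f : N →ₗ[B] N') (a : A) (n : N) :
    map φ f (tmul φ a n) = tmul φ a (f n) := by
  change a • tmul φ 1 (f n) = _
  rw [smul_tmul', mul_one]

theorem map_id : map φ (LinearMap.id : N →ₗ[B] N) = LinearMap.id := by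
  ext x
  induction x using induction_on with
  | zero => simp
  | tm a n => simp
  | add x y hx hy => simp only [map_add, hx, hy]

theorem map_comp (f : N →ₗ[B] N') (g : N' →ₗ[B] N'') : map φ (g ∘ₗ f) = map φ g ∘ₗ map φ f := by
  ext x
  induction x using induction_on with
  | zero => simp
  | tm a n => simp
  | add x y hx hy => simp only [map_add, hx, hy]

theorem finite [Module.Finite B N] : Module.Finite A (BalancedTensor φ N) := by
  obtain ⟨s, hs⟩ := (Module.finite_def (R := B) (M := N)).1 inferInstance
  classical
  refine ⟨⟨s.image (fun n => tmul φ 1 n), ?_⟩⟩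
  rw [eq_top_iff]
  rintro x -
  induction x using induction_on with
  | zero => exact zero_mem _
  | add x y hx hy => exact add_mem hx hy
  | tm a n =>
    have hn : n ∈ Submodule.span B (s : Set N) := hs ▸ Submodule.mem_top
    have key : tmul φ (1 : A) n ∈
        Submodule.span A ((s.image (fun n => tmul φ (1 : A) n) : Finset _) : Set _) := by
      induction hn using Submodule.span_induction with
      | mem x hx => exact Submodule.subset_span (by simpa using ⟨x, hx, rfl⟩)
      | zero =>
        have := tmul_add φ (1 : A) (0 : N) 0
        rw [add_zero, left_eq_add] at this
        rw [this]; exact zero_mem _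
      | add x y _ _ hx hy => rw [tmul_add]; exact add_mem hx hy
      | smul b x _ hx =>
        rw [← mul_tmul, one_mul, ← mul_one (φ b), ← smul_tmul']
        exact Submodule.smul_mem _ _ hx
    rw [← mul_one a, ← smul_tmul']
    exact Submodule.smul_mem _ _ key

theorem projective [Module.Projective B N] : Module.Projective A (BalancedTensor φ N) := by
  refine Module.Projective.of_lifting_property'' (fun f hf => ?_)
  let _ : Module B (BalancedTensor φ N →₀ A) := Module.compHom _ φ
  let _ : Module B (BalancedTensor φ N) := Module.compHom _ φ
  let fB : (BalancedTensor φ N →₀ A) →ₗ[B] BalancedTensor φ N :=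
    { toFun := f, map_add' := map_add f, map_smul' := fun b x => map_smul f (φ b) x }
  let ι : N →ₗ[B] BalancedTensor φ N :=
    { toFun := fun n => tmul φ 1 n
      map_add' := tmul_add φ 1
      map_smul' := fun b n => by
        change tmul φ 1 (b • n) = φ b • tmul φ 1 n
        rw [← mul_tmul, smul_tmul', one_mul, mul_one] }
  obtain ⟨g, hg⟩ := Module.projective_lifting_property fB ι hf
  refine ⟨lift φ g.toAddMonoidHom (fun b n => g.map_smul b n), ?_⟩
  ext x
  induction x using induction_on with
  | zero => simp
  | add x y hx hy => simp only [map_add, hx, hy]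
  | tm a n =>
    have h1 : f (g n) = tmul φ 1 n := LinearMap.congr_fun hg n
    change f (a • g n) = _
    rw [map_smul, h1, smul_tmul', mul_one]; rfl

end BalancedTensor

/-- `A` is projective as a left and as a right `B`-module, `B` acting through `φ`. -/
structure IsBiprojective : Prop where
  left : @Module.Projective B _ A _ (Module.compHom A φ)
  right : @Module.Projective Bᵐᵒᵖ _ A _ (Module.compHom A (RingHom.op φ))

namespace BalancedTensor

variable {φ}

theorem exists_section (hφ : IsBiprojective φ) :
    ∃ s : A → A →₀ B, (∀ a a', s (a + a') = s a + s a') ∧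
      (∀ a b x, s (a * φ b) x = s a x * b) ∧ (∀ a, (s a).sum (fun x b => x * φ b) = a) := by
  let _ : Module Bᵐᵒᵖ A := Module.compHom A (RingHom.op φ)
  obtain ⟨s, hs⟩ := (Module.projective_def' (R := Bᵐᵒᵖ) (P := A)).1 hφ.right
  refine ⟨fun a => (s a).mapRange MulOpposite.unop rfl, fun a a' => ?_, fun a b x => ?_,
    fun a => ?_⟩
  · ext x; simp
  · have : a * φ b = MulOpposite.op b • a := rfl
    simp only [this, map_smul, Finsupp.mapRange_apply, Finsupp.smul_apply]; rfl
  · have h := LinearMap.congr_fun hs a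
    rw [LinearMap.comp_apply, Finsupp.linearCombination_apply] at h
    rw [Finsupp.sum_mapRange_index (by simp)]
    exact h

theorem tmul_zero (a : A) : tmul φ a (0 : N) = 0 := by
  have := tmul_add φ a (0 : N) 0
  rwa [add_zero, left_eq_add] at this

theorem zero_tmul (n : N) : tmul φ (0 : A) n = 0 := by
  have := add_tmul φ (0 : A) 0 n
  rwa [add_zero, left_eq_add] at this

/-- Finite sums `∑ x ⊗ n_x`. -/
def ofFinsupp : (A →₀ N) →+ BalancedTensor φ N :=
  Finsupp.liftAddHom fun x =>
    { toFun := fun n => tmul φ x n, map_zero' := tmul_zero x, map_add' := tmul_add φ x }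

/-- If `A` is right `B`-projective then, naturally in `N`, the group `A ⊗_B N` is a direct summand
of a direct sum of copies of `N`; hence `A ⊗_B -` is exact. -/
theorem exists_retract (hφ : IsBiprojective φ) :
    ∃ t : ∀ (N : Type u) [AddCommGroup N] [Module B N], BalancedTensor φ N →+ (A →₀ N),
      (∀ (N : Type u) [AddCommGroup N] [Module B N] (y : BalancedTensor φ N),
        ofFinsupp (t N y) = y) ∧
      (∀ (N N' : Type u) [AddCommGroup N] [Module B N] [AddCommGroup N'] [Module B N']
        (f : N →ₗ[B] N') (y : BalancedTensor φ N) (x : A), t N' (map φ f y) x = f (t N y x)) := by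
  obtain ⟨s, hadd, hmul, hsum⟩ := exists_section hφ
  have hs0 : s 0 = 0 := by simpa using hadd 0 0
  let t0 : ∀ (N : Type u) [AddCommGroup N] [Module B N], A ⊗[ℤ] N →+ (A →₀ N) :=
    fun N _ _ => TensorProduct.liftAddHom
      { toFun := fun a =>
          { toFun := fun n => (s a).mapRange (fun b => b • n) (zero_smul _ _)
            map_zero' := by ext x; simp
            map_add' := fun n n' => by ext x; simp }
        map_zero' := by ext n x; simp [hs0]
        map_add' := fun a a' => by ext n x; simp [hadd, add_smul] }
      (fun r a n => by
        let F : A →+ (A →₀ N) :=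
          { toFun := fun a => (s a).mapRange (fun b => b • n) (zero_smul _ _)
            map_zero' := by ext x; simp [hs0]
            map_add' := fun a a' => by ext x; simp [hadd, add_smul] }
        let G : N →+ (A →₀ N) :=
          { toFun := fun n => (s a).mapRange (fun b => b • n) (zero_smul _ _)
            map_zero' := by ext x; simp
            map_add' := fun n n' => by ext x; simp }
        exact (map_zsmul F r a).trans (map_zsmul G r n).symm)
  have ht0 : ∀ (N : Type u) [AddCommGroup N] [Module B N] (a : A) (n : N) (x : A),
      t0 N (a ⊗ₜ n) x = s a x • n := fun N _ _ a n x => rfl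
  have hrel : ∀ (N : Type u) [AddCommGroup N] [Module B N] (y : A ⊗[ℤ] N),
      y ∈ balancedRel φ N → ∀ c : A, t0 N (c • y) = 0 := by
    intro N _ _ y hy
    induction hy using Submodule.span_induction with
    | mem y hy =>
      obtain ⟨a, b, n, rfl⟩ := hy
      intro c
      rw [smul_sub, TensorProduct.smul_tmul', TensorProduct.smul_tmul', map_sub, sub_eq_zero]
      ext x
      rw [ht0, ht0, smul_eq_mul, smul_eq_mul, ← mul_assoc, hmul, mul_smul]
    | zero => intro c; simp
    | add x y _ _ hx hy => intro c; rw [smul_add, map_add, hx, hy, add_zero]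
    | smul d x _ hx => intro c; rw [← mul_smul]; exact hx _
  let t : ∀ (N : Type u) [AddCommGroup N] [Module B N], BalancedTensor φ N →+ (A →₀ N) :=
    fun N _ _ => QuotientAddGroup.lift (balancedRel φ N).toAddSubgroup (t0 N)
      (fun y hy => by simpa using hrel N y hy 1)
  have ht : ∀ (N : Type u) [AddCommGroup N] [Module B N] (a : A) (n : N) (x : A),
      t N (tmul φ a n) x = s a x • n := fun N _ _ a n x => rfl
  refine ⟨t, ?_, ?_⟩
  · intro N _ _ y
    induction y using induction_on with
    | zero => rw [map_zero, map_zero]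
    | add x y hx hy => rw [map_add, map_add, hx, hy]
    | tm a n =>
      have h1 : t N (tmul φ a n) = (s a).mapRange (fun b => b • n) (zero_smul _ _) := rfl
      rw [h1, ofFinsupp, Finsupp.liftAddHom_apply,
        Finsupp.sum_mapRange_index (fun x => AddMonoidHom.map_zero _)]
      let H : A →+ BalancedTensor φ N :=
        { toFun := fun a => tmul φ a n, map_zero' := zero_tmul n,
          map_add' := fun a a' => add_tmul φ a a' n }
      have h2 : H ((s a).sum fun x b => x * φ b) = H a := by rw [hsum]
      rw [Finsupp.sum, map_sum] at h2
      refine Eq.trans (Finset.sum_congr rfl fun x _ => ?_) h2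
      exact (mul_tmul φ x (s a x) n).symm
  · intro N N' _ _ _ _ f y x
    induction y using induction_on with
    | zero => simp
    | add y z hy hz => simp only [map_add, Finsupp.add_apply, hy, hz]
    | tm a n => rw [map_tmul, ht, ht, map_smul]

theorem map_injective (hφ : IsBiprojective φ) (f : N →ₗ[B] N') (hf : Function.Injective f) :
    Function.Injective (map φ f) := by
  obtain ⟨t, h1, h2⟩ := exists_retract hφ
  rw [injective_iff_map_eq_zero]
  intro y hy
  have h3 : t N y = 0 := by
    ext x
    refine hf ?_
    rw [← h2, hy]; simp
  rw [← h1 N y, h3, map_zero]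

theorem map_surjective (f : N →ₗ[B] N') (hf : Function.Surjective f) :
    Function.Surjective (map φ f) := by
  intro y
  induction y using induction_on with
  | zero => exact ⟨0, map_zero _⟩
  | tm a n => obtain ⟨m, rfl⟩ := hf n; exact ⟨tmul φ a m, map_tmul φ f a m⟩
  | add y z hy hz =>
    obtain ⟨y', rfl⟩ := hy; obtain ⟨z', rfl⟩ := hz
    exact ⟨y' + z', map_add _ _ _⟩

theorem map_exact (hφ : IsBiprojective φ) (f : N →ₗ[B] N') (g : N' →ₗ[B] N'')
    (h : Function.Exact f g) : Function.Exact (map φ f) (map φ g) := by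
  intro y
  constructor
  · intro hy
    obtain ⟨t, h1, h2⟩ := exists_retract hφ
    have h3 : ∀ x, t N' y x ∈ Set.range f := fun x => by
      rw [← h, ← h2, hy]; simp
    change y ∈ LinearMap.range (map φ f)
    rw [← h1 N' y, ofFinsupp, Finsupp.liftAddHom_apply]
    refine Submodule.sum_mem _ fun x _ => ?_
    obtain ⟨n, hn⟩ := h3 x
    exact ⟨tmul φ x n, by rw [map_tmul, hn]; rfl⟩
  · rintro ⟨x, rfl⟩
    rw [← LinearMap.comp_apply, ← map_comp, show g ∘ₗ f = 0 from
      LinearMap.ext fun z => (h _).2 ⟨z, rfl⟩]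
    induction x using induction_on with
    | zero => simp
    | tm a n => rw [map_tmul, LinearMap.zero_apply, tmul_zero]
    | add x y hx hy => rw [map_add, hx, hy, add_zero]

end BalancedTensor
end Balanced

/-! ### Notation for linear maps

The abbreviations fix, once and for all, the module structures on direct sums, tensor products
and spaces of linear maps, also for `k = ℤ`. -/

section Abbreviations

universe v w

open DirectSum

/-- Bilinear maps. -/
abbrev Bilin (k : Type v) [CommRing k] (V W X : Type*) [AddCommGroup V] [Module k V]
    [AddCommGroup W] [Module k W] [AddCommGroup X] [Module k X] := V →ₗ[k] W →ₗ[k] X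

/-- Linear maps from a tensor product. -/
abbrev TensorHom (k : Type v) [CommRing k] (V W X : Type*) [AddCommGroup V] [Module k V]
    [AddCommGroup W] [Module k W] [AddCommGroup X] [Module k X] := V ⊗[k] W →ₗ[k] X

/-- Linear endomorphisms of `⨁ H_n`. -/
abbrev GradedEnd (k : Type v) [CommRing k] (H : ℕ → Type w) [∀ n, AddCommGroup (H n)]
    [∀ n, Module k (H n)] := (⨁ n, H n) →ₗ[k] (⨁ n, H n)

/-- Linear maps from `⨁ H_n` to its tensor square. -/
abbrev GradedComul (k : Type v) [CommRing k] (H : ℕ → Type w) [∀ n, AddCommGroup (H n)]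
    [∀ n, Module k (H n)] := (⨁ n, H n) →ₗ[k] (⨁ n, H n) ⊗[k] (⨁ n, H n)

/-- Bilinear forms on `(⨁ H'_n) × (⨁ H_n)`. -/
abbrev GradedForm (k : Type v) [CommRing k] (H' H : ℕ → Type w) [∀ n, AddCommGroup (H' n)]
    [∀ n, Module k (H' n)] [∀ n, AddCommGroup (H n)] [∀ n, Module k (H n)] :=
  (⨁ n, H' n) →ₗ[k] (⨁ n, H n) →ₗ[k] k

/-- A biadditive map as a bilinear map over `ℤ`. -/
def intBilin {V W X : Type*} [AddCommGroup V] [AddCommGroup W] [AddCommGroup X]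
    (f : V →+ W →+ X) : Bilin ℤ V W X :=
  LinearMap.mk₂ ℤ (fun v w => f v w) (fun _ _ _ => by rw [map_add]; rfl)
    (fun _ _ _ => by rw [map_zsmul]; rfl) (fun _ _ _ => map_add _ _ _)
    (fun _ _ _ => map_zsmul _ _ _)

end Abbreviations

/-! ### Finitely generated modules: induction, restriction, outer tensor product -/

section Functors

variable {F : Type u} [Field F]

/-- The `F`-vector space underlying a module over an `F`-algebra. -/
local instance (B : Type u) [Ring B] [Algebra F B] (M : FGModuleCat.{u} B) : Module F M :=
  ModuleCat.moduleOfAlgebraModule M.obj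

local instance (B : Type u) [Ring B] [Algebra F B] (M : FGModuleCat.{u} B) : IsScalarTower F B M :=
  ModuleCat.isScalarTower_of_algebra_moduleCat M.obj

theorem finite_over_field (B : Type u) [Ring B] [Algebra F B] [Module.Finite F B]
    (M : FGModuleCat.{u} B) : Module.Finite F M :=
  Module.Finite.trans B M

/-- The induction functor `N ↦ A ⊗_B N` on finitely generated modules. -/
def Ind {B A : Type u} [Ring B] [Ring A] (φ : B →+* A) : FGModuleCat.{u} B ⥤ FGModuleCat.{u} A where
  obj N := ⟨ModuleCat.of A (BalancedTensor φ N), BalancedTensor.finite φ⟩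
  map f := ObjectProperty.homMk (ModuleCat.ofHom (BalancedTensor.map φ f.hom.hom))
  map_id N := by
    apply FGModuleCat.hom_ext
    exact BalancedTensor.map_id φ
  map_comp f g := by
    apply FGModuleCat.hom_ext
    exact BalancedTensor.map_comp φ f.hom.hom g.hom.hom

variable {B C A : Type u} [Ring B] [Algebra F B] [Ring C] [Algebra F C] [Ring A] [Algebra F A]

theorem finite_restrict [Module.Finite F A] (φ : B →ₐ[F] A) (M : FGModuleCat.{u} A) :
    Module.Finite B ((ModuleCat.restrictScalars φ.toRingHom).obj M.obj) := by
  obtain ⟨s, hs⟩ := (Module.finite_def (R := F) (M := M)).1 (finite_over_field A M)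
  refine ⟨⟨s, ?_⟩⟩
  rw [eq_top_iff]
  intro (x : M) hx0
  clear hx0
  have hx : (x : M) ∈ Submodule.span F (s : Set M) := hs ▸ Submodule.mem_top
  induction hx using Submodule.span_induction with
  | mem x hx => exact Submodule.subset_span hx
  | zero => exact zero_mem _
  | add x y _ _ hx hy => exact add_mem hx hy
  | smul c x _ hx =>
    have : c • x = (show M from (algebraMap F B c) •
        (show (ModuleCat.restrictScalars φ.toRingHom).obj M.obj from x)) := by
      change c • x = φ (algebraMap F B c) • x
      rw [φ.commutes, algebraMap_smul]
    rw [this]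
    exact Submodule.smul_mem _ _ hx

/-- The restriction functor along `φ : B → A` on finitely generated modules, for a finite
dimensional algebra `A`. -/
def Res [Module.Finite F A] (φ : B →ₐ[F] A) : FGModuleCat.{u} A ⥤ FGModuleCat.{u} B :=
  ObjectProperty.lift _ (ObjectProperty.ι _ ⋙ ModuleCat.restrictScalars φ.toRingHom)
    (finite_restrict φ)

/-- The finite direct sum of functors into finitely generated modules. -/
def directSumFunctor {𝒞 : Type*} [Category 𝒞] {ι : Type} [Finite ι] (G : ι → 𝒞 ⥤ FGModuleCat.{u} B) :
    𝒞 ⥤ FGModuleCat.{u} B where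
  obj X := FGModuleCat.of B (∀ i, (G i).obj X)
  map f := FGModuleCat.ofHom (LinearMap.pi fun i => ((G i).map f).hom.hom ∘ₗ LinearMap.proj i)
  map_id X := by
    apply FGModuleCat.hom_ext
    refine LinearMap.ext fun x => funext fun i => ?_
    change ((G i).map (𝟙 X)).hom.hom (x i) = x i
    rw [(G i).map_id]; rfl
  map_comp f g := by
    apply FGModuleCat.hom_ext
    refine LinearMap.ext fun x => funext fun i => ?_
    change ((G i).map (f ≫ g)).hom.hom (x i) = ((G i).map g).hom.hom (((G i).map f).hom.hom (x i))
    rw [(G i).map_comp]; rfl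

/-- The action of `B ⊗ C` on `M ⊗ N` given by `(b ⊗ c) (m ⊗ n) = b m ⊗ c n`. -/
def outerAction (M N : Type u) [AddCommGroup M] [Module F M] [Module B M] [IsScalarTower F B M]
    [AddCommGroup N] [Module F N] [Module C N] [IsScalarTower F C N] :
    B ⊗[F] C →ₐ[F] Module.End F (M ⊗[F] N) :=
  (Module.endTensorEndAlgHom (R := F) (S := F) (A := F) (M := M) (N := N)).comp
    (Algebra.TensorProduct.map (Algebra.lsmul F F M) (Algebra.lsmul F F N))

/-- The module structure on `M ⊗ N` over `B ⊗ C` given by `outerAction`. -/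
@[reducible] def outerModule (M N : Type u) [AddCommGroup M] [Module F M] [Module B M] [IsScalarTower F B M]
    [AddCommGroup N] [Module F N] [Module C N] [IsScalarTower F C N] :
    Module (B ⊗[F] C) (M ⊗[F] N) :=
  Module.compHom _ (outerAction (F := F) (B := B) (C := C) M N).toRingHom

attribute [local instance] outerModule

section
variable {M N M' N' M'' N'' : Type u}
  [AddCommGroup M] [Module F M] [Module B M] [IsScalarTower F B M]
  [AddCommGroup M'] [Module F M'] [Module B M'] [IsScalarTower F B M']
  [AddCommGroup N] [Module F N] [Module C N] [IsScalarTower F C N]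
  [AddCommGroup N'] [Module F N'] [Module C N'] [IsScalarTower F C N']

theorem outer_smul_tmul (b : B) (c : C) (m : M) (n : N) :
    (b ⊗ₜ[F] c : B ⊗[F] C) • (m ⊗ₜ[F] n : M ⊗[F] N) = (b • m) ⊗ₜ[F] (c • n) := rfl

theorem outer_zero_smul (x : M ⊗[F] N) : (0 : B ⊗[F] C) • x = 0 := zero_smul _ _

theorem outer_isScalarTower : IsScalarTower F (B ⊗[F] C) (M ⊗[F] N) where
  smul_assoc r x y := by
    change outerAction M N (r • x) y = r • outerAction M N x y
    rw [map_smul]; rfl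

/-- The outer tensor product of two module homomorphisms. -/
def outerMap (f : M →ₗ[B] M') (g : N →ₗ[C] N') :
    M ⊗[F] N →ₗ[B ⊗[F] C] M' ⊗[F] N' where
  toFun := TensorProduct.map (f.restrictScalars F) (g.restrictScalars F)
  map_add' := map_add _
  map_smul' r x := by
    induction x with
    | zero => simp
    | add x y hx hy => simp only [smul_add, map_add, hx, hy]
    | tmul m n =>
      induction r with
      | zero => simp
      | add r s hr hs => simp only [add_smul, map_add, hr, hs]
      | tmul b c =>
        simp only [RingHom.id_apply, outer_smul_tmul, TensorProduct.map_tmul,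
          LinearMap.restrictScalars_apply, map_smul]

theorem outer_finite [Module.Finite F M] [Module.Finite F N] :
    Module.Finite (B ⊗[F] C) (M ⊗[F] N) :=
  have := outer_isScalarTower (F := F) (B := B) (C := C) (M := M) (N := N)
  Module.Finite.of_restrictScalars_finite F _ _

theorem outer_projective [Module.Projective B M] [Module.Projective C N] :
    Module.Projective (B ⊗[F] C) (M ⊗[F] N) := by
  obtain ⟨s, hs⟩ := (Module.projective_def' (R := B) (P := M)).1 inferInstance
  obtain ⟨t, ht⟩ := (Module.projective_def' (R := C) (P := N)).1 inferInstance
  let e := finsuppTensorFinsupp F F B C M N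
  have he : ∀ (r : B ⊗[F] C) x, e (r • x) = r • e x := by
    intro r x
    induction x with
    | zero => simp
    | add x y hx hy => simp only [smul_add, map_add, hx, hy]
    | tmul m n =>
      induction r with
      | zero =>
        have h0 : (0 : B ⊗[F] C) • (m ⊗ₜ[F] n : (M →₀ B) ⊗[F] (N →₀ C)) = 0 := outer_zero_smul _
        rw [h0, zero_smul, map_zero]
      | add r s hr hs => simp only [add_smul, map_add, hr, hs]
      | tmul b c =>
        rw [outer_smul_tmul]
        ext ⟨i, j⟩
        simp [e, finsuppTensorFinsupp_apply]
  let e' : (M →₀ B) ⊗[F] (N →₀ C) ≃ₗ[B ⊗[F] C] (M × N →₀ B ⊗[F] C) :=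
    { e with map_smul' := he }
  have : Module.Projective (B ⊗[F] C) ((M →₀ B) ⊗[F] (N →₀ C)) :=
    Module.Projective.of_equiv e'.symm
  refine Module.Projective.of_split (outerMap s t)
    (outerMap (Finsupp.linearCombination B id) (Finsupp.linearCombination C id)) ?_
  ext x
  induction x with
  | zero => simp
  | add x y hx hy => simp only [map_add, hx, hy]
  | tmul m n =>
    have h1 : Finsupp.linearCombination B id (s m) = m := LinearMap.congr_fun hs m
    have h2 : Finsupp.linearCombination C id (t n) = n := LinearMap.congr_fun ht n
    change (Finsupp.linearCombination B id (s m)) ⊗ₜ[F] (Finsupp.linearCombination C id (t n)) = _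
    rw [h1, h2]; rfl

end

/-- The outer tensor product `M ⊗ N`, a module over `B ⊗ C`. -/
def outer [Module.Finite F B] [Module.Finite F C] (M : FGModuleCat.{u} B) (N : FGModuleCat.{u} C) :
    FGModuleCat.{u} (B ⊗[F] C) :=
  have := finite_over_field (F := F) B M
  have := finite_over_field (F := F) C N
  ⟨ModuleCat.of (B ⊗[F] C) (M ⊗[F] N), outer_finite⟩

/-! ### Grothendieck groups -/

/-- `0 → M' → M → M'' → 0` is exact. -/
structure IsShortExact {R : Type u} [Ring R] {M' M M'' : Type u} [AddCommGroup M'] [Module R M']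
    [AddCommGroup M] [Module R M] [AddCommGroup M''] [Module R M'']
    (i : M' →ₗ[R] M) (p : M →ₗ[R] M'') : Prop where
  injective : Function.Injective i
  exact : Function.Exact i p
  surjective : Function.Surjective p

/-- The relations `[M] = [M'] + [M'']` for short exact sequences `0 → M' → M → M'' → 0`. -/
def G0Rel (B : Type u) [Ring B] : AddSubgroup (FreeAbelianGroup (FGModuleCat.{u} B)) :=
  AddSubgroup.closure {x | ∃ (M' M M'' : FGModuleCat.{u} B) (i : M' →ₗ[B] M) (p : M →ₗ[B] M''),
    IsShortExact i p ∧
      x = FreeAbelianGroup.of M - (FreeAbelianGroup.of M' + FreeAbelianGroup.of M'')}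

/-- The Grothendieck group of the category of finitely generated left `B`-modules. -/
def G0 (B : Type u) [Ring B] : Type (u + 1) :=
  FreeAbelianGroup (FGModuleCat.{u} B) ⧸ G0Rel B

instance (B : Type u) [Ring B] : AddCommGroup (G0 B) :=
  inferInstanceAs (AddCommGroup (FreeAbelianGroup (FGModuleCat.{u} B) ⧸ G0Rel B))

/-- Finitely generated projective left `B`-modules. -/
abbrev FGProj (B : Type u) [Ring B] : Type (u + 1) :=
  {P : FGModuleCat.{u} B // Module.Projective B P}

instance (B : Type u) [Ring B] (P : FGProj B) : Module.Projective B P.1 := P.2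

/-- The relations `[P] = [P'] + [P'']` for `P ≅ P' ⊕ P''`. -/
def K0Rel (B : Type u) [Ring B] : AddSubgroup (FreeAbelianGroup (FGProj B)) :=
  AddSubgroup.closure {x | ∃ P' P P'' : FGProj B, Nonempty (P.1 ≃ₗ[B] P'.1 × P''.1) ∧
      x = FreeAbelianGroup.of P - (FreeAbelianGroup.of P' + FreeAbelianGroup.of P'')}

/-- The split Grothendieck group of the category of finitely generated projective left
`B`-modules. -/
def K0 (B : Type u) [Ring B] : Type (u + 1) :=
  FreeAbelianGroup (FGProj B) ⧸ K0Rel B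

instance (B : Type u) [Ring B] : AddCommGroup (K0 B) :=
  inferInstanceAs (AddCommGroup (FreeAbelianGroup (FGProj B) ⧸ K0Rel B))

section Groth

variable {R : Type u} [Ring R] {X : Type*} [AddCommGroup X]

/-- The class `[M]`. -/
def G0.cls (M : FGModuleCat.{u} R) : G0 R :=
  QuotientAddGroup.mk' (G0Rel R) (FreeAbelianGroup.of M)

/-- The class `[P]`. -/
def K0.cls (P : FGProj R) : K0 R :=
  QuotientAddGroup.mk' (K0Rel R) (FreeAbelianGroup.of P)

/-- The homomorphism on `G0` determined by a function additive on short exact sequences. -/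
def G0.lift (f : FGModuleCat.{u} R → X)
    (hf : ∀ (M' M M'' : FGModuleCat.{u} R) (i : M' →ₗ[R] M) (p : M →ₗ[R] M''),
      IsShortExact i p → f M = f M' + f M'') : G0 R →+ X :=
  QuotientAddGroup.lift (G0Rel R) (FreeAbelianGroup.lift f) (by
    rw [G0Rel, AddSubgroup.closure_le]
    rintro _ ⟨M', M, M'', i, p, h, rfl⟩
    simp [hf M' M M'' i p h])

/-- The homomorphism on `K0` determined by a function additive on direct sums. -/
def K0.lift (f : FGProj R → X)
    (hf : ∀ P' P P'' : FGProj R, (P.1 ≃ₗ[R] P'.1 × P''.1) → f P = f P' + f P'') : K0 R →+ X :=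
  QuotientAddGroup.lift (K0Rel R) (FreeAbelianGroup.lift f) (by
    rw [K0Rel, AddSubgroup.closure_le]
    rintro _ ⟨P', P, P'', ⟨e⟩, rfl⟩
    simp [hf P' P P'' e])

@[simp] theorem G0.lift_cls (f : FGModuleCat.{u} R → X) (hf) (M : FGModuleCat.{u} R) :
    G0.lift f hf (G0.cls M) = f M :=
  FreeAbelianGroup.lift_apply_of f M

@[simp] theorem K0.lift_cls (f : FGProj R → X) (hf) (P : FGProj R) :
    K0.lift f hf (K0.cls P) = f P :=
  FreeAbelianGroup.lift_apply_of f P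

theorem G0.hom_ext {f g : G0 R →+ X} (h : ∀ M, f (G0.cls M) = g (G0.cls M)) : f = g :=
  QuotientAddGroup.addMonoidHom_ext _ (FreeAbelianGroup.lift_ext _ _ h)

theorem K0.hom_ext {f g : K0 R →+ X} (h : ∀ P, f (K0.cls P) = g (K0.cls P)) : f = g :=
  QuotientAddGroup.addMonoidHom_ext _ (FreeAbelianGroup.lift_ext _ _ h)

theorem G0.cls_eq {M' M M'' : FGModuleCat.{u} R} {i : M' →ₗ[R] M} {p : M →ₗ[R] M''}
    (h : IsShortExact i p) : G0.cls M = G0.cls M' + G0.cls M'' := by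
  rw [← sub_eq_zero]
  exact (QuotientAddGroup.eq_zero_iff _).2 (AddSubgroup.subset_closure ⟨M', M, M'', i, p, h, rfl⟩)

theorem K0.cls_eq {P' P P'' : FGProj R} (e : P.1 ≃ₗ[R] P'.1 × P''.1) :
    K0.cls P = K0.cls P' + K0.cls P'' := by
  rw [← sub_eq_zero]
  exact (QuotientAddGroup.eq_zero_iff _).2 (AddSubgroup.subset_closure ⟨P', P, P'', ⟨e⟩, rfl⟩)

theorem IsShortExact.of_prod {P' P P'' : Type u} [AddCommGroup P'] [Module R P']
    [AddCommGroup P] [Module R P] [AddCommGroup P''] [Module R P''] (e : P ≃ₗ[R] P' × P'') :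
    IsShortExact (e.symm.toLinearMap ∘ₗ LinearMap.inl R P' P'')
      (LinearMap.snd R P' P'' ∘ₗ e.toLinearMap) where
  injective := e.symm.injective.comp LinearMap.inl_injective
  exact x := by
    constructor
    · intro hx
      refine ⟨(e x).1, ?_⟩
      apply e.injective
      ext <;> simp_all
    · rintro ⟨y, rfl⟩; simp
  surjective := Prod.snd_surjective.comp e.surjective

theorem IsShortExact.exists_equiv {P' P P'' : Type u} [AddCommGroup P'] [Module R P']
    [AddCommGroup P] [Module R P] [AddCommGroup P''] [Module R P''] [Module.Projective R P'']
    {i : P' →ₗ[R] P} {p : P →ₗ[R] P''} (h : IsShortExact i p) :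
    Nonempty (P ≃ₗ[R] P' × P'') := by
  obtain ⟨s, hs⟩ := Module.projective_lifting_property p LinearMap.id h.surjective
  exact ⟨(h.exact.splitSurjectiveEquiv h.injective ⟨s, hs⟩).1⟩

end Groth

/-- A function on finitely generated modules which carries short exact sequences to short exact
sequences. -/
def IsExactFun {R S : Type u} [Ring R] [Ring S] (f : FGModuleCat.{u} R → FGModuleCat.{u} S) : Prop :=
  ∀ (M' M M'' : FGModuleCat.{u} R) (i : M' →ₗ[R] M) (p : M →ₗ[R] M''), IsShortExact i p →
    ∃ (i' : f M' →ₗ[S] f M) (p' : f M →ₗ[S] f M''), IsShortExact i' p'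

/-- The map on `G0` induced by an exact functor. -/
def G0.map {R S : Type u} [Ring R] [Ring S] (f : FGModuleCat.{u} R → FGModuleCat.{u} S)
    (hf : IsExactFun f) : G0 R →+ G0 S :=
  G0.lift (fun M => G0.cls (f M)) (fun M' M M'' i p h => by
    obtain ⟨i', p', h'⟩ := hf M' M M'' i p h
    exact G0.cls_eq h')

/-- The map on `K0` induced by an exact functor which preserves projective modules. -/
def K0.map {R S : Type u} [Ring R] [Ring S] (f : FGModuleCat.{u} R → FGModuleCat.{u} S)
    (hf : IsExactFun f) (hp : ∀ P : FGProj R, Module.Projective S (f P.1)) : K0 R →+ K0 S :=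
  K0.lift (fun P => K0.cls ⟨f P.1, hp P⟩) (fun P' P P'' e => by
    obtain ⟨i', p', h'⟩ := hf _ _ _ _ _ (IsShortExact.of_prod e)
    have := hp P''
    exact K0.cls_eq h'.exists_equiv.some)

theorem Ind_exact {B A : Type u} [Ring B] [Ring A] (φ : B →+* A) (hφ : IsBiprojective φ) :
    IsExactFun (Ind φ).obj := fun _ _ _ i p h =>
  ⟨BalancedTensor.map φ i, BalancedTensor.map φ p,
    ⟨BalancedTensor.map_injective hφ i h.injective, BalancedTensor.map_exact hφ i p h.exact,
      BalancedTensor.map_surjective p h.surjective⟩⟩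

theorem Res_exact [Module.Finite F A] (φ : B →ₐ[F] A) : IsExactFun (Res φ).obj :=
  fun _ _ _ i p h =>
  ⟨((ModuleCat.restrictScalars φ.toRingHom).map (ModuleCat.ofHom i)).hom,
    ((ModuleCat.restrictScalars φ.toRingHom).map (ModuleCat.ofHom p)).hom,
    ⟨h.injective, h.exact, h.surjective⟩⟩

theorem Ind_projective {B A : Type u} [Ring B] [Ring A] (φ : B →+* A) (P : FGProj B) :
    Module.Projective A ((Ind φ).obj P.1) :=
  BalancedTensor.projective φ

theorem Res_projective [Module.Finite F A] (φ : B →ₐ[F] A)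
    (hφ : @Module.Projective B _ A _ (Module.compHom A φ.toRingHom)) (P : FGProj A) :
    Module.Projective B ((Res φ).obj P.1) := by
  obtain ⟨s, hs⟩ := (Module.projective_def' (R := A) (P := P.1)).1 inferInstance
  let _ : Module B A := Module.compHom A φ.toRingHom
  let _ : Module B P.1 := Module.compHom P.1 φ.toRingHom
  have := hφ
  classical
  have : Module.Projective B (P.1 →₀ A) :=
    Module.Projective.of_equiv (finsuppLEquivDirectSum B A P.1).symm
  let s' : P.1 →ₗ[B] (P.1 →₀ A) :=
    { toFun := s, map_add' := map_add s, map_smul' := fun b x => by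
        change s (φ b • x) = _
        rw [map_smul]; rfl }
  let q' : (P.1 →₀ A) →ₗ[B] P.1 :=
    { toFun := Finsupp.linearCombination A id, map_add' := map_add _, map_smul' := fun b x => by
        exact (Finsupp.linearCombination A id).map_smul (φ b) x }
  exact Module.Projective.of_split s' q' (LinearMap.ext fun x => LinearMap.congr_fun hs x)

theorem projective_of_equiv (e : B ≃ₐ[F] A) :
    @Module.Projective B _ A _ (Module.compHom A (e : B →ₐ[F] A).toRingHom) := by
  let _ : Module B A := Module.compHom A (e : B →ₐ[F] A).toRingHom
  let e' : B ≃ₗ[B] A :=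
    { toFun := e, map_add' := map_add e, map_smul' := fun a b => map_mul e a b
      invFun := e.symm, left_inv := e.left_inv, right_inv := e.right_inv }
  exact Module.Projective.of_equiv e'

/-! ### The pairing of `K0` and `G0` -/

theorem finrank_of_exact {U V W : Type u} [AddCommGroup U] [Module F U] [AddCommGroup V]
    [Module F V] [AddCommGroup W] [Module F W] [Module.Finite F V] {i : U →ₗ[F] V} {p : V →ₗ[F] W}
    (h : IsShortExact i p) :
    Module.finrank F V = Module.finrank F U + Module.finrank F W := by
  rw [← LinearMap.finrank_range_add_finrank_ker p, LinearMap.range_eq_top.2 h.surjective,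
    finrank_top, add_comm, LinearMap.exact_iff.1 h.exact,
    LinearMap.finrank_range_of_inj h.injective]

theorem hom_finite [Module.Finite F B] (P M : FGModuleCat.{u} B) : Module.Finite F (P →ₗ[B] M) := by
  have := finite_over_field (F := F) B P
  have := finite_over_field (F := F) B M
  exact Module.Finite.of_injective (LinearMap.restrictScalarsₗ F B P M F)
    (LinearMap.restrictScalars_injective F)

variable (F B) in
/-- The bilinear form `⟨[P], [M]⟩ = dim_F Hom_B(P, M)` for a finite dimensional algebra `B`. -/
def pairing [Module.Finite F B] : K0 B →+ G0 B →+ ℤ :=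
  K0.lift
    (fun P => G0.lift (fun M => (Module.finrank F (P.1 →ₗ[B] M) : ℤ)) (fun M' M M'' i p h => by
      have := hom_finite (F := F) P.1 M
      let i' : (P.1 →ₗ[B] M') →ₗ[F] (P.1 →ₗ[B] M) :=
        { toFun := fun f => i ∘ₗ f, map_add' := fun f g => LinearMap.comp_add _ _ _
          map_smul' := fun c f => by
            ext x
            exact (i.restrictScalars F).map_smul c (f x) }
      let p' : (P.1 →ₗ[B] M) →ₗ[F] (P.1 →ₗ[B] M'') :=
        { toFun := fun f => p ∘ₗ f, map_add' := fun f g => LinearMap.comp_add _ _ _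
          map_smul' := fun c f => by
            ext x
            exact (p.restrictScalars F).map_smul c (f x) }
      have h' : IsShortExact i' p' := by
        refine ⟨fun f g hfg => ?_, fun f => ⟨fun hf => ?_, ?_⟩, fun f => ?_⟩
        · ext x
          exact h.injective (LinearMap.congr_fun hfg x)
        · have hr : LinearMap.range f ≤ LinearMap.range i := by
            rintro _ ⟨x, rfl⟩
            exact (h.exact _).1 (LinearMap.congr_fun hf x)
          let e := LinearEquiv.ofInjective i h.injective
          refine ⟨e.symm.toLinearMap ∘ₗ f.codRestrict (LinearMap.range i)
            (fun x => hr ⟨x, rfl⟩), ?_⟩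
          ext x
          exact congrArg Subtype.val (e.apply_symm_apply ⟨f x, hr ⟨x, rfl⟩⟩)
        · rintro ⟨g, rfl⟩
          ext x
          exact (h.exact _).2 ⟨g x, rfl⟩
        · exact Module.projective_lifting_property p f h.surjective
      exact_mod_cast finrank_of_exact h'))
    (fun P' P P'' e => by
      apply G0.hom_ext
      intro M
      have := hom_finite (F := F) P'.1 M
      have := hom_finite (F := F) P''.1 M
      change (Module.finrank F (P.1 →ₗ[B] M) : ℤ) =
        Module.finrank F (P'.1 →ₗ[B] M) + Module.finrank F (P''.1 →ₗ[B] M)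
      rw [LinearEquiv.finrank_eq ((LinearEquiv.congrLeft M F e).trans
        (LinearMap.coprodEquiv F).symm), Module.finrank_prod]
      push_cast
      rfl)

theorem pairing_cls [Module.Finite F B] (P : FGProj B) (M : FGModuleCat.{u} B) :
    pairing F B (K0.cls P) (G0.cls M) = Module.finrank F (P.1 →ₗ[B] M) := by
  rfl

variable (F B) in
/-- `[M] ↦ dim_F M` on `G0 B`. -/
def G0.dim [Module.Finite F B] : G0 B →+ ℤ :=
  G0.lift (fun M => (Module.finrank F M : ℤ)) (fun M' M M'' i p h => by
    have := finite_over_field (F := F) B M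
    have h' : IsShortExact (i.restrictScalars F) (p.restrictScalars F) :=
      ⟨h.injective, h.exact, h.surjective⟩
    exact_mod_cast finrank_of_exact h')

variable (F B) in
/-- `[P] ↦ dim_F P` on `K0 B`. -/
def K0.dim [Module.Finite F B] : K0 B →+ ℤ :=
  K0.lift (fun P => (Module.finrank F P.1 : ℤ)) (fun P' P P'' e => by
    have := finite_over_field (F := F) B P'.1
    have := finite_over_field (F := F) B P''.1
    have h := LinearEquiv.finrank_eq (e.restrictScalars F)
    rw [Module.finrank_prod] at h
    exact_mod_cast h)

/-! ### The outer tensor product on Grothendieck groups -/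

theorem outer_exact_right [Module.Finite F B] [Module.Finite F C] (M : FGModuleCat.{u} B) :
    IsExactFun (fun N : FGModuleCat.{u} C => outer (F := F) M N) := fun _ _ _ i p h =>
  ⟨outerMap (F := F) LinearMap.id i, outerMap (F := F) LinearMap.id p,
    ⟨Module.Flat.lTensor_preserves_injective_linearMap (M := M) (i.restrictScalars F) h.injective,
      lTensor_exact M (f := i.restrictScalars F) (g := p.restrictScalars F) h.exact h.surjective,
      LinearMap.lTensor_surjective M (g := p.restrictScalars F) h.surjective⟩⟩

theorem outer_exact_left [Module.Finite F B] [Module.Finite F C] (N : FGModuleCat.{u} C) :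
    IsExactFun (fun M : FGModuleCat.{u} B => outer (F := F) M N) := fun _ _ _ i p h =>
  ⟨outerMap (F := F) i LinearMap.id, outerMap (F := F) p LinearMap.id,
    ⟨Module.Flat.rTensor_preserves_injective_linearMap (M := N) (i.restrictScalars F) h.injective,
      rTensor_exact N (f := i.restrictScalars F) (g := p.restrictScalars F) h.exact h.surjective,
      LinearMap.rTensor_surjective N (g := p.restrictScalars F) h.surjective⟩⟩

theorem outer_proj [Module.Finite F B] [Module.Finite F C] (P : FGProj B) (Q : FGProj C) :
    Module.Projective (B ⊗[F] C) (outer (F := F) P.1 Q.1) :=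
  outer_projective (F := F) (B := B) (C := C) (M := P.1) (N := Q.1)

variable (F B C) in
/-- The map `[M] ⊗ [N] ↦ [M ⊗ N]` from `G0 B ⊗ G0 C` to `G0 (B ⊗ C)`. -/
def G0.kunneth [Module.Finite F B] [Module.Finite F C] :
    TensorHom ℤ (G0 B) (G0 C) (G0 (B ⊗[F] C)) :=
  TensorProduct.lift (intBilin
    (G0.lift (fun M => G0.map (fun N => outer (F := F) M N) (outer_exact_right M))
      (fun M' M M'' i p h => by
        apply G0.hom_ext
        intro N
        obtain ⟨i', p', h'⟩ := outer_exact_left (F := F) (C := C) N M' M M'' i p h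
        exact G0.cls_eq h')))

variable (F B C) in
/-- The map `[P] ⊗ [Q] ↦ [P ⊗ Q]` from `K0 B ⊗ K0 C` to `K0 (B ⊗ C)`. -/
def K0.kunneth [Module.Finite F B] [Module.Finite F C] :
    TensorHom ℤ (K0 B) (K0 C) (K0 (B ⊗[F] C)) :=
  TensorProduct.lift (intBilin
    (K0.lift (fun P => K0.map (fun Q => outer (F := F) P.1 Q) (outer_exact_right P.1)
        (fun Q => outer_proj P Q))
      (fun P' P P'' e => by
        apply K0.hom_ext
        intro Q
        obtain ⟨i', p', h'⟩ :=
          outer_exact_left (F := F) (C := C) Q.1 _ _ _ _ _ (IsShortExact.of_prod e)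
        have := outer_proj (F := F) P'' Q
        exact K0.cls_eq (P' := ⟨_, outer_proj P' Q⟩) (P := ⟨_, outer_proj P Q⟩)
          (P'' := ⟨_, outer_proj P'' Q⟩) h'.exists_equiv.some)))

theorem G0.kunneth_cls [Module.Finite F B] [Module.Finite F C] (M : FGModuleCat.{u} B)
    (N : FGModuleCat.{u} C) :
    G0.kunneth F B C (G0.cls M ⊗ₜ G0.cls N) = G0.cls (outer (F := F) M N) := rfl

theorem K0.kunneth_cls [Module.Finite F B] [Module.Finite F C] (P : FGProj B) (Q : FGProj C) :
    K0.kunneth F B C (K0.cls P ⊗ₜ K0.cls Q) = K0.cls ⟨outer (F := F) P.1 Q.1, outer_proj P Q⟩ := rfl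

end Functors
/-! ### Graded connected Hopf algebras and dual pairs -/

section Hopf

universe v w
variable {k : Type v} [CommRing k]

/-- A multiplication, unit, comultiplication and counit on a module, without axioms. -/
structure HopfOps (k : Type v) [CommRing k] (V : Type w) [AddCommGroup V] [Module k V] where
  mul : V →ₗ[k] V →ₗ[k] V
  unit : k →ₗ[k] V
  comul : V →ₗ[k] V ⊗[k] V
  counit : V →ₗ[k] k

/-- The operations make `V` a Hopf algebra over `k`: they are those of a Hopf algebra, carried
along a linear isomorphism. -/
def HopfOps.IsHopfAlgebra {V : Type w} [AddCommGroup V] [Module k V] (o : HopfOps k V) : Prop :=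
  ∃ (R : Type w) (_ : Ring R) (_ : HopfAlgebra k R) (e : V ≃ₗ[k] R),
    (∀ x y, e (o.mul x y) = e x * e y) ∧
    (∀ c, e (o.unit c) = algebraMap k R c) ∧
    (∀ x, TensorProduct.map e.toLinearMap e.toLinearMap (o.comul x) = Coalgebra.comul (e x)) ∧
    (∀ x, o.counit x = Coalgebra.counit (e x))

/-- The bilinear form on `V ⊗ V` and `W ⊗ W` induced by a bilinear form on `V` and `W`:
`⟨a ⊗ b, x ⊗ y⟩ = ⟨a, x⟩ ⟨b, y⟩`. -/
def tensorForm {V W : Type*} [AddCommGroup V] [Module k V] [AddCommGroup W] [Module k W]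
    (β : V →ₗ[k] W →ₗ[k] k) : V ⊗[k] V →ₗ[k] W ⊗[k] W →ₗ[k] k :=
  TensorProduct.dualDistrib k W W ∘ₗ TensorProduct.map β β

theorem tensorForm_tmul {V W : Type*} [AddCommGroup V] [Module k V] [AddCommGroup W] [Module k W]
    (β : V →ₗ[k] W →ₗ[k] k) (a b : V) (x y : W) :
    tensorForm β (a ⊗ₜ b) (x ⊗ₜ y) = β a x * β b y := by
  simp [tensorForm]

/-- A Hopf pairing. -/
structure IsHopfPairing {V W : Type*} [AddCommGroup V] [Module k V] [AddCommGroup W] [Module k W]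
    (oV : HopfOps k V) (oW : HopfOps k W) (β : V →ₗ[k] W →ₗ[k] k) : Prop where
  mul_left : ∀ a b x, β (oV.mul a b) x = tensorForm β (a ⊗ₜ b) (oW.comul x)
  mul_right : ∀ a x y, β a (oW.mul x y) = tensorForm β (oV.comul a) (x ⊗ₜ y)
  one_left : ∀ x, β (oV.unit 1) x = oW.counit x
  one_right : ∀ a, β a (oW.unit 1) = oV.counit a

open DirectSum

variable {H : ℕ → Type w} [∀ n, AddCommGroup (H n)] [∀ n, Module k (H n)]
  {H' : ℕ → Type w} [∀ n, AddCommGroup (H' n)] [∀ n, Module k (H' n)]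

variable (k H) in
/-- Operations on `⨁ H_n`. -/
abbrev GradedOps := HopfOps k (⨁ n, H n)

/-- `H = ⨁ H_n` is a graded connected Hopf algebra. -/
structure IsGradedConnectedHopf (o : GradedOps k H) : Prop where
  hopf : o.IsHopfAlgebra
  free : ∀ n, Module.Free k (H n)
  finite : ∀ n, Module.Finite k (H n)
  mul_mem : ∀ m n (x : H m) (y : H n),
    o.mul (lof k ℕ H m x) (lof k ℕ H n y) ∈ LinearMap.range (lof k ℕ H (m + n))
  comul_mem : ∀ n (x : H n), o.comul (lof k ℕ H n x) ∈
    ⨆ p ∈ Finset.HasAntidiagonal.antidiagonal n,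
      LinearMap.range (TensorProduct.map (lof k ℕ H p.1) (lof k ℕ H p.2))
  unit_mem : ∀ c, o.unit c ∈ LinearMap.range (lof k ℕ H 0)
  counit_eq_zero : ∀ n, 0 < n → ∀ x : H n, o.counit (lof k ℕ H n x) = 0
  connected : LinearMap.range (lof k ℕ H 0) = Submodule.span k {o.unit 1}

/-- `(H⁺, H⁻) = (⨁ H n, ⨁ H' n)` is a dual pair of Hopf algebras under the form `β` on
`H⁻ × H⁺`: both are graded connected Hopf algebras, and `β` is a Hopf pairing which identifies
each of them with the graded dual of the other. -/
structure IsDualPair (o : GradedOps k H) (o' : GradedOps k H')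
    (β : GradedForm k H' H) : Prop where
  plus : IsGradedConnectedHopf o
  minus : IsGradedConnectedHopf o'
  hopf_pairing : IsHopfPairing o' o β
  graded : ∀ m n, m ≠ n → ∀ (x : H' m) (y : H n), β (lof k ℕ H' m x) (lof k ℕ H n y) = 0
  perfect : ∀ n, (β.compl₁₂ (lof k ℕ H' n) (lof k ℕ H n)).IsPerfPair

/-- The operations on `⨁ H_n` assembled from their graded components
`H_m × H_n → H_{m+n}`, `1 ∈ H_0`, `H_N → H_m ⊗ H_n` for `m + n = N`, and `H_0 → k`. -/
def assembleOps (μ : ∀ m n, H m →ₗ[k] H n →ₗ[k] H (m + n)) (one : H 0)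
    (δ : ∀ {m n N : ℕ}, m + n = N → H N →ₗ[k] H m ⊗[k] H n) (ε : H 0 →ₗ[k] k) :
    GradedOps k H where
  mul := toModule k ℕ _ fun m =>
    (toModule k ℕ _ fun n => ((μ m n).compr₂ (lof k ℕ H (m + n))).flip).flip
  unit := LinearMap.toSpanSingleton k _ (lof k ℕ H 0 one)
  comul := toModule k ℕ _ fun N => ∑ p : Finset.HasAntidiagonal.antidiagonal N,
    TensorProduct.map (lof k ℕ H p.1.1) (lof k ℕ H p.1.2) ∘ₗ
      δ (Finset.HasAntidiagonal.mem_antidiagonal.1 p.2)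
  counit := ε ∘ₗ component k ℕ H 0

/-- The form on `(⨁ H'_n) × (⨁ H_n)` which is `β n` on `H'_n × H_n` and vanishes on
`H'_m × H_n` for `m ≠ n`. -/
def assembleForm (β : ∀ n, H' n →ₗ[k] H n →ₗ[k] k) :
    GradedForm k H' H :=
  toModule k ℕ _ fun n => (LinearMap.lcomp k k (component k ℕ H n)) ∘ₗ β n

/-- The inverse of a bijective linear map (and `0` for a map which is not bijective). -/
def linearInverse {V W : Type*} [AddCommGroup V] [Module k V] [AddCommGroup W] [Module k W]
    (f : V →ₗ[k] W) : W →ₗ[k] V :=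
  open Classical in
  if h : Function.Bijective f then (LinearEquiv.ofBijective f h).symm.toLinearMap else 0

/-- The endomorphism of `⨁ H_n` with the given graded components. -/
def assembleEnd (f : ∀ n, H n →ₗ[k] H n) : GradedEnd k H := DirectSum.lmap f

/-- The map `(f ⊗ f) Δ g`. -/
def conjComul (o : GradedOps k H) (f g : GradedEnd k H) : GradedComul k H :=
  TensorProduct.map f f ∘ₗ o.comul ∘ₗ g

end Hopf

/-! ### Towers of algebras -/

/-- A tower of algebras: a graded algebra `⨁ alg n` over the field `F`, each of whose graded
pieces is also a finite dimensional algebra with a product of its own.  The multiplication of the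
graded algebra is given by its components `alg m ⊗ alg n → alg N`, `m + n = N`. -/
structure AlgebraTower (F : Type u) [Field F] where
  alg : ℕ → Type u
  [ring : ∀ n, Ring (alg n)]
  [algebra : ∀ n, Algebra F (alg n)]
  [finite : ∀ n, Module.Finite F (alg n)]
  alg_zero : Nonempty (alg 0 ≃ₐ[F] F)
  /-- The external multiplication, a homomorphism of (unital) algebras. -/
  ρ : ∀ {m n N : ℕ}, m + n = N → (alg m ⊗[F] alg n →ₐ[F] alg N)
  /-- The external multiplication is associative. -/
  ρ_assoc : ∀ {l m n lm mn N : ℕ} (h₁ : l + m = lm) (h₂ : lm + n = N) (h₃ : m + n = mn)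
    (h₄ : l + mn = N) (a : alg l) (b : alg m) (c : alg n),
    ρ h₂ (ρ h₁ (a ⊗ₜ b) ⊗ₜ c) = ρ h₄ (a ⊗ₜ ρ h₃ (b ⊗ₜ c))
  /-- The external multiplication has a unit. -/
  ρ_unit : ∃ e : alg 0, ∀ (n : ℕ) (a : alg n),
    ρ (zero_add n) (e ⊗ₜ a) = a ∧ ρ (add_zero n) (a ⊗ₜ e) = a
  /-- `alg N` is projective as a left and as a right module over `alg m ⊗ alg n`. -/
  biprojective : ∀ {m n N : ℕ} (h : m + n = N), IsBiprojective (ρ h).toRingHom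
  /-- The pairing of `K0 (alg n)` and `G0 (alg n)` is perfect. -/
  perfect : ∀ n, Function.Bijective (pairing F (alg n))

namespace AlgebraTower

attribute [instance] ring algebra finite

variable {F : Type u} [Field F] (T : AlgebraTower F)

/-- Induction from `A_m ⊗ A_n` to `A_N`: the component of `∇` for `m + n = N`. -/
def ind {m n N : ℕ} (h : m + n = N) :
    FGModuleCat.{u} (T.alg m ⊗[F] T.alg n) ⥤ FGModuleCat.{u} (T.alg N) :=
  Ind (T.ρ h).toRingHom

/-- Restriction from `A_N` to `A_m ⊗ A_n`: the component of `Δ` for `m + n = N`. -/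
def res {m n N : ℕ} (h : m + n = N) :
    FGModuleCat.{u} (T.alg N) ⥤ FGModuleCat.{u} (T.alg m ⊗[F] T.alg n) :=
  Res (T.ρ h)

section Conjugation

variable (ψ : ∀ n, T.alg n ≃ₐ[F] T.alg n)

/-- The functor `Ψ_n`, which twists the action of `A_n` by `ψ_n`: on `Ψ_n M` the element `ψ_n a`
acts as `a` does on `M`. -/
def twist (n : ℕ) : FGModuleCat.{u} (T.alg n) ⥤ FGModuleCat.{u} (T.alg n) :=
  Res ((ψ n).symm : T.alg n →ₐ[F] T.alg n)

/-- The inverse `Ψ_n⁻¹` of the functor `Ψ_n`. -/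
def twistInv (n : ℕ) : FGModuleCat.{u} (T.alg n) ⥤ FGModuleCat.{u} (T.alg n) :=
  Res (ψ n : T.alg n →ₐ[F] T.alg n)

/-- The component of `Ψ ⊗ Ψ` on modules over `A_m ⊗ A_n`: twisting by `ψ_m ⊗ ψ_n`. -/
def twistTwo (m n : ℕ) :
    FGModuleCat.{u} (T.alg m ⊗[F] T.alg n) ⥤ FGModuleCat.{u} (T.alg m ⊗[F] T.alg n) :=
  Res (Algebra.TensorProduct.map ((ψ m).symm : T.alg m →ₐ[F] T.alg m)
    ((ψ n).symm : T.alg n →ₐ[F] T.alg n))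

/-- The component of `(Ψ ⊗ Ψ) Δ Ψ⁻¹` for `m + n = N`. -/
def conjRes {m n N : ℕ} (h : m + n = N) :
    FGModuleCat.{u} (T.alg N) ⥤ FGModuleCat.{u} (T.alg m ⊗[F] T.alg n) :=
  T.twistInv ψ N ⋙ T.res h ⋙ T.twistTwo ψ m n

end Conjugation

/-- The indices `(r, s, t, q)` with `r + s = m`, `t + q = n`, `r + t = k`, `s + q = l`. -/
structure MackeyIndex (m n k l : ℕ) where
  (r s t q : ℕ)
  hm : r + s = m
  hn : t + q = n
  hk : r + t = k
  hl : s + q = l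

instance (m n k l : ℕ) : Finite (MackeyIndex m n k l) := by
  refine Finite.of_injective (fun i => (⟨i.r, by have := i.hm; omega⟩ : Fin (m + 1))) ?_
  rintro ⟨r, s, t, q, h1, h2, h3, h4⟩ ⟨r', s', t', q', h1', h2', h3', h4'⟩ h
  simp only [Fin.mk.injEq] at h
  subst h
  obtain rfl : s = s' := by omega
  obtain rfl : t = t' := by omega
  obtain rfl : q = q' := by omega
  rfl

/-- The component of `Δ ⊗ Δ`: restriction from `A_m ⊗ A_n` to
`(A_r ⊗ A_s) ⊗ (A_t ⊗ A_q)`. -/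
def resTwo {m n k l : ℕ} (i : MackeyIndex m n k l) :
    FGModuleCat.{u} (T.alg m ⊗[F] T.alg n) ⥤
      FGModuleCat.{u} ((T.alg i.r ⊗[F] T.alg i.s) ⊗[F] (T.alg i.t ⊗[F] T.alg i.q)) :=
  Res (Algebra.TensorProduct.map (T.ρ i.hm) (T.ρ i.hn))

/-- The component of `S₂₃`, which interchanges the second and the third tensor factor. -/
def swapTwoThree {m n k l : ℕ} (i : MackeyIndex m n k l) :
    FGModuleCat.{u} ((T.alg i.r ⊗[F] T.alg i.s) ⊗[F] (T.alg i.t ⊗[F] T.alg i.q)) ⥤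
      FGModuleCat.{u} ((T.alg i.r ⊗[F] T.alg i.t) ⊗[F] (T.alg i.s ⊗[F] T.alg i.q)) :=
  Res (Algebra.TensorProduct.tensorTensorTensorComm F F F F
    (T.alg i.r) (T.alg i.t) (T.alg i.s) (T.alg i.q)).toAlgHom

/-- The component of `∇ ⊗ ∇`: induction from `(A_r ⊗ A_t) ⊗ (A_s ⊗ A_q)` to `A_k ⊗ A_l`. -/
def indTwo {m n k l : ℕ} (i : MackeyIndex m n k l) :
    FGModuleCat.{u} ((T.alg i.r ⊗[F] T.alg i.t) ⊗[F] (T.alg i.s ⊗[F] T.alg i.q)) ⥤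
      FGModuleCat.{u} (T.alg k ⊗[F] T.alg l) :=
  Ind (Algebra.TensorProduct.map (T.ρ i.hk) (T.ρ i.hl)).toRingHom

/-- The tower is strong, with conjugation `Ψ` given by the automorphisms `ψ n`.  The functors
`∇`, `Δ`, ... between direct sums of module categories are given by their components. -/
structure IsStrong (ψ : ∀ n, T.alg n ≃ₐ[F] T.alg n) : Prop where
  /-- `∇` is right adjoint to `(Ψ ⊗ Ψ) Δ Ψ⁻¹`. -/
  adjoint : ∀ {m n N : ℕ} (h : m + n = N), Nonempty (T.conjRes ψ h ⊣ T.ind h)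
  /-- The isomorphism of functors `Δ ∇ ≅ (∇ ⊗ ∇) S₂₃ (Δ ⊗ Δ)`. -/
  mackey : ∀ {m n k l N : ℕ} (h : m + n = N) (h' : k + l = N),
    Nonempty (T.ind h ⋙ T.res h' ≅ directSumFunctor fun i : MackeyIndex m n k l =>
      T.resTwo i ⋙ T.swapTwoThree i ⋙ T.indTwo i)

/-! ### The operations on `𝒢(A) = ⨁ G0 (A_n)` and `𝒦(A) = ⨁ K0 (A_n)` -/

/-- The operations on `𝒢(A)` induced by `∇`, `Δ`, `η`, `ε`, where `G0 (A_m ⊗ A_n)` is identified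
with `G0 (A_m) ⊗ G0 (A_n)` through the isomorphism `[M] ⊗ [N] ↦ [M ⊗ N]`, and finite dimensional
vector spaces are identified with modules over `A_0 ≅ F`. -/
def opsG : GradedOps ℤ (fun n => G0 (T.alg n)) :=
  assembleOps
    (fun m n => TensorProduct.curry
      ((G0.map (T.ind (rfl : m + n = m + n)).obj
          (Ind_exact _ (T.biprojective rfl))).toIntLinearMap ∘ₗ
        G0.kunneth F (T.alg m) (T.alg n)))
    (G0.cls (FGModuleCat.of (T.alg 0) (T.alg 0)))
    (fun {m n _} h => linearInverse (G0.kunneth F (T.alg m) (T.alg n)) ∘ₗ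
      (G0.map (T.res h).obj (Res_exact _)).toIntLinearMap)
    (G0.dim F (T.alg 0)).toIntLinearMap

/-- The operations on `𝒦(A)` induced by `∇`, `Δ`, `η`, `ε`, with the same identifications. -/
def opsK : GradedOps ℤ (fun n => K0 (T.alg n)) :=
  assembleOps
    (fun m n => TensorProduct.curry
      ((K0.map (T.ind (rfl : m + n = m + n)).obj (Ind_exact _ (T.biprojective rfl))
          (Ind_projective _)).toIntLinearMap ∘ₗ
        K0.kunneth F (T.alg m) (T.alg n)))
    (K0.cls ⟨FGModuleCat.of (T.alg 0) (T.alg 0),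
      inferInstanceAs (Module.Projective (T.alg 0) (T.alg 0))⟩)
    (fun {m n _} h => linearInverse (K0.kunneth F (T.alg m) (T.alg n)) ∘ₗ
      (K0.map (T.res h).obj (Res_exact _)
        (Res_projective _ (T.biprojective h).left)).toIntLinearMap)
    (K0.dim F (T.alg 0)).toIntLinearMap

/-- The form on `𝒦(A) × 𝒢(A)`: `⟨[P], [M]⟩ = dim Hom(P, M)` if `P` and `M` are modules over the
same `A_n`, and `0` otherwise. -/
def form : GradedForm ℤ (fun n => K0 (T.alg n)) (fun n => G0 (T.alg n)) :=
  assembleForm fun n => intBilin (pairing F (T.alg n))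

/-- The tower is dualizing: `(𝒢(A), 𝒦(A))` is a dual pair of Hopf algebras under the form on
`𝒦(A) × 𝒢(A)`. -/
def IsDualizing : Prop := IsDualPair T.opsG T.opsK T.form

section Conjugation

variable (ψ : ∀ n, T.alg n ≃ₐ[F] T.alg n)

/-- The map on `𝒦(A)` induced by `Ψ`. -/
def twistK : GradedEnd ℤ (fun n => K0 (T.alg n)) :=
  assembleEnd fun n => (K0.map (T.twist ψ n).obj (Res_exact _)
    (Res_projective _ (projective_of_equiv (ψ n).symm))).toIntLinearMap

/-- The map on `𝒦(A)` induced by `Ψ⁻¹`. -/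
def twistInvK : GradedEnd ℤ (fun n => K0 (T.alg n)) :=
  assembleEnd fun n => (K0.map (T.twistInv ψ n).obj (Res_exact _)
    (Res_projective _ (projective_of_equiv (ψ n)))).toIntLinearMap

/-- The map `(Ψ ⊗ Ψ) Δ Ψ⁻¹` from `𝒦(A)` to `𝒦(A) ⊗ 𝒦(A)`. -/
def conjComulK : GradedComul ℤ (fun n => K0 (T.alg n)) :=
  conjComul T.opsK (T.twistK ψ) (T.twistInvK ψ)

end Conjugation

end AlgebraTower

/-- `B` is a symmetric algebra over `F`: it is finite dimensional and has a linear form `tr` with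
`tr (a b) = tr (b a)` for which the bilinear form `tr (a b)` is nondegenerate. -/
def IsSymmetricAlgebra (F B : Type u) [Field F] [Ring B] [Algebra F B] : Prop :=
  Module.Finite F B ∧ ∃ tr : B →ₗ[F] F, (∀ a b, tr (a * b) = tr (b * a)) ∧
    ∀ a, (∀ b, tr (a * b) = 0) → a = 0

end
end AlgTower

/-! Everything is read off from the behaviour of `∇` and `Δ` under the form. Induction is always
left adjoint to restriction, so `⟨∇(a ⊗ b), x⟩ = ⟨a ⊗ b, Δ x⟩` holds in every tower (`pairing_ind`).
Strength supplies the other adjunction, `⟨a, ∇(x ⊗ y)⟩ = ⟨(Ψ ⊗ Ψ) Δ Ψ⁻¹ a, x ⊗ y⟩`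
(`IsStrong.pairing_indG`). Since the form is nondegenerate, it is a Hopf pairing only if the twisted
comultiplication on `𝒦(A)` is `Δ`; this is the condition `IsConjInvariant`, to which the other
conditions are compared. Passing between isomorphic modules and equal classes costs nothing: a
projective module `P` is determined by the numbers `dim Hom(P, S)` with `S` simple
(`nonempty_equiv_of_finrank_hom`, by splitting off projective covers), hence by its class in `K0`.

Conversely, assume invariance, so that `∇` and `Δ` are adjoint on both sides. The products on `𝒦(A)`
and `𝒢(A)` are associative because, tested against the other group, they become iterated
restrictions, which agree by associativity of `ρ`. Coassociativity and the counit laws of each side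
are the associativity and unit laws of the other, seen through the form. Compatibility of product
and coproduct is a single identity for `⟨ab, xy⟩`, symmetric in the two sides: move the second
product across the form and apply `Δ∇ ≅ ∇² S₂₃ Δ²` (`IsStrong.mackey_pairing`). The antipode exists
because the bialgebras are graded and connected (`exists_conv_inverse`).

All this needs the groups of `A_m ⊗ A_n` to be tensor products. Perfectness of the pairing forces
simple modules to be absolutely simple (`finrank_end_eq_one`), so the simple `B ⊗ C`-modules are
outer tensor products and `G0.kunneth` is surjective. As `Hom(P ⊗ Q, M ⊗ N) = Hom(P, M) ⊗ Hom(Q, N)`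
for projective `P`, `Q`, the form on tensor products is the product form; its nondegeneracy gives
injectivity for `G0` and bijectivity for `K0`.

For symmetric algebras `dim Hom(P, M) = dim Hom(M, P)` when `P` is projective
(`IsSymmetricAlgebra.finrank_hom_comm`). Hence `∇` on `𝒢(A)` is adjoint to the untwisted `Δ`, and
invariance follows by comparison. The other two sufficient conditions give invariance directly. -/

namespace AlgTower

noncomputable section

/-! ### Connected graded bialgebras have antipodes -/

section HopfLaws

universe v w

open DirectSum WithConv

variable {k : Type v} [CommRing k]

/-- Convolution inverse of the identity of a connected graded bialgebra. -/
theorem exists_conv_inverse {A : Type w} [Ring A] [Bialgebra k A] {H : ℕ → Type w}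
    [∀ n, AddCommGroup (H n)] [∀ n, Module k (H n)] (e : (⨁ n, H n) ≃ₗ[k] A)
    (hΔ : ∀ n (x : H n), Coalgebra.comul (R := k) (e (lof k ℕ H n x)) ∈
      ⨆ p ∈ Finset.HasAntidiagonal.antidiagonal n,
        LinearMap.range (TensorProduct.map (e.toLinearMap ∘ₗ lof k ℕ H p.1)
          (e.toLinearMap ∘ₗ lof k ℕ H p.2)))
    (h0 : ∀ x : H 0, ∃ c : k, e (lof k ℕ H 0 x) = algebraMap k A c) :
    ∃ S : A →ₗ[k] A, toConv S * toConv LinearMap.id = (1 : WithConv (A →ₗ[k] A)) ∧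
      toConv LinearMap.id * toConv S = (1 : WithConv (A →ₗ[k] A)) := by
  -- The map `f` vanishes in degree `0`, so `f ^ r` vanishes in degrees below `r`, and `id = 1 - f`
  -- is inverted by the geometric series in `f`, a finite sum in each degree.
  set f : WithConv (A →ₗ[k] A) := 1 - toConv LinearMap.id with hf
  have hf0 : ∀ x : H 0, f (e (lof k ℕ H 0 x)) = 0 := by
    intro x
    obtain ⟨c, hc⟩ := h0 x
    rw [hf, hc]
    change algebraMap k A (Coalgebra.counit (algebraMap k A c)) - algebraMap k A c = 0
    rw [Bialgebra.counit_algebraMap, sub_self]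
  -- linear maps agreeing on the comultiplication of a homogeneous element
  have key : ∀ (n : ℕ) (x : H n) (g g' h h' : WithConv (A →ₗ[k] A)),
      (∀ i j, i + j = n → ∀ (y : H i) (z : H j),
        g (e (lof k ℕ H i y)) * h (e (lof k ℕ H j z)) =
          g' (e (lof k ℕ H i y)) * h' (e (lof k ℕ H j z))) →
      (g * h) (e (lof k ℕ H n x)) = (g' * h') (e (lof k ℕ H n x)) := by
    intro n x g g' h h' hyp
    rw [LinearMap.convMul_apply, LinearMap.convMul_apply]
    have hx := hΔ n x
    generalize Coalgebra.comul (R := k) (e (lof k ℕ H n x)) = t at hx ⊢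
    have hle : (⨆ p ∈ Finset.HasAntidiagonal.antidiagonal n,
        LinearMap.range (TensorProduct.map (e.toLinearMap ∘ₗ lof k ℕ H p.1)
          (e.toLinearMap ∘ₗ lof k ℕ H p.2))) ≤
        LinearMap.eqLocus (LinearMap.mul' k A ∘ₗ TensorProduct.map g.ofConv h.ofConv)
          (LinearMap.mul' k A ∘ₗ TensorProduct.map g'.ofConv h'.ofConv) := by
      refine iSup₂_le fun p hp => ?_
      rintro _ ⟨s, rfl⟩
      induction s with
      | zero => rw [map_zero]; exact zero_mem _
      | add a b ha hb => rw [map_add]; exact add_mem ha hb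
      | tmul y z => exact hyp p.1 p.2 (Finset.HasAntidiagonal.mem_antidiagonal.1 hp) y z
    exact hle hx
  have hnil : ∀ (r n : ℕ), n < r → ∀ x : H n, (f ^ r) (e (lof k ℕ H n x)) = 0 := by
    intro r
    induction r with
    | zero => intro n hn; omega
    | succ r ih =>
      intro n hn x
      rw [pow_succ']
      refine (key n x f 0 (f ^ r) 0 ?_).trans ?_
      · intro i j hij y z
        change _ = 0 * (0 : A)
        rw [mul_zero]
        -- Either the left factor has degree `0` and is killed by `f`, or the right factor has
        -- dropped in degree and is killed by `f ^ r`.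
        rcases Nat.eq_zero_or_pos i with rfl | hi
        · rw [hf0, zero_mul]
        · rw [ih j (by omega), mul_zero]
      · rw [mul_zero]; rfl
  let P : ℕ → WithConv (A →ₗ[k] A) := fun N => ∑ r ∈ Finset.range (N + 1), f ^ r
  have hP : ∀ n N, n ≤ N → ∀ x : H n, (P N) (e (lof k ℕ H n x)) = (P n) (e (lof k ℕ H n x)) := by
    intro n N hnN x
    induction N, hnN using Nat.le_induction with
    | base => rfl
    | succ N hN ih =>
      have h1 : P (N + 1) = P N + f ^ (N + 1) := Finset.sum_range_succ _ _
      rw [h1]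
      change (P N) (e (lof k ℕ H n x)) + (f ^ (N + 1)) (e (lof k ℕ H n x)) = _
      rw [ih, hnil _ _ (by omega), add_zero]
  -- In degree `n` the series stops at `f ^ n`; by `hP` any longer partial sum gives the same value.
  let S : A →ₗ[k] A :=
    toModule k ℕ A (fun n => (P n).ofConv ∘ₗ e.toLinearMap ∘ₗ lof k ℕ H n) ∘ₗ e.symm.toLinearMap
  have hS : ∀ n N, n ≤ N → ∀ x : H n, S (e (lof k ℕ H n x)) = (P N) (e (lof k ℕ H n x)) := by
    intro n N h x
    rw [hP n N h]
    simp [S]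
  have hid : toConv LinearMap.id = 1 - f := by rw [hf, sub_sub_cancel]
  have hext : ∀ g h : WithConv (A →ₗ[k] A),
      (∀ n (x : H n), g (e (lof k ℕ H n x)) = h (e (lof k ℕ H n x))) → g = h := by
    intro g h hgh
    apply WithConv.ext
    have : g.ofConv ∘ₗ e.toLinearMap = h.ofConv ∘ₗ e.toLinearMap := by
      refine DirectSum.linearMap_ext k fun n => ?_
      ext x
      exact hgh n x
    ext y
    obtain ⟨z, rfl⟩ := e.surjective y
    exact LinearMap.congr_fun this z
  -- All tensor factors of the coproduct of a degree `n` element have degree at most `n`, so `S` may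
  -- be replaced by the single partial sum `P n`. The product telescopes to `1 - f ^ (n + 1)`, whose
  -- last term vanishes in degree `n`.
  refine ⟨S, hext _ _ fun n x => ?_, hext _ _ fun n x => ?_⟩
  · rw [key n x (toConv S) (P n) (toConv LinearMap.id) (toConv LinearMap.id)
      (fun i j hij y z => by rw [← hS i n (by omega) y]), hid, geom_sum_mul_neg]
    change (1 : WithConv (A →ₗ[k] A)) (e (lof k ℕ H n x)) - (f ^ (n + 1)) (e (lof k ℕ H n x)) = _
    rw [hnil _ _ (by omega), sub_zero]
  · rw [key n x (toConv LinearMap.id) (toConv LinearMap.id) (toConv S) (P n)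
      (fun i j hij y z => by rw [← hS j n (by omega) z]), hid, mul_neg_geom_sum]
    change (1 : WithConv (A →ₗ[k] A)) (e (lof k ℕ H n x)) - (f ^ (n + 1)) (e (lof k ℕ H n x)) = _
    rw [hnil _ _ (by omega), sub_zero]

/-- The axioms of a bialgebra. -/
structure HopfOps.IsBialgebra {V : Type w} [AddCommGroup V] [Module k V] (o : HopfOps k V) :
    Prop where
  mul_assoc : ∀ x y z, o.mul (o.mul x y) z = o.mul x (o.mul y z)
  one_mul : ∀ x, o.mul (o.unit 1) x = x
  mul_one : ∀ x, o.mul x (o.unit 1) = x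
  coassoc : ∀ x, TensorProduct.assoc k V V V (o.comul.rTensor V (o.comul x)) =
    o.comul.lTensor V (o.comul x)
  counit_left : ∀ x, o.counit.rTensor V (o.comul x) = (1 : k) ⊗ₜ x
  counit_right : ∀ x, o.counit.lTensor V (o.comul x) = x ⊗ₜ (1 : k)
  counit_one : o.counit (o.unit 1) = 1
  counit_mul : ∀ x y, o.counit (o.mul x y) = o.counit x * o.counit y
  comul_one : o.comul (o.unit 1) = o.unit 1 ⊗ₜ o.unit 1
  comul_mul : ∀ x y, o.comul (o.mul x y) =
    TensorProduct.map₂ o.mul o.mul (o.comul x) (o.comul y)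

namespace HopfOps.IsBialgebra

variable {V : Type w} [AddCommGroup V] [Module k V] {o : HopfOps k V}

/-- The ring structure of a bialgebra. -/
@[reducible] def toRing (h : o.IsBialgebra) : Ring V :=
  { (inferInstance : AddCommGroup V) with
    mul := fun x y => o.mul x y
    one := o.unit 1
    mul_assoc := h.mul_assoc
    one_mul := h.one_mul
    mul_one := h.mul_one
    zero_mul := fun x => by change o.mul 0 x = 0; simp
    mul_zero := fun x => by change o.mul x 0 = 0; simp
    left_distrib := fun x y z => map_add (o.mul x) y z
    right_distrib := fun x y z => by change o.mul (x + y) z = o.mul x z + o.mul y z; simp }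

/-- The algebra structure of a bialgebra. -/
@[reducible] def toAlgebra (h : o.IsBialgebra) : letI := h.toRing; Algebra k V :=
  letI := h.toRing
  Algebra.ofModule (fun c x y => by change o.mul (c • x) y = c • o.mul x y; simp)
    (fun c x y => by change o.mul x (c • y) = c • o.mul x y; simp)

/-- The coalgebra structure of a bialgebra. -/
@[reducible] def toCoalgebra (h : o.IsBialgebra) : Coalgebra k V where
  comul := o.comul
  counit := o.counit
  coassoc := LinearMap.ext h.coassoc
  rTensor_counit_comp_comul := LinearMap.ext h.counit_left
  lTensor_counit_comp_comul := LinearMap.ext h.counit_right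

/-- The bialgebra structure. -/
@[reducible] def toBialgebra (h : o.IsBialgebra) : letI := h.toRing; Bialgebra k V :=
  letI := h.toRing
  letI := h.toAlgebra
  letI := h.toCoalgebra
  Bialgebra.mk' k V h.counit_one (fun {x y} => h.counit_mul x y) h.comul_one
    (fun {x y} => (h.comul_mul x y).trans (by
      change TensorProduct.map₂ o.mul o.mul (o.comul x) (o.comul y) = o.comul x * o.comul y
      generalize o.comul x = s
      generalize o.comul y = t
      induction s with
      | zero => rw [map_zero, zero_mul]; rfl
      | add a b ha hb => rw [map_add, add_mul, ← ha, ← hb]; rfl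
      | tmul a b =>
        induction t with
        | zero => rw [map_zero, mul_zero]
        | add c d hc hd => rw [map_add, mul_add, ← hc, ← hd]
        | tmul c d => rw [TensorProduct.map₂_apply_tmul, Algebra.TensorProduct.tmul_mul_tmul]; rfl))

end HopfOps.IsBialgebra

variable {H : ℕ → Type w} [∀ n, AddCommGroup (H n)] [∀ n, Module k (H n)]

/-- A connected graded bialgebra is a Hopf algebra. -/
theorem HopfOps.IsBialgebra.isHopfAlgebra {o : GradedOps k H} (h : o.IsBialgebra)
    (hΔ : ∀ n (x : H n), o.comul (lof k ℕ H n x) ∈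
      ⨆ p ∈ Finset.HasAntidiagonal.antidiagonal n,
        LinearMap.range (TensorProduct.map (lof k ℕ H p.1) (lof k ℕ H p.2)))
    (h0 : LinearMap.range (lof k ℕ H 0) = Submodule.span k {o.unit 1}) : o.IsHopfAlgebra := by
  let _ := h.toRing
  let _ := h.toBialgebra
  obtain ⟨S, h1, h2⟩ := exists_conv_inverse (k := k) (A := ⨁ n, H n) (H := H)
    (LinearEquiv.refl k (⨁ n, H n)) hΔ (fun x => by
      have hx : lof k ℕ H 0 x ∈ Submodule.span k {o.unit 1} := h0 ▸ ⟨x, rfl⟩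
      obtain ⟨c, hc⟩ := Submodule.mem_span_singleton.1 hx
      refine ⟨c, hc.symm.trans ?_⟩
      rw [Algebra.algebraMap_eq_smul_one]; rfl)
  refine ⟨⨁ n, H n, h.toRing,
    { h.toBialgebra with
      antipode := S
      mul_antipode_rTensor_comul := congrArg WithConv.ofConv h1
      mul_antipode_lTensor_comul := congrArg WithConv.ofConv h2 }, LinearEquiv.refl k _,
    fun x y => rfl, fun c => ?_, fun x => ?_, fun x => rfl⟩
  · rw [Algebra.algebraMap_eq_smul_one]
    change o.unit c = c • o.unit 1
    rw [← map_smul, smul_eq_mul, _root_.mul_one]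
  · change TensorProduct.map LinearMap.id LinearMap.id (o.comul x) = o.comul x
    rw [TensorProduct.map_id, LinearMap.id_apply]

end HopfLaws

/-! ### Dual bases, Hopf pairings, and transport of bialgebra axioms across a form -/

section Duality

universe v w

variable {k : Type v} [CommRing k]

/-- The form on `V ⊗ V'` and `W ⊗ W'` induced by forms on `V`, `W` and on `V'`, `W'`. -/
def tensorFormTwo {V W V' W' : Type*} [AddCommGroup V] [Module k V] [AddCommGroup W] [Module k W]
    [AddCommGroup V'] [Module k V'] [AddCommGroup W'] [Module k W']
    (β : V →ₗ[k] W →ₗ[k] k) (γ : V' →ₗ[k] W' →ₗ[k] k) : V ⊗[k] V' →ₗ[k] W ⊗[k] W' →ₗ[k] k :=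
  TensorProduct.dualDistrib k W W' ∘ₗ TensorProduct.map β γ

section

variable {V W V' W' : Type*} [AddCommGroup V] [Module k V] [AddCommGroup W] [Module k W]
    [AddCommGroup V'] [Module k V'] [AddCommGroup W'] [Module k W']
    {β : V →ₗ[k] W →ₗ[k] k} {γ : V' →ₗ[k] W' →ₗ[k] k}

theorem tensorFormTwo_tmul (a : V) (b : V') (x : W) (y : W') :
    tensorFormTwo β γ (a ⊗ₜ b) (x ⊗ₜ y) = β a x * γ b y := by
  simp [tensorFormTwo]

theorem tensorFormTwo_self : tensorFormTwo β β = tensorForm β := rfl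

theorem tensorFormTwo_flip (s : V ⊗[k] V') (t : W ⊗[k] W') :
    tensorFormTwo β.flip γ.flip t s = tensorFormTwo β γ s t := by
  induction s with
  | zero => simp
  | add s s' h h' => simp [h, h']
  | tmul a b =>
    induction t with
    | zero => simp
    | add s s' h h' => simp only [map_add, LinearMap.add_apply, h, h']
    | tmul x y => simp only [tensorFormTwo_tmul, LinearMap.flip_apply]

theorem tensorForm_flip (s : V ⊗[k] V) (t : W ⊗[k] W) :
    tensorForm β.flip t s = tensorForm β s t :=
  tensorFormTwo_flip s t

/-- `V` and `W` have bases which are dual to each other under `β`. -/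
def HasDualBases (β : V →ₗ[k] W →ₗ[k] k) : Prop :=
  ∃ (ι : Type) (_ : DecidableEq ι) (bV : Module.Basis ι k V) (bW : Module.Basis ι k W),
    ∀ i j, β (bV i) (bW j) = if i = j then 1 else 0

namespace HasDualBases

theorem flip (h : HasDualBases β) : HasDualBases β.flip := by
  obtain ⟨ι, _, bV, bW, hb⟩ := h
  exact ⟨ι, inferInstance, bW, bV, fun i j => by
    rw [LinearMap.flip_apply, hb]; simp only [eq_comm]⟩

theorem tensor (h : HasDualBases β) (h' : HasDualBases γ) :
    HasDualBases (tensorFormTwo β γ) := by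
  obtain ⟨ι, _, bV, bW, hb⟩ := h
  obtain ⟨ι', _, bV', bW', hb'⟩ := h'
  refine ⟨ι × ι', inferInstance, bV.tensorProduct bV', bW.tensorProduct bW', ?_⟩
  rintro ⟨i, i'⟩ ⟨j, j'⟩
  rw [Module.Basis.tensorProduct_apply, Module.Basis.tensorProduct_apply, tensorFormTwo_tmul, hb,
    hb']
  simp only [Prod.mk.injEq, ite_and, mul_ite, mul_one, mul_zero]
  split_ifs <;> rfl

/-- The coordinates of a vector in one basis are its values against the dual basis. -/
theorem ext_left (h : HasDualBases β) {v v' : V} (hv : ∀ w, β v w = β v' w) : v = v' := by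
  obtain ⟨ι, _, bV, bW, hb⟩ := h
  have key : ∀ (v : V) (i : ι), β v (bW i) = bV.repr v i := by
    intro v i
    have : β.flip (bW i) = Finsupp.lapply i ∘ₗ bV.repr.toLinearMap := by
      refine bV.ext fun j => ?_
      simp [hb, Finsupp.single_apply]
    exact LinearMap.congr_fun this v
  apply bV.repr.injective
  ext i
  rw [← key, ← key, hv]

theorem ext_right (h : HasDualBases β) {w w' : W} (hw : ∀ v, β v w = β v w') : w = w' :=
  h.flip.ext_left hw

theorem ext_tensor (h : HasDualBases β) (h' : HasDualBases γ) {s t : V ⊗[k] V'}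
    (hs : ∀ x y, tensorFormTwo β γ s (x ⊗ₜ y) = tensorFormTwo β γ t (x ⊗ₜ y)) : s = t := by
  refine (h.tensor h').ext_left fun z => ?_
  induction z with
  | zero => simp
  | add a b ha hb => simp only [map_add, ha, hb]
  | tmul x y => exact hs x y

end HasDualBases

end

section

variable {V : Type*} {W : Type*} [AddCommGroup V] [Module k V] [AddCommGroup W] [Module k W]
  {oV : HopfOps k V} {oW : HopfOps k W} {β : V →ₗ[k] W →ₗ[k] k}

theorem IsHopfPairing.flip (h : IsHopfPairing oV oW β) : IsHopfPairing oW oV β.flip where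
  mul_left a b x := by
    rw [LinearMap.flip_apply, h.mul_right, tensorForm_flip]
  mul_right a x y := by
    rw [LinearMap.flip_apply, h.mul_left, tensorForm_flip]
  one_left x := h.one_right x
  one_right x := h.one_left x

/-- The compatibility of multiplication and comultiplication, in terms of a pairing. -/
def MackeyIdentity (oV : HopfOps k V) (oW : HopfOps k W) (β : V →ₗ[k] W →ₗ[k] k) : Prop :=
  ∀ a b x y, β (oV.mul a b) (oW.mul x y) =
    tensorFormTwo (tensorForm β) (tensorForm β)
      (TensorProduct.tensorTensorTensorComm k V V V V (oV.comul a ⊗ₜ oV.comul b))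
      (oW.comul x ⊗ₜ oW.comul y)

/-- The interchange of the two middle factors is self-adjoint. This makes the Mackey identity
symmetric in the two paired structures. -/
theorem tensorFormTwo_tensorTensorTensorComm {V₁ V₂ V₃ V₄ W₁ W₂ W₃ W₄ : Type*}
    [AddCommGroup V₁] [Module k V₁] [AddCommGroup V₂] [Module k V₂]
    [AddCommGroup V₃] [Module k V₃] [AddCommGroup V₄] [Module k V₄]
    [AddCommGroup W₁] [Module k W₁] [AddCommGroup W₂] [Module k W₂]
    [AddCommGroup W₃] [Module k W₃] [AddCommGroup W₄] [Module k W₄]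
    (β₁ : V₁ →ₗ[k] W₁ →ₗ[k] k) (β₂ : V₂ →ₗ[k] W₂ →ₗ[k] k) (β₃ : V₃ →ₗ[k] W₃ →ₗ[k] k)
    (β₄ : V₄ →ₗ[k] W₄ →ₗ[k] k) (s : (V₁ ⊗[k] V₂) ⊗[k] (V₃ ⊗[k] V₄))
    (t : (W₁ ⊗[k] W₃) ⊗[k] (W₂ ⊗[k] W₄)) :
    tensorFormTwo (tensorFormTwo β₁ β₃) (tensorFormTwo β₂ β₄)
        (TensorProduct.tensorTensorTensorComm k V₁ V₂ V₃ V₄ s) t =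
      tensorFormTwo (tensorFormTwo β₁ β₂) (tensorFormTwo β₃ β₄) s
        (TensorProduct.tensorTensorTensorComm k W₁ W₃ W₂ W₄ t) := by
  induction s with
  | zero => simp
  | add a b ha hb => simp only [map_add, LinearMap.add_apply, ha, hb]
  | tmul s s' =>
  induction s with
  | zero => simp
  | add a b ha hb => simp only [TensorProduct.add_tmul, map_add, LinearMap.add_apply, ha, hb]
  | tmul s₁ s₂ =>
  induction s' with
  | zero => simp
  | add a b ha hb => simp only [TensorProduct.tmul_add, map_add, LinearMap.add_apply, ha, hb]
  | tmul s₃ s₄ =>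
  induction t with
  | zero => simp
  | add a b ha hb => simp only [map_add, ha, hb]
  | tmul t t' =>
  induction t with
  | zero => simp
  | add a b ha hb => simp only [TensorProduct.add_tmul, map_add, ha, hb]
  | tmul t₁ t₂ =>
  induction t' with
  | zero => simp
  | add a b ha hb => simp only [TensorProduct.tmul_add, map_add, ha, hb]
  | tmul t₃ t₄ =>
    simp only [TensorProduct.tensorTensorTensorComm_tmul, tensorFormTwo_tmul]
    ring

/-- One identity thus serves both Hopf algebras: whatever is proved for the left one applies to the
right one through the flipped form. -/
theorem MackeyIdentity.flip (h : MackeyIdentity oV oW β) : MackeyIdentity oW oV β.flip := by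
  intro x y a b
  have h4 : tensorForm β.flip = (tensorForm β).flip := by
    ext1
    ext
    simp [tensorForm_tmul]
  rw [LinearMap.flip_apply, h, h4, tensorFormTwo_flip, ← tensorFormTwo_self,
    tensorFormTwo_tensorTensorTensorComm]

/-- The structure dual to a unital associative multiplication: `oV` is a bialgebra if it is
associative and unital and is paired with an associative unital `oW`. -/
theorem IsHopfPairing.isBialgebra_left (h : IsHopfPairing oV oW β) (hβ : HasDualBases β)
    (hM : MackeyIdentity oV oW β)
    (hVa : ∀ x y z, oV.mul (oV.mul x y) z = oV.mul x (oV.mul y z))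
    (hV1 : ∀ x, oV.mul (oV.unit 1) x = x) (hV1' : ∀ x, oV.mul x (oV.unit 1) = x)
    (hWa : ∀ x y z, oW.mul (oW.mul x y) z = oW.mul x (oW.mul y z))
    (hW1 : ∀ x, oW.mul (oW.unit 1) x = x) (hW1' : ∀ x, oW.mul x (oW.unit 1) = x)
    (hVΔ : oV.comul (oV.unit 1) = oV.unit 1 ⊗ₜ oV.unit 1)
    (hWΔ : oW.comul (oW.unit 1) = oW.unit 1 ⊗ₜ oW.unit 1)
    (h1 : β (oV.unit 1) (oW.unit 1) = 1) : oV.IsBialgebra where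
  mul_assoc := hVa
  one_mul := hV1
  mul_one := hV1'
  comul_one := hVΔ
  counit_one := by rw [← h.one_right, h1]
  -- The counit is evaluation against the unit of `oW`, and that unit is group-like.
  counit_mul x y := by
    rw [← h.one_right, h.mul_left, hWΔ, tensorForm_tmul, h.one_right, h.one_right]
  -- Evaluated against `x`, the counit laws of `oV` become the unit laws of `oW`.
  counit_left a := by
    apply (TensorProduct.lid k V).injective
    refine hβ.ext_left fun x => ?_
    have key : ∀ t : V ⊗[k] V, β (TensorProduct.lid k V (oV.counit.rTensor V t)) x =
        tensorForm β t (oW.unit 1 ⊗ₜ x) := by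
      intro t
      induction t with
      | zero => simp
      | add s t hs ht => simp only [map_add, LinearMap.add_apply, hs, ht]
      | tmul a b => simp [tensorForm_tmul, h.one_right]
    rw [key, ← h.mul_right, hW1, TensorProduct.lid_tmul, one_smul]
  counit_right a := by
    apply (TensorProduct.rid k V).injective
    refine hβ.ext_left fun x => ?_
    have key : ∀ t : V ⊗[k] V, β (TensorProduct.rid k V (oV.counit.lTensor V t)) x =
        tensorForm β t (x ⊗ₜ oW.unit 1) := by
      intro t
      induction t with
      | zero => simp
      | add s t hs ht => simp only [map_add, LinearMap.add_apply, hs, ht]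
      | tmul a b => simp [tensorForm_tmul, h.one_right, mul_comm]
    rw [key, ← h.mul_right, hW1', TensorProduct.rid_tmul, one_smul]
  -- Against `x ⊗ y ⊗ z` the two sides are the values of `a` on `(xy)z` and on `x(yz)`.
  coassoc a := by
    have key : ∀ (t : V ⊗[k] V) (x y z : W),
        tensorFormTwo β (tensorForm β)
          (TensorProduct.assoc k V V V (oV.comul.rTensor V t)) (x ⊗ₜ (y ⊗ₜ z)) =
        tensorForm β t (oW.mul x y ⊗ₜ z) := by
      intro t x y z
      induction t with
      | zero => simp
      | add s t hs ht => simp only [map_add, LinearMap.add_apply, hs, ht]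
      | tmul a b =>
        rw [LinearMap.rTensor_tmul, tensorForm_tmul, h.mul_right]
        generalize oV.comul a = s
        induction s with
        | zero => simp
        | add s t hs ht =>
          simp only [TensorProduct.add_tmul, map_add, LinearMap.add_apply, hs, ht, add_mul]
        | tmul c d =>
          rw [TensorProduct.assoc_tmul, tensorFormTwo_tmul, tensorForm_tmul, tensorForm_tmul,
            mul_assoc]
    have key' : ∀ (t : V ⊗[k] V) (x y z : W),
        tensorFormTwo β (tensorForm β) (oV.comul.lTensor V t) (x ⊗ₜ (y ⊗ₜ z)) =
        tensorForm β t (x ⊗ₜ oW.mul y z) := by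
      intro t x y z
      induction t with
      | zero => simp
      | add s t hs ht => simp only [map_add, LinearMap.add_apply, hs, ht]
      | tmul a b =>
        rw [LinearMap.lTensor_tmul, tensorForm_tmul, tensorFormTwo_tmul, h.mul_right]
    refine hβ.ext_tensor (hβ.tensor hβ) fun x t => ?_
    induction t with
    | zero => simp
    | add s t hs ht => rw [TensorProduct.tmul_add, map_add, map_add, hs, ht]
    | tmul y z =>
      change tensorFormTwo β (tensorForm β) _ _ = tensorFormTwo β (tensorForm β) _ _
      rw [key, key', ← h.mul_right, ← h.mul_right, hWa]
  -- Against `x ⊗ y` the left side is `⟨ab, xy⟩`, to which the Mackey identity applies.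
  comul_mul a b := by
    refine hβ.ext_tensor hβ fun x y => ?_
    rw [tensorFormTwo_self, ← h.mul_right, hM]
    generalize oV.comul a = s
    generalize oV.comul b = t
    induction s with
    | zero => simp
    | add s s' hs hs' => simp only [TensorProduct.add_tmul, map_add, LinearMap.add_apply, hs, hs']
    | tmul a a' =>
    induction t with
    | zero => simp
    | add s s' hs hs' => simp only [TensorProduct.tmul_add, map_add, LinearMap.add_apply, hs, hs']
    | tmul b b' =>
      rw [TensorProduct.map₂_apply_tmul, TensorProduct.map_tmul, tensorForm_tmul, h.mul_left, h.mul_left,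
        TensorProduct.tensorTensorTensorComm_tmul, tensorFormTwo_tmul]

end

end Duality

/-! ### From graded components to operations, forms and dual pairs -/

section Graded

universe v w

open DirectSum Finset.HasAntidiagonal

variable {k : Type v} [CommRing k]
  {H : ℕ → Type w} [∀ n, AddCommGroup (H n)] [∀ n, Module k (H n)]
  {H' : ℕ → Type w} [∀ n, AddCommGroup (H' n)] [∀ n, Module k (H' n)]

/-- Graded components of a multiplication, unit, comultiplication and counit on `⨁ H_n`. -/
structure ComponentOps (k : Type v) [CommRing k] (H : ℕ → Type w) [∀ n, AddCommGroup (H n)]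
    [∀ n, Module k (H n)] where
  mul : ∀ {m n N : ℕ}, m + n = N → H m →ₗ[k] H n →ₗ[k] H N
  one : H 0
  comul : ∀ {m n N : ℕ}, m + n = N → H N →ₗ[k] H m ⊗[k] H n
  counit : H 0 →ₗ[k] k

/-- The operations with the given graded components. -/
def ComponentOps.ops (G : ComponentOps k H) : GradedOps k H :=
  assembleOps (fun _ _ => G.mul rfl) G.one G.comul G.counit

section Assemble

variable (G : ComponentOps k H)

/-- The target degree is a variable `N` with a proof of `m + n = N`, so associativity and unit laws
can be stated in components without casts between degrees. -/
theorem ComponentOps.ops_mul_lof {m n N : ℕ} (h : m + n = N) (x : H m) (y : H n) :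
    G.ops.mul (lof k ℕ H m x) (lof k ℕ H n y) =
      lof k ℕ H N (G.mul h x y) := by
  subst h
  simp [ComponentOps.ops, assembleOps]

theorem ComponentOps.ops_comul_lof (N : ℕ) (x : H N) :
    G.ops.comul (lof k ℕ H N x) =
      ∑ p : Finset.HasAntidiagonal.antidiagonal N,
        TensorProduct.map (lof k ℕ H p.1.1) (lof k ℕ H p.1.2) (G.comul (mem_antidiagonal.1 p.2) x) := by
  simp [ComponentOps.ops, assembleOps]

theorem ComponentOps.ops_unit_one :
    G.ops.unit 1 = lof k ℕ H 0 G.one := by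
  simp [ComponentOps.ops, assembleOps]

theorem ComponentOps.ops_counit_lof_zero (x : H 0) :
    G.ops.counit (lof k ℕ H 0 x) = G.counit x := by
  simp [ComponentOps.ops, assembleOps, component.lof_self]

theorem ComponentOps.ops_counit_lof_of_ne {n : ℕ} (hn : n ≠ 0) (x : H n) :
    G.ops.counit (lof k ℕ H n x) = 0 := by
  simp only [ComponentOps.ops, assembleOps, LinearMap.comp_apply, component.of]
  rw [dif_neg hn, map_zero]

theorem ComponentOps.ops_comul_mem (N : ℕ) (x : H N) :
    G.ops.comul (lof k ℕ H N x) ∈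
      ⨆ p ∈ Finset.HasAntidiagonal.antidiagonal N,
        LinearMap.range (TensorProduct.map (lof k ℕ H p.1) (lof k ℕ H p.2)) := by
  rw [ComponentOps.ops_comul_lof]
  refine Submodule.sum_mem _ fun p _ => ?_
  exact Submodule.mem_iSup_of_mem p.1 (Submodule.mem_iSup_of_mem p.2 ⟨_, rfl⟩)

theorem ComponentOps.ops_mul_assoc
    (hμ : ∀ {l m n lm mn N : ℕ} (h₁ : l + m = lm) (h₂ : lm + n = N) (h₃ : m + n = mn)
      (h₄ : l + mn = N) (x : H l) (y : H m) (z : H n), G.mul h₂ (G.mul h₁ x y) z = G.mul h₄ x (G.mul h₃ y z))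
    (x y z : ⨁ n, H n) :
    G.ops.mul
        (G.ops.mul x y) z =
      G.ops.mul x
        (G.ops.mul y z) := by
  induction x using DirectSum.induction_on with
  | zero => simp
  | add a b ha hb => simp only [map_add, LinearMap.add_apply, ha, hb]
  | of l x =>
  induction y using DirectSum.induction_on with
  | zero => simp
  | add a b ha hb => simp only [map_add, LinearMap.add_apply, ha, hb]
  | of m y =>
  induction z using DirectSum.induction_on with
  | zero => simp
  | add a b ha hb => simp only [map_add, ha, hb]
  | of n z =>
    simp only [← lof_eq_of k]
    rw [ComponentOps.ops_mul_lof G rfl, ComponentOps.ops_mul_lof G rfl,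
      ComponentOps.ops_mul_lof G rfl, ComponentOps.ops_mul_lof G (add_assoc l m n).symm,
      hμ rfl rfl rfl (add_assoc l m n).symm]

theorem ComponentOps.ops_one_mul (h1 : ∀ {n : ℕ} (x : H n), G.mul (zero_add n) G.one x = x)
    (x : ⨁ n, H n) :
    G.ops.mul
      (G.ops.unit 1) x = x := by
  induction x using DirectSum.induction_on with
  | zero => simp
  | add a b ha hb => rw [map_add, ha, hb]
  | of l x => rw [← lof_eq_of k, ComponentOps.ops_unit_one, ComponentOps.ops_mul_lof G (zero_add l), h1]

theorem ComponentOps.ops_mul_one (h1 : ∀ {n : ℕ} (x : H n), G.mul (add_zero n) x G.one = x)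
    (x : ⨁ n, H n) :
    G.ops.mul x
      (G.ops.unit 1) = x := by
  induction x using DirectSum.induction_on with
  | zero => simp
  | add a b ha hb => rw [map_add, LinearMap.add_apply, ha, hb]
  | of l x => rw [← lof_eq_of k, ComponentOps.ops_unit_one, ComponentOps.ops_mul_lof G (add_zero l), h1]

theorem ComponentOps.ops_comul_one (h1 : G.comul (zero_add 0) G.one = G.one ⊗ₜ G.one) :
    G.ops.comul
        (G.ops.unit 1) =
      G.ops.unit 1 ⊗ₜ
        G.ops.unit 1 := by
  rw [ComponentOps.ops_unit_one, ComponentOps.ops_comul_lof, Finset.sum_eq_single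
    (⟨(0, 0), mem_antidiagonal.2 rfl⟩ : {p // p ∈ Finset.HasAntidiagonal.antidiagonal 0})]
  · rw [h1, TensorProduct.map_tmul]
  · rintro ⟨⟨i, j⟩, hp⟩ - hne
    have := mem_antidiagonal.1 hp
    refine absurd ?_ hne
    simp only at this
    simp only [Subtype.mk.injEq, Prod.mk.injEq]
    omega
  · intro h; exact absurd (Finset.mem_univ _) h

/-- The bialgebra of a graded connected Hopf algebra from its graded components. -/
theorem ComponentOps.ops_isGradedConnectedHopf [∀ n, Module.Free k (H n)] [∀ n, Module.Finite k (H n)]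
    (hc : ∀ x : H 0, ∃ c : k, x = c • G.one)
    (hb : G.ops.IsBialgebra) :
    IsGradedConnectedHopf G.ops := by
  have hconn : LinearMap.range (lof k ℕ H 0) =
      Submodule.span k {G.ops.unit 1} := by
    rw [ComponentOps.ops_unit_one]
    ext y
    rw [Submodule.mem_span_singleton]
    constructor
    · rintro ⟨x, rfl⟩
      obtain ⟨c, rfl⟩ := hc x
      exact ⟨c, (map_smul _ _ _).symm⟩
    · rintro ⟨c, rfl⟩
      exact ⟨c • G.one, map_smul _ _ _⟩
  exact
    { hopf := hb.isHopfAlgebra (ComponentOps.ops_comul_mem G) hconn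
      free := inferInstance
      finite := inferInstance
      mul_mem := fun m n x y => ⟨_, (ComponentOps.ops_mul_lof G rfl x y).symm⟩
      comul_mem := ComponentOps.ops_comul_mem G
      unit_mem := fun c => ⟨c • G.one, by
        rw [map_smul, ← ComponentOps.ops_unit_one, ← map_smul, smul_eq_mul, mul_one]⟩
      counit_eq_zero := fun n hn x => ComponentOps.ops_counit_lof_of_ne G hn.ne' x
      connected := hconn }

end Assemble

section Form

variable (β : ∀ n, H' n →ₗ[k] H n →ₗ[k] k)

theorem assembleForm_lof (n : ℕ) (a : H' n) (x : H n) :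
    assembleForm β (lof k ℕ H' n a) (lof k ℕ H n x) = β n a x := by
  simp [assembleForm, component.lof_self]

theorem assembleForm_lof_of_ne {m n : ℕ} (h : m ≠ n) (a : H' m) (x : H n) :
    assembleForm β (lof k ℕ H' m a) (lof k ℕ H n x) = 0 := by
  simp only [assembleForm, toModule_lof, LinearMap.comp_apply, LinearMap.lcomp_apply, component.of]
  rw [dif_neg h.symm, map_zero]

/-- The union of the dual bases of the pieces works because different degrees are orthogonal. -/
theorem hasDualBases_assembleForm (h : ∀ n, HasDualBases (β n)) :
    HasDualBases (assembleForm β) := by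
  choose ι hι bV bW hb using h
  let BV : Module.Basis (Σ n, ι n) k (⨁ n, H' n) := DFinsupp.basis bV
  let BW : Module.Basis (Σ n, ι n) k (⨁ n, H n) := DFinsupp.basis bW
  have hBV : ∀ n i, BV ⟨n, i⟩ = lof k ℕ H' n (bV n i) := fun n i => by
    change BV.repr.symm _ = _
    apply BV.repr.injective
    rw [LinearEquiv.apply_symm_apply]
    ext ⟨m, j⟩
    change _ = (bV m).repr ((lof k ℕ H' n (bV n i)) m) j
    by_cases hmn : n = m
    · subst hmn
      rw [DirectSum.lof_apply, Module.Basis.repr_self, Finsupp.single_apply, Finsupp.single_apply]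
      simp
    · rw [lof_eq_of, DirectSum.of_eq_of_ne _ _ _ (Ne.symm hmn), map_zero, Finsupp.zero_apply,
        Finsupp.single_apply, if_neg]
      intro h
      exact hmn (congrArg Sigma.fst h)
  have hBW : ∀ n i, BW ⟨n, i⟩ = lof k ℕ H n (bW n i) := fun n i => by
    change BW.repr.symm _ = _
    apply BW.repr.injective
    rw [LinearEquiv.apply_symm_apply]
    ext ⟨m, j⟩
    change _ = (bW m).repr ((lof k ℕ H n (bW n i)) m) j
    by_cases hmn : n = m
    · subst hmn
      rw [DirectSum.lof_apply, Module.Basis.repr_self, Finsupp.single_apply, Finsupp.single_apply]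
      simp
    · rw [lof_eq_of, DirectSum.of_eq_of_ne _ _ _ (Ne.symm hmn), map_zero, Finsupp.zero_apply,
        Finsupp.single_apply, if_neg]
      intro h
      exact hmn (congrArg Sigma.fst h)
  refine ⟨Σ n, ι n, inferInstance, BV, BW, ?_⟩
  rintro ⟨m, i⟩ ⟨n, j⟩
  rw [hBV, hBW]
  by_cases hmn : m = n
  · subst hmn
    rw [assembleForm_lof, hb]
    simp
  · rw [assembleForm_lof_of_ne β hmn, if_neg]
    intro h
    exact hmn (congrArg Sigma.fst h)

theorem tensorForm_assembleForm_map {m n : ℕ} (s : H' m ⊗[k] H' n) (t : H m ⊗[k] H n) :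
    tensorForm (assembleForm β)
        (TensorProduct.map (lof k ℕ H' m) (lof k ℕ H' n) s)
        (TensorProduct.map (lof k ℕ H m) (lof k ℕ H n) t) =
      tensorFormTwo (β m) (β n) s t := by
  induction s with
  | zero => simp
  | add a b ha hb => simp only [map_add, LinearMap.add_apply, ha, hb]
  | tmul a b =>
    induction t with
    | zero => simp
    | add a b ha hb => simp only [map_add, ha, hb]
    | tmul x y =>
      rw [TensorProduct.map_tmul, TensorProduct.map_tmul, tensorForm_tmul, tensorFormTwo_tmul,
        assembleForm_lof, assembleForm_lof]

theorem tensorForm_assembleForm_map_of_ne {m n m' n' : ℕ} (h : ¬ (m = m' ∧ n = n'))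
    (s : H' m ⊗[k] H' n) (t : H m' ⊗[k] H n') :
    tensorForm (assembleForm β)
        (TensorProduct.map (lof k ℕ H' m) (lof k ℕ H' n) s)
        (TensorProduct.map (lof k ℕ H m') (lof k ℕ H n') t) = 0 := by
  induction s with
  | zero => simp
  | add a b ha hb => simp only [map_add, LinearMap.add_apply, ha, hb, add_zero]
  | tmul a b =>
    induction t with
    | zero => simp
    | add a b ha hb => simp only [map_add, ha, hb, add_zero]
    | tmul x y =>
      rw [TensorProduct.map_tmul, TensorProduct.map_tmul, tensorForm_tmul]
      by_cases hm : m = m'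
      · rw [assembleForm_lof_of_ne β (fun hn => h ⟨hm, hn⟩), mul_zero]
      · rw [assembleForm_lof_of_ne β hm, zero_mul]

variable (G : ComponentOps k H)

/-- Orthogonality of different degrees leaves only the summand of the coproduct in bidegree `(m,
n)`. -/
theorem tensorForm_ops_comul {m n N : ℕ} (h : m + n = N) (s : H' m ⊗[k] H' n) (x : H N) :
    tensorForm (assembleForm β) (TensorProduct.map (lof k ℕ H' m) (lof k ℕ H' n) s)
        (G.ops.comul (lof k ℕ H N x)) =
      tensorFormTwo (β m) (β n) s (G.comul h x) := by
  rw [ComponentOps.ops_comul_lof, map_sum, Finset.sum_eq_single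
    (⟨(m, n), mem_antidiagonal.2 h⟩ : {p // p ∈ Finset.HasAntidiagonal.antidiagonal N}),
    tensorForm_assembleForm_map]
  · rintro ⟨⟨i, j⟩, hp⟩ - hne
    refine tensorForm_assembleForm_map_of_ne β ?_ _ _
    rintro ⟨rfl, rfl⟩
    exact hne rfl
  · intro h; exact absurd (Finset.mem_univ _) h

theorem tensorForm_ops_comul_of_ne {m n N : ℕ} (h : m + n ≠ N) (s : H' m ⊗[k] H' n)
    (x : H N) :
    tensorForm (assembleForm β) (TensorProduct.map (lof k ℕ H' m) (lof k ℕ H' n) s)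
        (G.ops.comul (lof k ℕ H N x)) = 0 := by
  rw [ComponentOps.ops_comul_lof, map_sum]
  refine Finset.sum_eq_zero ?_
  rintro ⟨⟨i, j⟩, hp⟩ -
  refine tensorForm_assembleForm_map_of_ne β ?_ _ _
  rintro ⟨rfl, rfl⟩
  exact h (mem_antidiagonal.1 hp)

end Form

section Pair

variable (β : ∀ n, H' n →ₗ[k] H n →ₗ[k] k)
  (G : ComponentOps k H)
  (G' : ComponentOps k H')

theorem assembleForm_flip (a : ⨁ n, H' n) (x : ⨁ n, H n) :
    assembleForm (fun n => (β n).flip) x a = assembleForm β a x := by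
  induction a using DirectSum.induction_on with
  | zero => simp
  | add a b ha hb => simp only [map_add, LinearMap.add_apply, ha, hb]
  | of m a =>
  induction x using DirectSum.induction_on with
  | zero => simp
  | add a b ha hb => simp only [map_add, LinearMap.add_apply, ha, hb]
  | of n x =>
    rw [← lof_eq_of k, ← lof_eq_of k]
    by_cases h : m = n
    · subst h
      rw [assembleForm_lof, assembleForm_lof]; rfl
    · rw [assembleForm_lof_of_ne _ h, assembleForm_lof_of_ne _ (Ne.symm h)]

theorem assembleForm_mul_left
    (adj : ∀ {m n N : ℕ} (h : m + n = N) a b x,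
      β N (G'.mul h a b) x = tensorFormTwo (β m) (β n) (a ⊗ₜ b) (G.comul h x))
    (a b : ⨁ n, H' n) (x : ⨁ n, H n) :
    assembleForm β (G'.ops.mul a b) x =
      tensorForm (assembleForm β) (a ⊗ₜ b)
        (G.ops.comul x) := by
  induction a using DirectSum.induction_on with
  | zero => simp
  | add a b ha hb => simp only [TensorProduct.add_tmul, map_add, LinearMap.add_apply, ha, hb]
  | of m a =>
  induction b using DirectSum.induction_on with
  | zero => simp
  | add a b ha hb => simp only [TensorProduct.tmul_add, map_add, LinearMap.add_apply, ha, hb]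
  | of n b =>
  induction x using DirectSum.induction_on with
  | zero => simp
  | add a b ha hb => simp only [map_add, ha, hb]
  | of N x =>
    rw [← lof_eq_of k, ← lof_eq_of k, ← lof_eq_of k, ← TensorProduct.map_tmul]
    by_cases h : m + n = N
    · rw [ComponentOps.ops_mul_lof G' h, assembleForm_lof, adj,
        tensorForm_ops_comul β G h]
    · rw [ComponentOps.ops_mul_lof G' rfl, assembleForm_lof_of_ne β h,
        tensorForm_ops_comul_of_ne β G h]

theorem assembleForm_one_left (hε : ∀ x, β 0 G'.one x = G.counit x) (x : ⨁ n, H n) :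
    assembleForm β (G'.ops.unit 1) x =
      G.ops.counit x := by
  induction x using DirectSum.induction_on with
  | zero => simp
  | add a b ha hb => simp only [map_add, ha, hb]
  | of N x =>
    rw [← lof_eq_of k, ComponentOps.ops_unit_one]
    by_cases h : N = 0
    · subst h
      rw [assembleForm_lof, ComponentOps.ops_counit_lof_zero, hε]
    · rw [assembleForm_lof_of_ne β (Ne.symm h), ComponentOps.ops_counit_lof_of_ne G h]

theorem ComponentOps.ops_isHopfPairing
    (adj : ∀ {m n N : ℕ} (h : m + n = N) a b x,
      β N (G'.mul h a b) x = tensorFormTwo (β m) (β n) (a ⊗ₜ b) (G.comul h x))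
    (adj' : ∀ {m n N : ℕ} (h : m + n = N) a x y,
      β N a (G.mul h x y) = tensorFormTwo (β m) (β n) (G'.comul h a) (x ⊗ₜ y))
    (hε : ∀ x, β 0 G'.one x = G.counit x) (hε' : ∀ a, β 0 a G.one = G'.counit a) :
    IsHopfPairing G'.ops
      G.ops (assembleForm β) where
  mul_left := assembleForm_mul_left β G G' adj
  mul_right a x y := by
    -- The second adjointness is the first one for the flipped forms, with the two structures
    -- exchanged.
    have h := assembleForm_mul_left (fun n => (β n).flip) G' G
      (fun h x y a => by
        rw [LinearMap.flip_apply, adj', tensorFormTwo_flip]) x y a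
    have hf : assembleForm (fun n => (β n).flip) = (assembleForm β).flip :=
      LinearMap.ext fun x => LinearMap.ext fun a => assembleForm_flip β a x
    rw [hf, tensorForm_flip] at h
    exact h
  one_left := assembleForm_one_left β G G' hε
  one_right a := by
    have h := assembleForm_one_left (fun n => (β n).flip) G' G
      (fun x => hε' x) a
    rw [assembleForm_flip] at h
    exact h

instance AlgebraTower.MackeyIndex.instFintype (m n i j : ℕ) :
    Fintype (AlgebraTower.MackeyIndex m n i j) := Fintype.ofFinite _

theorem tensorForm_mackey_term {r s t q i j : ℕ} (u : H' r ⊗[k] H' s) (v : H' t ⊗[k] H' q)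
    (x : H i) (y : H j) (hi : r + t = i) (hj : s + q = j) :
    tensorFormTwo (tensorForm (assembleForm β)) (tensorForm (assembleForm β))
      (TensorProduct.tensorTensorTensorComm k _ _ _ _
        (TensorProduct.map (lof k ℕ H' r) (lof k ℕ H' s) u ⊗ₜ
          TensorProduct.map (lof k ℕ H' t) (lof k ℕ H' q) v))
      (G.ops.comul (lof k ℕ H i x) ⊗ₜ G.ops.comul (lof k ℕ H j y)) =
    tensorFormTwo (tensorFormTwo (β r) (β t)) (tensorFormTwo (β s) (β q))
      (TensorProduct.tensorTensorTensorComm k _ _ _ _ (u ⊗ₜ v))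
      (G.comul hi x ⊗ₜ G.comul hj y) := by
  induction u with
  | zero => simp
  | add a b ha hb => simp only [TensorProduct.add_tmul, map_add, LinearMap.add_apply, ha, hb]
  | tmul a a' =>
  induction v with
  | zero => simp
  | add a b ha hb => simp only [TensorProduct.tmul_add, map_add, LinearMap.add_apply, ha, hb]
  | tmul b b' =>
    rw [TensorProduct.map_tmul, TensorProduct.map_tmul, TensorProduct.tensorTensorTensorComm_tmul,
      TensorProduct.tensorTensorTensorComm_tmul, tensorFormTwo_tmul, tensorFormTwo_tmul,
      ← TensorProduct.map_tmul, ← TensorProduct.map_tmul, tensorForm_ops_comul β G hi,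
      tensorForm_ops_comul β G hj]

/-- After the interchange the tensor has bidegrees `(r, t)` and `(s, q)`, which are orthogonal to
coproducts of elements of degrees `i` and `j` unless the totals match. The surviving quadruples are
those of `MackeyIndex`. -/
theorem tensorForm_mackey_term_of_ne {r s t q i j : ℕ} (u : H' r ⊗[k] H' s) (v : H' t ⊗[k] H' q)
    (x : H i) (y : H j) (h : ¬ (r + t = i ∧ s + q = j)) :
    tensorFormTwo (tensorForm (assembleForm β)) (tensorForm (assembleForm β))
      (TensorProduct.tensorTensorTensorComm k _ _ _ _
        (TensorProduct.map (lof k ℕ H' r) (lof k ℕ H' s) u ⊗ₜ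
          TensorProduct.map (lof k ℕ H' t) (lof k ℕ H' q) v))
      (G.ops.comul (lof k ℕ H i x) ⊗ₜ G.ops.comul (lof k ℕ H j y)) = 0 := by
  induction u with
  | zero => simp
  | add a b ha hb =>
    simp only [TensorProduct.add_tmul, map_add, LinearMap.add_apply, ha, hb, add_zero]
  | tmul a a' =>
  induction v with
  | zero => simp
  | add a b ha hb =>
    simp only [TensorProduct.tmul_add, map_add, LinearMap.add_apply, ha, hb, add_zero]
  | tmul b b' =>
    rw [TensorProduct.map_tmul, TensorProduct.map_tmul, TensorProduct.tensorTensorTensorComm_tmul,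
      tensorFormTwo_tmul, ← TensorProduct.map_tmul, ← TensorProduct.map_tmul]
    by_cases hi : r + t = i
    · rw [tensorForm_ops_comul_of_ne β G (fun hj => h ⟨hi, hj⟩), mul_zero]
    · rw [tensorForm_ops_comul_of_ne β G hi, zero_mul]

/-- The Mackey identity follows from that for the graded components. -/
theorem ComponentOps.mackeyIdentity
    (hM : ∀ {m n i j N : ℕ} (h : m + n = N) (h' : i + j = N) a b x y,
      β N (G'.mul h a b) (G.mul h' x y) = ∑ p : AlgebraTower.MackeyIndex m n i j,
        tensorFormTwo (tensorFormTwo (β p.r) (β p.t)) (tensorFormTwo (β p.s) (β p.q))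
          (TensorProduct.tensorTensorTensorComm k _ _ _ _ (G'.comul p.hm a ⊗ₜ G'.comul p.hn b))
          (G.comul p.hk x ⊗ₜ G.comul p.hl y)) :
    MackeyIdentity G'.ops G.ops (assembleForm β) := by
  intro a b x y
  induction a using DirectSum.induction_on with
  | zero => simp
  | add a b ha hb => simp only [TensorProduct.add_tmul, map_add, LinearMap.add_apply, ha, hb]
  | of m a =>
  induction b using DirectSum.induction_on with
  | zero => simp
  | add a b ha hb => simp only [TensorProduct.tmul_add, map_add, LinearMap.add_apply, ha, hb]
  | of n b =>
  induction x using DirectSum.induction_on with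
  | zero => simp
  | add a b ha hb => simp only [TensorProduct.add_tmul, map_add, LinearMap.add_apply, ha, hb]
  | of i x =>
  induction y using DirectSum.induction_on with
  | zero => simp
  | add a b ha hb => simp only [TensorProduct.tmul_add, map_add, ha, hb]
  | of j y =>
    simp only [← lof_eq_of k]
    rw [ComponentOps.ops_mul_lof G' rfl, ComponentOps.ops_mul_lof G rfl,
      ComponentOps.ops_comul_lof G', ComponentOps.ops_comul_lof G', TensorProduct.sum_tmul,
      map_sum, map_sum, LinearMap.sum_apply]
    simp only [TensorProduct.tmul_sum, map_sum, LinearMap.sum_apply]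
    rw [← Fintype.sum_prod_type']
    -- The expanded coproducts are indexed by all pairs of decompositions `m = r + s`, `n = t + q`;
    -- the image of `f` consists of those pairs that can contribute.
    let f : AlgebraTower.MackeyIndex m n i j →
        {p // p ∈ Finset.HasAntidiagonal.antidiagonal m} ×
          {p // p ∈ Finset.HasAntidiagonal.antidiagonal n} :=
      fun p => (⟨(p.r, p.s), mem_antidiagonal.2 p.hm⟩, ⟨(p.t, p.q), mem_antidiagonal.2 p.hn⟩)
    have hf : Function.Injective f := by
      rintro ⟨r, s, t, q, h1, h2, h3, h4⟩ ⟨r', s', t', q', h1', h2', h3', h4'⟩ h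
      simp only [f, Prod.mk.injEq, Subtype.mk.injEq] at h
      obtain ⟨⟨rfl, rfl⟩, rfl, rfl⟩ := h
      rfl
    by_cases h : i + j = m + n
    · rw [← ComponentOps.ops_mul_lof G rfl, ComponentOps.ops_mul_lof G h, assembleForm_lof,
        hM rfl h]
      refine Fintype.sum_of_injective f hf _ _ ?_ ?_
      · rintro ⟨⟨⟨r, s⟩, hp⟩, ⟨⟨t, q⟩, hq⟩⟩ hne
        refine tensorForm_mackey_term_of_ne β G _ _ x y ?_
        rintro ⟨hi, hj⟩
        exact hne ⟨⟨r, s, t, q, mem_antidiagonal.1 hp, mem_antidiagonal.1 hq, hi, hj⟩, rfl⟩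
      · intro p
        exact (tensorForm_mackey_term β G _ _ x y p.hk p.hl).symm
    -- In the remaining case the total degrees differ, and both sides vanish.
    · rw [assembleForm_lof_of_ne β (Ne.symm h)]
      refine (Finset.sum_eq_zero ?_).symm
      rintro ⟨⟨⟨r, s⟩, hp⟩, ⟨⟨t, q⟩, hq⟩⟩ -
      refine tensorForm_mackey_term_of_ne β G _ _ x y ?_
      rintro ⟨hi, hj⟩
      have h1 := mem_antidiagonal.1 hp
      have h2 := mem_antidiagonal.1 hq
      simp only at h1 h2 hi hj
      omega

/-- A dual pair of Hopf algebras from its graded components. -/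
theorem ComponentOps.isDualPair (hβ : ∀ n, HasDualBases (β n))
    [∀ n, Module.Free k (H n)] [∀ n, Module.Finite k (H n)]
    [∀ n, Module.Free k (H' n)] [∀ n, Module.Finite k (H' n)]
    (hp : ∀ n, (β n).IsPerfPair)
    (adj : ∀ {m n N : ℕ} (h : m + n = N) a b x,
      β N (G'.mul h a b) x = tensorFormTwo (β m) (β n) (a ⊗ₜ b) (G.comul h x))
    (adj' : ∀ {m n N : ℕ} (h : m + n = N) a x y,
      β N a (G.mul h x y) = tensorFormTwo (β m) (β n) (G'.comul h a) (x ⊗ₜ y))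
    (hε : ∀ x, β 0 G'.one x = G.counit x) (hε' : ∀ a, β 0 a G.one = G'.counit a)
    (h1 : β 0 G'.one G.one = 1)
    (hc : ∀ x : H 0, ∃ c : k, x = c • G.one) (hc' : ∀ x : H' 0, ∃ c : k, x = c • G'.one)
    (assoc : ∀ {l m n lm mn N : ℕ} (h₁ : l + m = lm) (h₂ : lm + n = N) (h₃ : m + n = mn)
      (h₄ : l + mn = N) x y z, G.mul h₂ (G.mul h₁ x y) z = G.mul h₄ x (G.mul h₃ y z))
    (assoc' : ∀ {l m n lm mn N : ℕ} (h₁ : l + m = lm) (h₂ : lm + n = N) (h₃ : m + n = mn)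
      (h₄ : l + mn = N) x y z, G'.mul h₂ (G'.mul h₁ x y) z = G'.mul h₄ x (G'.mul h₃ y z))
    (one_mul : ∀ {n : ℕ} (x : H n), G.mul (zero_add n) G.one x = x)
    (mul_one : ∀ {n : ℕ} (x : H n), G.mul (add_zero n) x G.one = x)
    (one_mul' : ∀ {n : ℕ} (x : H' n), G'.mul (zero_add n) G'.one x = x)
    (mul_one' : ∀ {n : ℕ} (x : H' n), G'.mul (add_zero n) x G'.one = x)
    (comul_one : G.comul (zero_add 0) G.one = G.one ⊗ₜ G.one)
    (comul_one' : G'.comul (zero_add 0) G'.one = G'.one ⊗ₜ G'.one)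
    (hM : ∀ {m n i j N : ℕ} (h : m + n = N) (h' : i + j = N) a b x y,
      β N (G'.mul h a b) (G.mul h' x y) = ∑ p : AlgebraTower.MackeyIndex m n i j,
        tensorFormTwo (tensorFormTwo (β p.r) (β p.t)) (tensorFormTwo (β p.s) (β p.q))
          (TensorProduct.tensorTensorTensorComm k _ _ _ _ (G'.comul p.hm a ⊗ₜ G'.comul p.hn b))
          (G.comul p.hk x ⊗ₜ G.comul p.hl y)) :
    IsDualPair G.ops G'.ops (assembleForm β) := by
  have hpair := ComponentOps.ops_isHopfPairing β G G' adj adj' hε hε'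
  have hdual := hasDualBases_assembleForm β hβ
  have hmack := ComponentOps.mackeyIdentity β G G' hM
  have hone : assembleForm β (G'.ops.unit 1) (G.ops.unit 1) = 1 := by
    rw [ComponentOps.ops_unit_one, ComponentOps.ops_unit_one, assembleForm_lof, h1]
  have hb' := hpair.isBialgebra_left hdual hmack (ComponentOps.ops_mul_assoc G' assoc')
    (ComponentOps.ops_one_mul G' one_mul') (ComponentOps.ops_mul_one G' mul_one')
    (ComponentOps.ops_mul_assoc G assoc)
    (ComponentOps.ops_one_mul G one_mul) (ComponentOps.ops_mul_one G mul_one)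
    (ComponentOps.ops_comul_one G' comul_one') (ComponentOps.ops_comul_one G comul_one) hone
  -- The same transport lemma gives the other bialgebra, since the pairing, the dual bases and the
  -- Mackey identity can all be flipped.
  have hb := hpair.flip.isBialgebra_left hdual.flip hmack.flip (ComponentOps.ops_mul_assoc G assoc)
    (ComponentOps.ops_one_mul G one_mul) (ComponentOps.ops_mul_one G mul_one)
    (ComponentOps.ops_mul_assoc G' assoc')
    (ComponentOps.ops_one_mul G' one_mul') (ComponentOps.ops_mul_one G' mul_one')
    (ComponentOps.ops_comul_one G comul_one) (ComponentOps.ops_comul_one G' comul_one') hone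
  refine ⟨ComponentOps.ops_isGradedConnectedHopf G hc hb,
    ComponentOps.ops_isGradedConnectedHopf G' hc' hb', hpair,
    fun m n h x y => assembleForm_lof_of_ne β h x y, fun n => ?_⟩
  have h2 : (assembleForm β).compl₁₂ (lof k ℕ H' n) (lof k ℕ H n) = β n :=
    LinearMap.ext fun a => LinearMap.ext fun x => assembleForm_lof β n a x
  rw [h2]
  exact hp n

end Pair

end Graded

/-! ### Projective covers of simple modules over artinian rings -/

section ProjectiveCover

variable {R : Type u} [Ring R]

theorem projective_of_equiv_prod {P A B : Type u} [AddCommGroup P] [Module R P] [AddCommGroup A]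
    [Module R A] [AddCommGroup B] [Module R B] [Module.Projective R P] (e : P ≃ₗ[R] A × B) :
    Module.Projective R A :=
  Module.Projective.of_split (e.symm.toLinearMap ∘ₗ LinearMap.inl R A B)
    (LinearMap.fst R A B ∘ₗ e.toLinearMap) (by ext; simp)

/-- A simple quotient of a nonzero finitely generated module. -/
theorem exists_simple_quotient (P : Type u) [AddCommGroup P] [Module R P] [Module.Finite R P]
    [Nontrivial P] : ∃ (S : FGModuleCat.{u} R) (p : P →ₗ[R] S), IsSimpleModule R S ∧ p ≠ 0 := by
  obtain h | ⟨N, hN, -⟩ := eq_top_or_exists_le_coatom (⊥ : Submodule R P)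
  · exact absurd h bot_ne_top
  · refine ⟨FGModuleCat.of R (P ⧸ N), N.mkQ, isSimpleModule_iff_isCoatom.2 hN, fun h => hN.1 ?_⟩
    have h' : N.mkQ = 0 := h
    rw [← N.ker_mkQ, h', LinearMap.ker_zero]

/-- `π : X → S` is right minimal. -/
def IsRightMinimal {X S : Type u} [AddCommGroup X] [Module R X] [AddCommGroup S] [Module R S]
    (π : X →ₗ[R] S) : Prop :=
  ∀ θ : X →ₗ[R] X, π ∘ₗ θ = π → Function.Bijective θ

section

variable [IsArtinianRing R]

/-- A finitely generated projective of least length among those with a nonzero map to `S` is right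
minimal: by Fitting's lemma a non-surjective `θ` with `π θ = π` would split off the image of a power
of `θ`, a shorter projective on which `π` is still nonzero. -/
theorem exists_projective_cover (S : Type u) [AddCommGroup S] [Module R S] [IsSimpleModule R S] :
    ∃ (X : FGProj R) (π : X.1 →ₗ[R] S), π ≠ 0 ∧ IsRightMinimal π := by
  classical
  have hex : ∃ (X : FGProj R) (π : X.1 →ₗ[R] S), π ≠ 0 := by
    have := IsSimpleModule.nontrivial R S
    obtain ⟨s, hs⟩ := exists_ne (0 : S)
    refine ⟨⟨FGModuleCat.of R R, inferInstanceAs (Module.Projective R R)⟩,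
      LinearMap.toSpanSingleton R S s, fun h => hs ?_⟩
    have h' : LinearMap.toSpanSingleton R S s = 0 := h
    simpa using LinearMap.congr_fun h' 1
  let s : Set ℕ∞ := {n | ∃ (X : FGProj R) (π : X.1 →ₗ[R] S), π ≠ 0 ∧ Module.length R X.1 = n}
  have hs : s.Nonempty := by
    obtain ⟨X, π, h⟩ := hex
    exact ⟨_, X, π, h, rfl⟩
  obtain ⟨X, π, hπ, hX⟩ := wellFounded_lt.min_mem s hs
  refine ⟨X, π, hπ, fun θ hθ => ?_⟩
  have : IsArtinian R X.1 := isArtinian_of_fg_of_artinian' 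
  have hpow : ∀ n : ℕ, π ∘ₗ (θ ^ n : Module.End R X.1) = π := by
    intro n
    induction n with
    | zero => rfl
    | succ n ih =>
      rw [pow_succ, Module.End.mul_eq_comp, ← LinearMap.comp_assoc, ih, hθ]
  -- Fitting decomposition for a large power. The condition `1 ≤ n` lets one factor `θ` be pulled
  -- out in front, so surjectivity passes from `θ ^ n` to `θ`.
  obtain ⟨n, hn, hn1⟩ := ((LinearMap.eventually_isCompl_ker_pow_range_pow
    (θ : Module.End R X.1)).and (Filter.eventually_ge_atTop 1)).exists
  set φ : Module.End R X.1 := θ ^ n with hφ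
  have htop : LinearMap.range φ = ⊤ := by
    by_contra hne
    have hlt := Submodule.length_lt hne
    have hproj : Module.Projective R (LinearMap.range φ) :=
      projective_of_equiv_prod (Submodule.prodEquivOfIsCompl _ _ hn.symm).symm
    have hmem : Module.length R (LinearMap.range φ) ∈ s := by
      refine ⟨⟨FGModuleCat.of R (LinearMap.range φ), hproj⟩, π ∘ₗ (LinearMap.range φ).subtype,
        fun h => hπ ?_, rfl⟩
      rw [← hpow n]
      ext x
      exact LinearMap.congr_fun h ⟨φ x, x, rfl⟩
    exact WellFounded.not_lt_min wellFounded_lt s hmem (hX ▸ hlt)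
  apply IsNoetherian.bijective_of_surjective_endomorphism
  intro y
  obtain ⟨x, hx⟩ := LinearMap.range_eq_top.1 htop y
  refine ⟨(θ ^ (n - 1) : Module.End R X.1) x, ?_⟩
  rw [← hx, hφ, ← Nat.sub_add_cancel hn1, pow_succ']
  rfl

end

variable {S : Type u} [AddCommGroup S] [Module R S] [IsSimpleModule R S]

/-- A projective cover of `S` is a direct summand of each projective module mapping onto `S`. -/
theorem IsRightMinimal.exists_equiv [IsNoetherianRing R] {X : FGProj R} {π : X.1 →ₗ[R] S}
    (hπ : IsRightMinimal π) (h0 : π ≠ 0) (P : FGProj R) (p : P.1 →ₗ[R] S) (hp : p ≠ 0) :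
    ∃ P' : FGProj R, Nonempty (P.1 ≃ₗ[R] P'.1 × X.1) := by
  -- The maps `π` and `p` are lifted through each other. The composite `g h` preserves `π`, so
  -- minimality makes it bijective and `g` surjective; `g` splits because `X` is projective.
  obtain ⟨g, hg⟩ := Module.projective_lifting_property π p (LinearMap.surjective_of_ne_zero h0)
  obtain ⟨h, hh⟩ := Module.projective_lifting_property p π (LinearMap.surjective_of_ne_zero hp)
  have hb : Function.Bijective (g ∘ₗ h) := hπ _ (by rw [← LinearMap.comp_assoc, hg, hh])
  have hex : IsShortExact (LinearMap.ker g).subtype g :=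
    ⟨Subtype.val_injective, g.exact_subtype_ker_map, fun x => by
      obtain ⟨y, hy⟩ := hb.2 x
      exact ⟨h y, hy⟩⟩
  obtain ⟨e⟩ := hex.exists_equiv
  exact ⟨⟨FGModuleCat.of R (LinearMap.ker g), projective_of_equiv_prod e⟩, ⟨e⟩⟩

/-- A projective cover of `S` has no nonzero map to a simple module which is not isomorphic to
`S`. -/
theorem IsRightMinimal.eq_zero {X : FGProj R} {π : X.1 →ₗ[R] S}
    (hπ : IsRightMinimal π) (h0 : π ≠ 0) {S' : Type u} [AddCommGroup S'] [Module R S']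
    [IsSimpleModule R S'] (hS : ¬ Nonempty (S ≃ₗ[R] S')) (f : X.1 →ₗ[R] S') : f = 0 := by
  by_contra hf
  have hsurj := LinearMap.surjective_of_ne_zero h0
  -- If `f` killed `ker π`, then both maps would have the same kernel, a maximal submodule, and `S`
  -- would be isomorphic to `S'`. As `S'` is simple, `f` maps `ker π` onto it.
  have hker : (LinearMap.ker π).map f = ⊤ := by
    refine (eq_bot_or_eq_top ((LinearMap.ker π).map f)).resolve_left fun hbot => hS ?_
    have hle : LinearMap.ker π ≤ LinearMap.ker f := fun x hx => by
      have : f x ∈ (LinearMap.ker π).map f := ⟨x, hx, rfl⟩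
      rwa [hbot] at this
    have hle' : LinearMap.ker f ≤ LinearMap.ker π := by
      have hco : IsCoatom (LinearMap.ker π) := by
        rw [← isSimpleModule_iff_isCoatom]
        exact IsSimpleModule.congr (π.quotKerEquivOfSurjective hsurj)
      rcases hco.le_iff.1 hle with h | h
      · exact absurd (LinearMap.ker_eq_top.1 h) hf
      · exact h.le
    exact ⟨(π.quotKerEquivOfSurjective hsurj).symm.trans
      ((Submodule.quotEquivOfEq _ _ (le_antisymm hle hle')).trans
        (f.quotKerEquivOfSurjective (LinearMap.surjective_of_ne_zero hf)))⟩
  have hsurj' : Function.Surjective (π.prod f) := by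
    rintro ⟨s, s'⟩
    obtain ⟨x, rfl⟩ := hsurj s
    have : s' - f x ∈ (LinearMap.ker π).map f := hker ▸ Submodule.mem_top
    obtain ⟨y, hy, hy'⟩ := this
    refine ⟨x + y, ?_⟩
    have hy0 : π y = 0 := hy
    simp [hy', hy0]
  -- The lift `θ` satisfies both `π θ = π` and `f θ = 0`. Minimality makes it surjective, which
  -- forces `f = 0`.
  obtain ⟨θ, hθ⟩ := Module.projective_lifting_property (π.prod f) (π.prod 0) hsurj'
  have h1 : π ∘ₗ θ = π := LinearMap.ext fun x => congrArg Prod.fst (LinearMap.congr_fun hθ x)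
  have h2 : f ∘ₗ θ = 0 := LinearMap.ext fun x => congrArg Prod.snd (LinearMap.congr_fun hθ x)
  apply hf
  ext x
  obtain ⟨y, rfl⟩ := (hπ θ h1).2 x
  exact LinearMap.congr_fun h2 y

end ProjectiveCover

/-! ### Projective modules are determined by their maps to simple modules -/

section Multiplicities

variable {F : Type u} [Field F] {D : Type u} [Ring D] [Algebra F D]

/-- The vector space underlying a module over an algebra. -/
@[reducible] def moduleOverField (B : Type u) [Ring B] [Algebra F B] (M : FGModuleCat.{u} B) :
    Module F M :=
  ModuleCat.moduleOfAlgebraModule M.obj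

attribute [local instance] moduleOverField

theorem isScalarTower_overField (B : Type u) [Ring B] [Algebra F B] (M : FGModuleCat.{u} B) :
    IsScalarTower F B M :=
  ModuleCat.isScalarTower_of_algebra_moduleCat M.obj

attribute [local instance] isScalarTower_overField

theorem finrank_hom_congr {P Q : Type u} [AddCommGroup P] [Module D P] [AddCommGroup Q]
    [Module D Q] (e : P ≃ₗ[D] Q) (M : FGModuleCat.{u} D) :
    Module.finrank F (P →ₗ[D] M) = Module.finrank F (Q →ₗ[D] M) :=
  LinearEquiv.finrank_eq (LinearEquiv.congrLeft M F e)

variable [Module.Finite F D]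

theorem finrank_hom_prod (P Q : FGModuleCat.{u} D) (M : FGModuleCat.{u} D) :
    Module.finrank F (P × Q →ₗ[D] M) =
      Module.finrank F (P →ₗ[D] M) + Module.finrank F (Q →ₗ[D] M) := by
  have := hom_finite (F := F) P M
  have := hom_finite (F := F) Q M
  rw [← LinearEquiv.finrank_eq (LinearMap.coprodEquiv (R := D) (M := P) (M₂ := Q) (M₃ := M) F),
    Module.finrank_prod]

variable (F) in
/-- A projective module is determined by the dimensions of its spaces of maps to simple modules. -/
theorem nonempty_equiv_of_finrank_hom (P Q : FGProj D)
    (h : ∀ S : FGModuleCat.{u} D, IsSimpleModule D S →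
      Module.finrank F (P.1 →ₗ[D] S) = Module.finrank F (Q.1 →ₗ[D] S)) :
    Nonempty (P.1 ≃ₗ[D] Q.1) := by
  have hart : IsArtinianRing D := IsArtinianRing.of_finite F D
  -- Induction on a bound for the length of `P`: a projective cover of a common simple quotient is
  -- split off from both modules, and the complements again have equal Hom dimensions.
  have main : ∀ (n : ℕ) (P Q : FGProj D), Module.length D P.1 ≤ n →
      (∀ S : FGModuleCat.{u} D, IsSimpleModule D S →
        Module.finrank F (P.1 →ₗ[D] S) = Module.finrank F (Q.1 →ₗ[D] S)) →
      Nonempty (P.1 ≃ₗ[D] Q.1) := by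
    intro n
    induction n with
    | zero =>
      intro P Q hP h
      have hP0 : Subsingleton P.1 := by
        rw [← Module.length_eq_zero_iff (R := D)]
        exact le_antisymm (by simpa using hP) bot_le
      have hQ0 : Subsingleton Q.1 := by
        by_contra hQ
        rw [not_subsingleton_iff_nontrivial] at hQ
        obtain ⟨S, q, hS, hq⟩ := exists_simple_quotient (R := D) Q.1
        have h1 := h S hS
        have h2 := hom_finite (F := F) Q.1 S
        rw [Module.finrank_zero_of_subsingleton] at h1
        have := Module.finrank_zero_iff.1 h1.symm
        exact hq (Subsingleton.elim _ _)
      exact ⟨{ (0 : P.1 →ₗ[D] Q.1) with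
        invFun := 0
        left_inv := fun x => Subsingleton.elim _ _
        right_inv := fun x => Subsingleton.elim _ _ }⟩
    | succ n ih =>
      intro P Q hP h
      by_cases hP0 : Subsingleton P.1
      · refine ih P Q ?_ h
        rw [(Module.length_eq_zero_iff (R := D)).2 hP0]
        exact bot_le
      · rw [not_subsingleton_iff_nontrivial] at hP0
        obtain ⟨S, p, hS, hp⟩ := exists_simple_quotient (R := D) P.1
        have hPf := hom_finite (F := F) P.1 S
        have hQf := hom_finite (F := F) Q.1 S
        -- Equality of dimensions carries the simple quotient of `P` over to `Q`.
        have hq : ∃ q : Q.1 →ₗ[D] S, q ≠ 0 := by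
          have : Nontrivial (P.1 →ₗ[D] S) := ⟨p, 0, hp⟩
          have h1 := Module.finrank_pos (R := F) (M := P.1 →ₗ[D] S)
          rw [h S hS] at h1
          have := Module.finrank_pos_iff.1 h1
          exact exists_ne 0
        obtain ⟨q, hq⟩ := hq
        obtain ⟨X, π, hπ, hmin⟩ := exists_projective_cover (R := D) S
        obtain ⟨P', ⟨e⟩⟩ := hmin.exists_equiv hπ P p hp
        obtain ⟨Q', ⟨e'⟩⟩ := hmin.exists_equiv hπ Q q hq
        have hX : Nontrivial X.1 := by
          by_contra hX
          rw [not_nontrivial_iff_subsingleton] at hX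
          exact hπ (LinearMap.ext fun x => by rw [Subsingleton.elim x 0, map_zero, map_zero])
        obtain ⟨e''⟩ := ih P' Q' (by
          have h1 : Module.length D P'.1 + Module.length D X.1 ≤ (n : ℕ∞) + 1 := by
            rw [← Module.length_prod, ← e.length_eq]
            exact_mod_cast hP
          have h2 : 1 ≤ Module.length D X.1 := Order.one_le_iff_pos.2 Module.length_pos
          have h3 : Module.length D P'.1 + 1 ≤ (n : ℕ∞) + 1 :=
            le_trans (add_le_add le_rfl h2) h1
          exact (ENat.add_le_add_iff_right (by simp)).1 h3) (fun T hT => by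
          have h1 := h T hT
          rw [finrank_hom_congr e, finrank_hom_congr e', finrank_hom_prod, finrank_hom_prod] at h1
          omega)
        exact ⟨e.trans ((e''.prodCongr (LinearEquiv.refl D X.1)).trans e'.symm)⟩
  have hPl : IsArtinian D P.1 := isArtinian_of_fg_of_artinian'
  obtain ⟨n, hn⟩ := ENat.ne_top_iff_exists.1 (Module.length_ne_top (R := D) (M := P.1))
  exact main n P Q hn.symm.le h

end Multiplicities

attribute [local instance] moduleOverField isScalarTower_overField

/-! ### The groups `G0` and `K0`, their bases, and perfectness of the pairing -/

section GrothendieckGroups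

section

variable {R : Type u} [Ring R]

theorem G0.cls_congr {M N : FGModuleCat.{u} R} (e : M ≃ₗ[R] N) : G0.cls M = G0.cls N := by
  let Z : FGModuleCat.{u} R := FGModuleCat.of R PUnit
  have key : ∀ {A B : FGModuleCat.{u} R} (f : A ≃ₗ[R] B), G0.cls A = G0.cls B + G0.cls Z := by
    intro A B f
    refine G0.cls_eq (i := f.symm.toLinearMap) (p := (0 : A →ₗ[R] Z)) ⟨f.symm.injective, ?_, ?_⟩
    · intro x
      exact ⟨fun _ => ⟨f x, f.symm_apply_apply x⟩, fun _ => rfl⟩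
    · intro x
      exact ⟨0, Subsingleton.elim (α := PUnit) _ _⟩
  have h0 : G0.cls Z = 0 := by
    have := key (LinearEquiv.refl R Z)
    rwa [left_eq_add] at this
  rw [key e, h0, add_zero]

theorem G0.cls_of_subsingleton (M : FGModuleCat.{u} R) [Subsingleton M] : G0.cls M = 0 := by
  have h : G0.cls M = G0.cls M + G0.cls M :=
    G0.cls_eq (i := (LinearMap.id : M →ₗ[R] M)) (p := (0 : M →ₗ[R] M))
      ⟨fun _ _ h => h, fun x => ⟨fun _ => ⟨x, rfl⟩, fun _ => rfl⟩,
        fun x => ⟨0, Subsingleton.elim _ _⟩⟩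
  rwa [left_eq_add] at h

theorem K0.cls_congr {P Q : FGProj R} (e : P.1 ≃ₗ[R] Q.1) : K0.cls P = K0.cls Q := by
  let Z : FGProj R := ⟨FGModuleCat.of R PUnit.{u + 1},
    inferInstanceAs (Module.Projective R PUnit.{u + 1})⟩
  have key : ∀ {A B : FGProj R} (f : A.1 ≃ₗ[R] B.1), K0.cls A = K0.cls B + K0.cls Z := by
    intro A B f
    exact K0.cls_eq (f.trans (LinearEquiv.prodUnique (R := R) (M := B.1) (M₂ := PUnit.{u + 1})).symm)
  have h0 : K0.cls Z = 0 := by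
    have := key (LinearEquiv.refl R Z.1)
    rwa [left_eq_add] at this
  rw [key e, h0, add_zero]

theorem K0.cls_of_subsingleton (P : FGProj R) [Subsingleton P.1] : K0.cls P = 0 := by
  let _ : Unique P.1 := ⟨⟨0⟩, fun _ => Subsingleton.elim _ _⟩
  have e : P.1 ≃ₗ[R] P.1 × P.1 :=
    (LinearEquiv.prodUnique (R := R) (M := P.1) (M₂ := P.1)).symm
  have h := K0.cls_eq e
  rwa [left_eq_add] at h

@[elab_as_elim]
theorem G0.induction_on {p : G0 R → Prop} (x : G0 R) (cls : ∀ M, p (G0.cls M))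
    (add : ∀ x y, p x → p y → p (x + y)) (neg : ∀ x, p x → p (-x)) : p x := by
  obtain ⟨y, rfl⟩ := QuotientAddGroup.mk'_surjective (G0Rel R) x
  induction y using FreeAbelianGroup.induction_on with
  | zero =>
    have h := cls (FGModuleCat.of R PUnit)
    rwa [G0.cls_of_subsingleton] at h
  | of M => exact cls M
  | neg M h => rw [map_neg]; exact neg _ h
  | add a b ha hb => rw [map_add]; exact add _ _ ha hb

/-- Each element of `K0` is a difference of two classes. -/
theorem K0.exists_sub (x : K0 R) : ∃ P Q : FGProj R, x = K0.cls P - K0.cls Q := by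
  let Z : FGProj R := ⟨FGModuleCat.of R PUnit.{u + 1},
    inferInstanceAs (Module.Projective R PUnit.{u + 1})⟩
  have h0 : K0.cls Z = 0 := by
    have : Subsingleton Z.1 := inferInstanceAs (Subsingleton PUnit)
    exact K0.cls_of_subsingleton Z
  obtain ⟨y, rfl⟩ := QuotientAddGroup.mk'_surjective (K0Rel R) x
  induction y using FreeAbelianGroup.induction_on with
  | zero => exact ⟨Z, Z, (sub_self _).symm⟩
  | of P => exact ⟨P, Z, (by rw [h0, sub_zero] : K0.cls P - K0.cls Z = K0.cls P).symm⟩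
  | neg P _ => exact ⟨Z, P, (by rw [h0, zero_sub] : K0.cls Z - K0.cls P = -K0.cls P).symm⟩
  | add a b ha hb =>
    obtain ⟨P, Q, h⟩ := ha
    obtain ⟨P', Q', h'⟩ := hb
    have key : ∀ A B : FGProj R, ∃ C : FGProj R, K0.cls C = K0.cls A + K0.cls B := fun A B =>
      ⟨⟨FGModuleCat.of R (A.1 × B.1), inferInstanceAs (Module.Projective R (A.1 × B.1))⟩,
        K0.cls_eq (LinearEquiv.refl R (A.1 × B.1))⟩
    obtain ⟨C, hC⟩ := key P P'
    obtain ⟨C', hC'⟩ := key Q Q'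
    exact ⟨C, C', by rw [map_add, h, h', hC, hC']; abel⟩

@[elab_as_elim]
theorem K0.induction_on {p : K0 R → Prop} (x : K0 R) (cls : ∀ P, p (K0.cls P))
    (add : ∀ x y, p x → p y → p (x + y)) (neg : ∀ x, p x → p (-x)) : p x := by
  obtain ⟨P, Q, rfl⟩ := K0.exists_sub x
  rw [sub_eq_add_neg]
  exact add _ _ (cls P) (neg _ (cls Q))

/-- Induction on the length of finitely generated modules over an artinian ring. -/
theorem fg_induction [IsArtinianRing R] {p : FGModuleCat.{u} R → Prop}
    (zero : ∀ M : FGModuleCat.{u} R, Subsingleton M → p M)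
    (ext : ∀ (K M S : FGModuleCat.{u} R) (i : K →ₗ[R] M) (q : M →ₗ[R] S), IsShortExact i q →
      IsSimpleModule R S → p K → p M) (M : FGModuleCat.{u} R) : p M := by
  have main : ∀ (n : ℕ) (M : FGModuleCat.{u} R), Module.length R M ≤ n → p M := by
    intro n
    induction n with
    | zero =>
      intro M hM
      refine zero M ?_
      rw [← Module.length_eq_zero_iff (R := R)]
      exact le_antisymm (by simpa using hM) bot_le
    | succ n ih =>
      intro M hM
      by_cases hM0 : Subsingleton M
      · exact zero M hM0
      rw [not_subsingleton_iff_nontrivial] at hM0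
      obtain ⟨S, q, hS, hq⟩ := exists_simple_quotient (R := R) M
      have hex : IsShortExact (LinearMap.ker q).subtype q :=
        ⟨Subtype.val_injective, q.exact_subtype_ker_map, LinearMap.surjective_of_ne_zero hq⟩
      refine ext (FGModuleCat.of R (LinearMap.ker q)) M S _ q hex hS (ih _ ?_)
      have h1 := Module.length_eq_add_of_exact _ _ hex.injective hex.surjective hex.exact
      rw [Module.length_eq_one R S] at h1
      rw [h1] at hM
      exact (ENat.add_le_add_iff_right (k := 1) (by simp)).1 (by exact_mod_cast hM)
  have : IsArtinian R M := isArtinian_of_fg_of_artinian'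
  obtain ⟨n, hn⟩ := ENat.ne_top_iff_exists.1 (Module.length_ne_top (R := R) (M := M))
  exact main n M hn.symm.le

/-- Representatives of the isomorphism classes of simple modules. -/
structure IsSimpleSystem {n : ℕ} (S : Fin n → FGModuleCat.{u} R) : Prop where
  simple : ∀ i, IsSimpleModule R (S i)
  eq_of_equiv : ∀ i j, Nonempty (S i ≃ₗ[R] S j) → i = j
  exists_equiv : ∀ T : FGModuleCat.{u} R, IsSimpleModule R T → ∃ i, Nonempty (T ≃ₗ[R] S i)

variable (R) in
-- Every simple module is a quotient of the regular module, which has finite length. Along a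
-- composition series, a nonzero map to a simple module either stays nonzero on the submodule or
-- factors through the simple quotient, so only finitely many isomorphism types occur.
theorem exists_isSimpleSystem [IsArtinianRing R] :
    ∃ (n : ℕ) (S : Fin n → FGModuleCat.{u} R), IsSimpleSystem S := by
  have key : ∀ M : FGModuleCat.{u} R, ∃ t : Set (FGModuleCat.{u} R), t.Finite ∧
      ∀ T : FGModuleCat.{u} R, IsSimpleModule R T → ∀ f : M →ₗ[R] T, f ≠ 0 →
        ∃ S ∈ t, Nonempty (T ≃ₗ[R] S) := by
    intro M
    induction M using fg_induction with
    | zero M hM =>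
      exact ⟨∅, Set.finite_empty, fun T _ f hf => absurd (LinearMap.ext fun x => by
        rw [Subsingleton.elim x 0, map_zero, map_zero]) hf⟩
    | ext K M S i q hex hS ih =>
      obtain ⟨t, ht, h⟩ := ih
      refine ⟨insert S t, ht.insert S, fun T hT f hf => ?_⟩
      by_cases hfi : f ∘ₗ i = 0
      · refine ⟨S, Set.mem_insert _ _, ?_⟩
        have hle : LinearMap.ker q ≤ LinearMap.ker f := fun x hx => by
          obtain ⟨y, rfl⟩ := (hex.exact x).1 hx
          exact LinearMap.congr_fun hfi y
        let g : (M ⧸ LinearMap.ker q) →ₗ[R] T := (LinearMap.ker q).liftQ f hle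
        let g' : S →ₗ[R] T := g ∘ₗ (q.quotKerEquivOfSurjective hex.surjective).symm.toLinearMap
        have hg' : g' ≠ 0 := fun h0 => hf (by
          ext x
          have := LinearMap.congr_fun h0 (q x)
          have h2 : (q.quotKerEquivOfSurjective hex.surjective).symm (q x) =
              (LinearMap.ker q).mkQ x :=
            (LinearEquiv.symm_apply_eq _).2 (by simp)
          simpa [g', g, h2] using this)
        exact ⟨(LinearEquiv.ofBijective g' (LinearMap.bijective_of_ne_zero hg')).symm⟩
      · obtain ⟨S', hS', e⟩ := h T hT _ hfi
        exact ⟨S', Set.mem_insert_of_mem _ hS', e⟩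
  obtain ⟨t, ht, h⟩ := key (FGModuleCat.of R R)
  have hall : ∀ T : FGModuleCat.{u} R, IsSimpleModule R T → ∃ S ∈ t, Nonempty (T ≃ₗ[R] S) := by
    intro T hT
    have := IsSimpleModule.nontrivial R T
    obtain ⟨x, hx⟩ := exists_ne (0 : T)
    refine h T hT (LinearMap.toSpanSingleton R T x) fun h0 => hx ?_
    have h' : LinearMap.toSpanSingleton R T x = 0 := h0
    simpa using LinearMap.congr_fun h' 1
  -- The finite set `t` may contain non-simple modules and repetitions. Passing to isomorphism
  -- classes of simple modules, which inject into `t`, gives exact representatives.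
  let st : Setoid {T : FGModuleCat.{u} R // IsSimpleModule R T} :=
    { r := fun A B => Nonempty (A.1 ≃ₗ[R] B.1)
      iseqv := ⟨fun A => ⟨LinearEquiv.refl R A.1⟩, fun ⟨e⟩ => ⟨e.symm⟩,
        fun ⟨e⟩ ⟨e'⟩ => ⟨e.trans e'⟩⟩ }
  have hout : ∀ A : {T : FGModuleCat.{u} R // IsSimpleModule R T},
      Nonempty (A.1 ≃ₗ[R] (Quotient.out (Quotient.mk st A)).1) := fun A =>
    Quotient.exact (Quotient.out_eq (Quotient.mk st A)).symm
  choose c hc hc' using fun q : Quotient st => hall q.out.1 q.out.2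
  have hfin : Finite (Quotient st) := by
    have := ht.to_subtype
    refine Finite.of_injective (fun q => (⟨c q, hc q⟩ : t)) fun q q' hq => ?_
    rw [← Quotient.out_eq q, ← Quotient.out_eq q']
    apply Quotient.sound
    obtain ⟨e⟩ := hc' q
    obtain ⟨e'⟩ := hc' q'
    have hcc : c q = c q' := congrArg Subtype.val hq
    rw [hcc] at e
    exact ⟨e.trans e'.symm⟩
  obtain ⟨n, ⟨e⟩⟩ := Finite.exists_equiv_fin (Quotient st)
  refine ⟨n, fun i => (e.symm i).out.1, fun i => (e.symm i).out.2, ?_, ?_⟩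
  · intro i j hij
    apply e.symm.injective
    rw [← Quotient.out_eq (e.symm i), ← Quotient.out_eq (e.symm j)]
    exact Quotient.sound hij
  · intro T hT
    refine ⟨e (Quotient.mk st ⟨T, hT⟩), ?_⟩
    rw [e.symm_apply_apply]
    exact hout ⟨T, hT⟩

theorem IsSimpleSystem.span_cls [IsArtinianRing R] {n : ℕ} {S : Fin n → FGModuleCat.{u} R}
    (hS : IsSimpleSystem S) : Submodule.span ℤ (Set.range fun i => G0.cls (S i)) = ⊤ := by
  have key : ∀ M : FGModuleCat.{u} R,
      G0.cls M ∈ Submodule.span ℤ (Set.range fun i => G0.cls (S i)) := by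
    intro M
    induction M using fg_induction with
    | zero M hM => rw [G0.cls_of_subsingleton]; exact zero_mem _
    | ext K M T i q hex hT ih =>
      rw [G0.cls_eq hex]
      obtain ⟨j, ⟨e⟩⟩ := hS.exists_equiv T hT
      refine add_mem ih ?_
      rw [G0.cls_congr e]
      exact Submodule.subset_span ⟨j, rfl⟩
  rw [eq_top_iff]
  rintro x -
  induction x using G0.induction_on with
  | cls M => exact key M
  | add x y hx hy => exact add_mem hx hy
  | neg x hx => exact neg_mem hx

end

variable {F : Type u} [Field F] {D : Type u} [Ring D] [Algebra F D] [Module.Finite F D]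

variable (F) in
-- This part of perfectness holds for every finite dimensional algebra. It is therefore available
-- for `A_m ⊗ A_n` too, where perfectness is not assumed.
theorem pairing_injective : Function.Injective (pairing F D) := by
  rw [injective_iff_map_eq_zero]
  intro x hx
  obtain ⟨P, Q, rfl⟩ := K0.exists_sub x
  obtain ⟨e⟩ := nonempty_equiv_of_finrank_hom F P Q fun S _ => by
    have h := DFunLike.congr_fun hx (G0.cls S)
    rw [map_sub, AddMonoidHom.sub_apply, pairing_cls, pairing_cls, AddMonoidHom.zero_apply,
      sub_eq_zero] at h
    exact_mod_cast h
  rw [K0.cls_congr e, sub_self]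

/-- Projective modules with the same class are isomorphic. -/
theorem K0.nonempty_equiv (F : Type u) [Field F] {D : Type u} [Ring D] [Algebra F D]
    [Module.Finite F D] {P Q : FGProj D} (h : K0.cls P = K0.cls Q) :
    Nonempty (P.1 ≃ₗ[D] Q.1) :=
  nonempty_equiv_of_finrank_hom F P Q fun S _ => by
    have h' := pairing_cls (F := F) P S
    rw [h, pairing_cls] at h'
    exact_mod_cast h'.symm

/-- The classes of the simple modules form a basis of `G0`. -/
theorem IsSimpleSystem.exists_basis (F : Type u) [Field F] {D : Type u} [Ring D] [Algebra F D]
    [Module.Finite F D] {n : ℕ} {S : Fin n → FGModuleCat.{u} D}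
    (hS : IsSimpleSystem S) : ∃ b : Module.Basis (Fin n) ℤ (G0 D), ∀ i, b i = G0.cls (S i) := by
  have hart : IsArtinianRing D := IsArtinianRing.of_finite F D
  have hli : LinearIndependent ℤ fun i => G0.cls (S i) := by
    rw [Fintype.linearIndependent_iff]
    intro g hg j
    have := hS.simple j
    -- Pairing a linear relation with the projective cover of `S j` isolates the coefficient of `S
    -- j`, multiplied by a positive dimension.
    obtain ⟨X, π, hπ, hmin⟩ := exists_projective_cover (R := D) (S j)
    have h1 := congrArg (pairing F D (K0.cls X)) hg
    rw [map_sum, map_zero, Finset.sum_eq_single j] at h1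
    · rw [map_zsmul, pairing_cls, smul_eq_mul] at h1
      refine (mul_eq_zero.1 h1).resolve_right ?_
      have := hom_finite (F := F) X.1 (S j)
      have : Nontrivial (X.1 →ₗ[D] S j) := ⟨π, 0, hπ⟩
      exact_mod_cast (Module.finrank_pos (R := F) (M := X.1 →ₗ[D] S j)).ne'
    · intro i _ hij
      have := hS.simple i
      have h0 : Subsingleton (X.1 →ₗ[D] S i) := ⟨fun f f' => by
        have hn : ¬ Nonempty (S j ≃ₗ[D] S i) := fun h => hij (hS.eq_of_equiv j i h).symm
        rw [hmin.eq_zero hπ hn f, hmin.eq_zero hπ hn f']⟩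
      rw [map_zsmul, pairing_cls, Module.finrank_zero_of_subsingleton]
      simp
    · intro h; exact absurd (Finset.mem_univ j) h
  exact ⟨Module.Basis.mk hli hS.span_cls.ge, fun i => by simp⟩

theorem G0.free_finite (F : Type u) [Field F] (D : Type u) [Ring D] [Algebra F D]
    [Module.Finite F D] : Module.Free ℤ (G0 D) ∧ Module.Finite ℤ (G0 D) := by
  have hart : IsArtinianRing D := IsArtinianRing.of_finite F D
  obtain ⟨n, S, hS⟩ := exists_isSimpleSystem D
  obtain ⟨b, -⟩ := hS.exists_basis F
  exact ⟨Module.Free.of_basis b, Module.Finite.of_basis b⟩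

section Perfect


/-- The linear equivalence of `K0` with the dual of `G0`. -/
def pairingEquiv (hD : Function.Bijective (pairing F D)) : K0 D ≃ₗ[ℤ] Module.Dual ℤ (G0 D) :=
  LinearEquiv.ofBijective (intBilin (pairing F D)) (by
    constructor
    · intro x y hxy
      refine hD.1 (AddMonoidHom.ext fun z => LinearMap.congr_fun hxy z)
    · intro f
      obtain ⟨x, hx⟩ := hD.2 f.toAddMonoidHom
      exact ⟨x, LinearMap.ext fun z => DFunLike.congr_fun hx z⟩)

theorem pairing_hasDualBases (hD : Function.Bijective (pairing F D)) :
    HasDualBases (intBilin (pairing F D)) := by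
  have hart : IsArtinianRing D := IsArtinianRing.of_finite F D
  obtain ⟨n, S, hS⟩ := exists_isSimpleSystem D
  obtain ⟨b, -⟩ := hS.exists_basis F
  refine ⟨Fin n, inferInstance, b.dualBasis.map (pairingEquiv hD).symm, b, fun i j => ?_⟩
  have h : pairingEquiv hD (b.dualBasis.map (pairingEquiv hD).symm i) = b.dualBasis i := by simp
  have h' : intBilin (pairing F D) (b.dualBasis.map (pairingEquiv hD).symm i) = b.dualBasis i := h
  rw [h', Module.Basis.dualBasis_apply_self]
  simp only [eq_comm]

theorem pairing_isPerfPair (hD : Function.Bijective (pairing F D)) :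
    (intBilin (pairing F D)).IsPerfPair := by
  obtain ⟨_, _⟩ := G0.free_finite F D
  exact LinearMap.IsPerfPair.of_bijective _ (pairingEquiv hD).bijective

theorem K0.free_finite (hD : Function.Bijective (pairing F D)) :
    Module.Free ℤ (K0 D) ∧ Module.Finite ℤ (K0 D) := by
  obtain ⟨_, _⟩ := G0.free_finite F D
  exact ⟨Module.Free.of_equiv (pairingEquiv hD).symm, Module.Finite.equiv (pairingEquiv hD).symm⟩

/-- If the pairing is perfect then the simple modules are absolutely simple. -/
theorem finrank_end_eq_one (hD : Function.Bijective (pairing F D)) (S : FGModuleCat.{u} D)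
    [IsSimpleModule D S] : Module.finrank F (S →ₗ[D] S) = 1 := by
  classical
  have hart : IsArtinianRing D := IsArtinianRing.of_finite F D
  obtain ⟨n, T, hT⟩ := exists_isSimpleSystem D
  obtain ⟨b, hb⟩ := hT.exists_basis F
  obtain ⟨i, ⟨e⟩⟩ := hT.exists_equiv S inferInstance
  -- Perfectness provides a class whose pairing with `[S]` is `1`.
  obtain ⟨x, hx⟩ := hD.2 (b.coord i).toAddMonoidHom
  have h1 : pairing F D x (G0.cls S) = 1 := by
    rw [G0.cls_congr e, ← hb, hx]
    simp
  let _ : DivisionRing (Module.End D S) := Module.End.instDivisionRing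
  -- Each `Hom(P, S)` is a vector space over the division algebra `End S`, so every pairing with
  -- `[S]` is divisible by `dim End S`, which therefore divides `1`.
  have hdvd : ∀ P : FGProj D, (Module.finrank F (Module.End D S) : ℤ) ∣
      pairing F D (K0.cls P) (G0.cls S) := by
    intro P
    rw [pairing_cls]
    have : IsScalarTower F (Module.End D S) (P.1 →ₗ[D] S) := ⟨fun c f g => rfl⟩
    have := Module.finrank_mul_finrank F (Module.End D S) (P.1 →ₗ[D] S)
    exact_mod_cast Dvd.intro _ this
  have hdvd' : (Module.finrank F (Module.End D S) : ℤ) ∣ 1 := by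
    rw [← h1]
    obtain ⟨P, Q, rfl⟩ := K0.exists_sub x
    rw [map_sub, AddMonoidHom.sub_apply]
    exact dvd_sub (hdvd P) (hdvd Q)
  have := Int.eq_one_of_dvd_one (by positivity) hdvd'
  exact_mod_cast this

end Perfect

end GrothendieckGroups

/-! ### Simple modules over `B ⊗ C` and surjectivity of the Künneth map -/

section Kunneth

attribute [local instance] outerModule

variable {F : Type u} [Field F]

/-- Maps from an absolutely simple module which are linearly independent over the field have
independent values. -/
theorem eq_zero_of_sum_apply_eq_zero {B : Type u} [Ring B] [Algebra F B] {S X : Type u}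
    [AddCommGroup S] [Module F S] [Module B S] [IsScalarTower F B S] [IsSimpleModule B S]
    [AddCommGroup X] [Module F X] [Module B X] [IsScalarTower F B X]
    (hEnd : ∀ g : S →ₗ[B] S, ∃ c : F, ∀ s, g s = c • s)
    {ι : Type*} [Fintype ι] (f : ι → S →ₗ[B] X)
    (hf : ∀ c : ι → F, (∀ s, ∑ i, c i • f i s = 0) → c = 0)
    (s : ι → S) (hs : ∑ i, f i (s i) = 0) : s = 0 := by
  by_contra hne
  let φ : (ι → S) →ₗ[B] X := ∑ i, f i ∘ₗ LinearMap.proj i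
  have hφ : ∀ t, φ t = ∑ i, f i (t i) := fun t => by simp [φ]
  -- A nonzero kernel in `S ^ ι` contains a simple submodule `K`. Some coordinate identifies `K`
  -- with `S`, and by Schur the other coordinates become scalars, so that `K` is a relation with
  -- coefficients in `F` among the `f i`.
  obtain h | ⟨K, hK, hle⟩ := eq_bot_or_exists_atom_le (LinearMap.ker φ)
  · apply hne
    have : s ∈ LinearMap.ker φ := (hφ s).trans hs
    rwa [h] at this
  · have hsimple : IsSimpleModule B K := isSimpleModule_iff_isAtom.2 hK
    have hex : ∃ i, LinearMap.proj i ∘ₗ K.subtype ≠ 0 := by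
      by_contra hall
      push Not at hall
      apply hK.1
      rw [eq_bot_iff]
      intro t ht
      refine (Submodule.mem_bot B).2 (funext fun i => ?_)
      exact LinearMap.congr_fun (hall i) ⟨t, ht⟩
    obtain ⟨i, hi⟩ := hex
    let e := LinearEquiv.ofBijective _ (LinearMap.bijective_of_ne_zero hi)
    choose c hc using fun j => hEnd (LinearMap.proj j ∘ₗ K.subtype ∘ₗ e.symm.toLinearMap)
    have hc0 : c = 0 := hf c fun t => by
      have h1 : φ (e.symm t : ι → S) = 0 := hle (e.symm t).2
      rw [hφ] at h1
      rw [← h1]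
      refine Finset.sum_congr rfl fun j _ => ?_
      rw [← LinearMap.map_smul_of_tower, ← hc j t]
      rfl
    have := IsSimpleModule.nontrivial B S
    obtain ⟨t, ht⟩ := exists_ne (0 : S)
    apply ht
    -- The coordinate `i` used for the identification has scalar `1`, which contradicts the
    -- vanishing of all `c j`.
    have h2 := hc i t
    rw [hc0, Pi.zero_apply, zero_smul] at h2
    rw [← h2]
    exact (e.apply_symm_apply t).symm

variable {B C : Type u} [Ring B] [Algebra F B] [Module.Finite F B] [Ring C] [Algebra F C]

/-- The identity of `M`, with values in the restriction of `M` along `φ`. -/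
def toRes (φ : C →ₐ[F] B) (M : FGModuleCat.{u} B) : M ≃+ (Res φ).obj M := AddEquiv.refl M

theorem smul_toRes (φ : C →ₐ[F] B) (M : FGModuleCat.{u} B) (c : C) (x : M) :
    c • toRes φ M x = toRes φ M (φ c • x) := rfl

theorem field_smul_toRes (φ : C →ₐ[F] B) (M : FGModuleCat.{u} B) (r : F) (x : M) :
    r • toRes φ M x = toRes φ M (r • x) := by
  rw [← algebraMap_smul C, smul_toRes, AlgHom.commutes, algebraMap_smul]

variable [Module.Finite F C]

/-- The identity of `M ⊗ N`, with values in the outer tensor product. -/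
def toOuter (M : FGModuleCat.{u} B) (N : FGModuleCat.{u} C) : M ⊗[F] N ≃+ outer (F := F) M N :=
  AddEquiv.refl (M ⊗[F] N)

theorem smul_toOuter_tmul (M : FGModuleCat.{u} B) (N : FGModuleCat.{u} C) (b : B) (c : C) (m : M)
    (n : N) : (b ⊗ₜ[F] c : B ⊗[F] C) • toOuter M N (m ⊗ₜ[F] n) =
      toOuter M N ((b • m) ⊗ₜ[F] (c • n)) := rfl

theorem field_smul_toOuter (M : FGModuleCat.{u} B) (N : FGModuleCat.{u} C) (r : F)
    (x : M ⊗[F] N) : r • toOuter M N x = toOuter M N (r • x) := by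
  have := outer_isScalarTower (F := F) (B := B) (C := C) (M := M) (N := N)
  rw [← algebraMap_smul (B ⊗[F] C)]
  exact algebraMap_smul (M := M ⊗[F] N) (B ⊗[F] C) r x

/-- A map out of an outer tensor product is linear if it is so on pure tensors. -/
def outerLift {M : FGModuleCat.{u} B} {N : FGModuleCat.{u} C} {X : Type u} [AddCommGroup X]
    [Module (B ⊗[F] C) X] (f : M ⊗[F] N →+ X)
    (hf : ∀ (b : B) (c : C) (m : M) (n : N),
      f ((b • m) ⊗ₜ (c • n)) = (b ⊗ₜ[F] c) • f (m ⊗ₜ n)) :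
    outer (F := F) M N →ₗ[B ⊗[F] C] X where
  toFun x := f ((toOuter M N).symm x)
  map_add' x y := by rw [map_add, map_add]
  map_smul' r x := by
    obtain ⟨x, rfl⟩ := (toOuter M N).surjective x
    rw [RingHom.id_apply]
    induction x with
    | zero => simp
    | add a b ha hb => simp only [map_add, smul_add, ha, hb]
    | tmul m n =>
      induction r with
      | zero => simp
      | add p q hp hq => simp only [map_add, add_smul, hp, hq]
      | tmul b c =>
        rw [smul_toOuter_tmul, AddEquiv.symm_apply_apply, AddEquiv.symm_apply_apply, hf]

theorem outer_hom_ext {M : FGModuleCat.{u} B} {N : FGModuleCat.{u} C} {X : Type u} [AddCommGroup X]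
    [Module (B ⊗[F] C) X] {f g : outer (F := F) M N →ₗ[B ⊗[F] C] X}
    (h : ∀ (m : M) (n : N), f (toOuter M N (m ⊗ₜ n)) = g (toOuter M N (m ⊗ₜ n))) : f = g := by
  ext x
  obtain ⟨x, rfl⟩ := (toOuter M N).surjective x
  induction x with
  | zero => simp
  | tmul m n => exact h m n
  | add a b ha hb => simp only [map_add, ha, hb]

/-- If simple `B`-modules are absolutely simple then a simple module over `B ⊗ C` is an outer
tensor product. -/
theorem exists_outer_equiv
    (hB : ∀ S : FGModuleCat.{u} B, IsSimpleModule B S → Module.finrank F (S →ₗ[B] S) = 1)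
    (X : FGModuleCat.{u} (B ⊗[F] C)) [IsSimpleModule (B ⊗[F] C) X] :
    ∃ (S : FGModuleCat.{u} B) (N : FGModuleCat.{u} C),
      Nonempty (outer (F := F) S N ≃ₗ[B ⊗[F] C] X) := by
  have hart : IsArtinianRing B := IsArtinianRing.of_finite F B
  let φ : B →ₐ[F] B ⊗[F] C := Algebra.TensorProduct.includeLeft
  let XB : FGModuleCat.{u} B := (Res φ).obj X
  let ι : X ≃+ XB := toRes φ X
  have hXB : Nontrivial XB := by
    have := IsSimpleModule.nontrivial (B ⊗[F] C) X
    exact ι.symm.toEquiv.nontrivial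
  have hXa : IsArtinian B XB := isArtinian_of_fg_of_artinian'
  obtain h | ⟨S₀, hS₀, -⟩ := eq_bot_or_exists_atom_le (⊤ : Submodule B XB)
  · exact absurd h top_ne_bot
  have hsimple : IsSimpleModule B S₀ := isSimpleModule_iff_isAtom.2 hS₀
  -- Over `B` the module `X` contains a simple submodule; it becomes the first tensor factor.
  obtain ⟨S, hS, j, hj⟩ : ∃ S : FGModuleCat.{u} B, IsSimpleModule B S ∧
      ∃ j : S →ₗ[B] XB, Function.Injective j :=
    ⟨FGModuleCat.of B S₀, hsimple, S₀.subtype, Subtype.val_injective⟩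
  have hSn : Nontrivial S := IsSimpleModule.nontrivial B S
  have hEnd : ∀ g : S →ₗ[B] S, ∃ c : F, ∀ s, g s = c • s := by
    have hid : (LinearMap.id : S →ₗ[B] S) ≠ 0 := fun h => by
      obtain ⟨s, hs⟩ := exists_ne (0 : S)
      exact hs (LinearMap.congr_fun h s)
    intro g
    obtain ⟨c, hc⟩ := (finrank_eq_one_iff_of_nonzero' _ hid).1 (hB S hS) g
    exact ⟨c, fun s => by rw [← hc]; rfl⟩
  let _ : Module C XB := Module.compHom X
    (Algebra.TensorProduct.includeRight : C →ₐ[F] B ⊗[F] C).toRingHom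
  have hsB : ∀ (b : B) (x : X), b • ι x = ι ((b ⊗ₜ[F] (1 : C) : B ⊗[F] C) • x) := fun _ _ => rfl
  have hsC : ∀ (c : C) (x : X), c • ι x = ι (((1 : B) ⊗ₜ[F] c : B ⊗[F] C) • x) := fun _ _ => rfl
  have hcomm : SMulCommClass B C XB := ⟨fun b c x => by
    obtain ⟨x, rfl⟩ := ι.surjective x
    rw [hsB, hsC, hsC, hsB, ← mul_smul, ← mul_smul, Algebra.TensorProduct.tmul_mul_tmul,
      Algebra.TensorProduct.tmul_mul_tmul, one_mul, mul_one, one_mul, mul_one]⟩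
  have hsF : ∀ (r : F) (x : X), r • ι x = ι (r • x) := field_smul_toRes φ X
  have hsFC : ∀ (r : F) (x : XB), algebraMap F C r • x = r • x := fun r x => by
    obtain ⟨x, rfl⟩ := ι.surjective x
    rw [hsC, hsF, ← Algebra.TensorProduct.includeRight_apply, AlgHom.commutes, algebraMap_smul]
  have hNfin : Module.Finite C (S →ₗ[B] XB) := by
    have := hom_finite (F := F) S XB
    have : IsScalarTower F C (S →ₗ[B] XB) := IsScalarTower.of_algebraMap_smul fun r f => by
      ext s
      exact hsFC r (f s)
    exact Module.Finite.of_restrictScalars_finite F C _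
  -- The second factor is the multiplicity space `Hom_B(S, X)`, on which `C` acts through the
  -- values; this is possible because the actions of `B` and `C` on `X` commute.
  obtain ⟨N, hom, hcN⟩ : ∃ (N : FGModuleCat.{u} C) (hom : N ≃+ (S →ₗ[B] XB)),
      ∀ (c : C) (f : N) (s : S), hom (c • f) s = c • hom f s :=
    ⟨FGModuleCat.of C (S →ₗ[B] XB), AddEquiv.refl (S →ₗ[B] XB), fun _ _ _ => rfl⟩
  have hsN : ∀ (r : F) (f : N) (s : S), hom (r • f) s = r • hom f s := fun r f s => by
    rw [← algebraMap_smul C r f, hcN, hsFC]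
  let ev : S ⊗[F] N →ₗ[F] X := TensorProduct.lift
    (LinearMap.mk₂ F (fun (s : S) (f : N) => ι.symm (hom f s))
      (fun s s' f => by rw [map_add, map_add])
      (fun r s f => by
        rw [AddEquiv.symm_apply_eq, ← hsF, AddEquiv.apply_symm_apply, LinearMap.map_smul_of_tower])
      (fun s f f' => by rw [map_add, LinearMap.add_apply, map_add])
      (fun r s f => by
        rw [AddEquiv.symm_apply_eq, ← hsF, AddEquiv.apply_symm_apply, hsN]))
  let Φ : outer (F := F) S N →ₗ[B ⊗[F] C] X := outerLift ev.toAddMonoidHom fun b c s f => by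
    change ι.symm (hom (c • f) (b • s)) = (b ⊗ₜ[F] c) • ι.symm (hom f s)
    obtain ⟨x, hx⟩ := ι.surjective (hom f s)
    rw [hcN, (hom f).map_smul, ← hx, hsB, hsC, AddEquiv.symm_apply_apply, AddEquiv.symm_apply_apply,
      ← mul_smul, Algebra.TensorProduct.tmul_mul_tmul, one_mul, mul_one]
  have hΦ : ∀ (s : S) (f : N), Φ (toOuter S N (s ⊗ₜ f)) = ι.symm (hom f s) := fun _ _ => rfl
  -- An element of the kernel of evaluation is expanded in an `F`-basis of `N`; homomorphisms
  -- independent over `F` have independent values, so its coefficients vanish. Surjectivity then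
  -- follows from simplicity of `X`.
  have hinj : Function.Injective Φ := by
    rw [injective_iff_map_eq_zero]
    intro x hx
    obtain ⟨x, rfl⟩ := (toOuter S N).surjective x
    have := finite_over_field (F := F) C N
    let bN := Module.finBasis F N
    obtain ⟨t, rfl⟩ := TensorProduct.eq_repr_basis_right bN x
    have ht : t = 0 := by
      have hx' : ∑ i, hom (bN i) (t i) = 0 := by
        have hsum : (t.sum fun i m => m ⊗ₜ[F] bN i) = ∑ i, t i ⊗ₜ[F] bN i :=
          Finsupp.sum_fintype _ _ fun i => TensorProduct.zero_tmul _ _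
        rw [hsum, map_sum, map_sum] at hx
        simp only [hΦ] at hx
        apply ι.symm.injective
        rw [map_sum, hx, map_zero]
      have h0 := eq_zero_of_sum_apply_eq_zero hEnd (fun i => hom (bN i)) (fun c hc => by
        have h1 : ∑ i, c i • bN i = 0 := by
          apply hom.injective
          ext s
          rw [map_sum, LinearMap.sum_apply, map_zero, LinearMap.zero_apply]
          simp only [hsN]
          rw [hc s]
        exact funext (Fintype.linearIndependent_iff.1 bN.linearIndependent c h1)) t hx'
      exact Finsupp.ext fun i => congrFun h0 i
    rw [ht, Finsupp.sum_zero_index, map_zero]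
  have hne : Φ ≠ 0 := by
    intro h0
    obtain ⟨s, hs⟩ := exists_ne (0 : S)
    apply hs
    have h1 := hΦ s (hom.symm j)
    rw [h0, LinearMap.zero_apply, eq_comm, AddEquiv.apply_symm_apply, AddEquiv.symm_apply_eq,
      map_zero] at h1
    exact hj (h1.trans (map_zero j).symm)
  exact ⟨S, N, ⟨LinearEquiv.ofBijective Φ ⟨hinj, LinearMap.surjective_of_ne_zero hne⟩⟩⟩

/-- Induction on length reduces to simple modules, which are outer tensor products. Absolute
simplicity is needed for one of the two algebras only. -/
theorem G0.kunneth_surjective (hB : Function.Bijective (pairing F B)) :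
    Function.Surjective (G0.kunneth F B C) := by
  have hart : IsArtinianRing (B ⊗[F] C) := IsArtinianRing.of_finite F _
  have key : ∀ M : FGModuleCat.{u} (B ⊗[F] C),
      G0.cls M ∈ LinearMap.range (G0.kunneth F B C) := by
    intro M
    induction M using fg_induction with
    | zero M hM => rw [G0.cls_of_subsingleton]; exact zero_mem _
    | ext K M T i q hex hT ih =>
      rw [G0.cls_eq hex]
      refine add_mem ih ?_
      obtain ⟨S, N, ⟨e⟩⟩ := exists_outer_equiv (fun S hS => finrank_end_eq_one hB S) T
      exact ⟨G0.cls S ⊗ₜ G0.cls N, by rw [G0.kunneth_cls, G0.cls_congr e]⟩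
  intro x
  change x ∈ LinearMap.range (G0.kunneth F B C)
  induction x using G0.induction_on with
  | cls M => exact key M
  | add x y hx hy => exact add_mem hx hy
  | neg x hx => exact neg_mem hx

end Kunneth

/-! ### Compatibility of the pairing with outer tensor products; Künneth isomorphisms -/

section PairingKunneth

theorem HasDualBases.exists_left {k V W : Type*} [CommRing k] [Nontrivial k] [AddCommGroup V]
    [Module k V] [AddCommGroup W] [Module k W] [Module.Finite k W] {β : V →ₗ[k] W →ₗ[k] k}
    (h : HasDualBases β) (f : W →ₗ[k] k) : ∃ v, β v = f := by
  obtain ⟨ι, _, bV, bW, hb⟩ := h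
  have : Finite ι := Module.Finite.finite_basis bW
  have : Fintype ι := Fintype.ofFinite ι
  refine ⟨∑ i, f (bW i) • bV i, bW.ext fun j => ?_⟩
  simp [hb]

variable {F : Type u} [Field F] {B C : Type u} [Ring B] [Algebra F B] [Module.Finite F B] [Ring C]
  [Algebra F C] [Module.Finite F C]

/-- The outer tensor product of two homomorphisms. -/
def outerHom {M M' : FGModuleCat.{u} B} {N N' : FGModuleCat.{u} C} (f : M →ₗ[B] M')
    (g : N →ₗ[C] N') : outer (F := F) M N →ₗ[B ⊗[F] C] outer (F := F) M' N' :=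
  outerLift ((toOuter M' N').toAddMonoidHom.comp
    (TensorProduct.map (f.restrictScalars F) (g.restrictScalars F)).toAddMonoidHom)
    fun b c m n => by
      change toOuter M' N' (f (b • m) ⊗ₜ g (c • n)) = _ • toOuter M' N' (f m ⊗ₜ g n)
      rw [smul_toOuter_tmul, map_smul, map_smul]

theorem outerHom_tmul {M M' : FGModuleCat.{u} B} {N N' : FGModuleCat.{u} C} (f : M →ₗ[B] M')
    (g : N →ₗ[C] N') (m : M) (n : N) :
    outerHom (F := F) f g (toOuter M N (m ⊗ₜ n)) = toOuter M' N' (f m ⊗ₜ g n) := rfl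

/-- The map `Hom(P, M) ⊗ Hom(Q, N) → Hom(P ⊗ Q, M ⊗ N)`. -/
def homOuter (P M : FGModuleCat.{u} B) (Q N : FGModuleCat.{u} C) :
    (P →ₗ[B] M) ⊗[F] (Q →ₗ[C] N) →ₗ[F]
      (outer (F := F) P Q →ₗ[B ⊗[F] C] outer (F := F) M N) :=
  TensorProduct.lift (LinearMap.mk₂ F outerHom
    (fun f f' g => outer_hom_ext fun m n => by
      rw [LinearMap.add_apply, outerHom_tmul, outerHom_tmul, outerHom_tmul, LinearMap.add_apply,
        TensorProduct.add_tmul, map_add])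
    (fun r f g => outer_hom_ext fun m n => by
      rw [LinearMap.smul_apply, outerHom_tmul, outerHom_tmul, LinearMap.smul_apply,
        field_smul_toOuter, TensorProduct.smul_tmul'])
    (fun f g g' => outer_hom_ext fun m n => by
      rw [LinearMap.add_apply, outerHom_tmul, outerHom_tmul, outerHom_tmul, LinearMap.add_apply,
        TensorProduct.tmul_add, map_add])
    (fun r f g => outer_hom_ext fun m n => by
      rw [LinearMap.smul_apply, outerHom_tmul, outerHom_tmul, LinearMap.smul_apply,
        field_smul_toOuter, TensorProduct.tmul_smul]))

/-- After forgetting the actions of `B` and `C` this is the isomorphism `Hom(P, M) ⊗ Hom(Q, N) ≅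
Hom(P ⊗ Q, M ⊗ N)` of finite dimensional vector spaces. The forgetful maps are injective, and remain
so after tensoring over the field. -/
theorem homOuter_injective (P M : FGModuleCat.{u} B) (Q N : FGModuleCat.{u} C) :
    Function.Injective (homOuter (F := F) P M Q N) := by
  have := finite_over_field (F := F) B P
  have := finite_over_field (F := F) B M
  have := finite_over_field (F := F) C Q
  have := finite_over_field (F := F) C N
  let r := TensorProduct.map (LinearMap.restrictScalarsₗ F B P M F)
    (LinearMap.restrictScalarsₗ F C Q N F)
  have hr : Function.Injective r := TensorProduct.map_injective_of_flat_flat _ _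
    (LinearMap.restrictScalars_injective F) (LinearMap.restrictScalars_injective F)
  have key : ∀ t x, homOuter (F := F) P M Q N t (toOuter P Q x) =
      toOuter M N (homTensorHomEquiv F P Q M N (r t) x) := by
    intro t x
    rw [homTensorHomEquiv_apply]
    induction t with
    | zero => simp
    | add s t hs ht => rw [map_add, LinearMap.add_apply, hs, ht, map_add, map_add,
        LinearMap.add_apply, map_add]
    | tmul f g => rfl
  rw [injective_iff_map_eq_zero]
  intro t ht
  apply hr
  apply (homTensorHomEquiv F P Q M N).injective
  rw [map_zero, map_zero]
  refine LinearMap.ext fun x => (toOuter M N).injective ?_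
  rw [← key, ht]
  simp

/-- A homomorphism out of `P ⊗ Q` is recovered from its values on products of generators, using the
dual bases of the projective modules `P` and `Q`. -/
theorem homOuter_surjective (P : FGProj B) (M : FGModuleCat.{u} B) (Q : FGProj C)
    (N : FGModuleCat.{u} C) : Function.Surjective (homOuter (F := F) P.1 M Q.1 N) := by
  classical
  intro h
  obtain ⟨n, f, g, -, -, hfg⟩ := Module.Finite.exists_comp_eq_id_of_projective B P.1
  obtain ⟨n', f', g', -, -, hfg'⟩ := Module.Finite.exists_comp_eq_id_of_projective C Q.1
  have hp : ∀ p : P.1, p = ∑ i, g p i • f (Pi.single i 1) := fun p => by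
    conv_lhs => rw [← LinearMap.id_apply (R := B) p, ← hfg, LinearMap.comp_apply,
      LinearMap.pi_apply_eq_sum_univ f]
    refine Finset.sum_congr rfl fun i _ => ?_
    congr 2
    ext j
    simp only [Pi.single_apply, eq_comm]
  have hq : ∀ q : Q.1, q = ∑ i, g' q i • f' (Pi.single i 1) := fun q => by
    conv_lhs => rw [← LinearMap.id_apply (R := C) q, ← hfg', LinearMap.comp_apply,
      LinearMap.pi_apply_eq_sum_univ f']
    refine Finset.sum_congr rfl fun i _ => ?_
    congr 2
    ext j
    simp only [Pi.single_apply, eq_comm]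
  -- For any target value `z` the map `p ⊗ q ↦ (g p i ⊗ g' q j) • z` lies in the image. Summing
  -- these with `z` the values of `h` on generators gives `h`.
  have hz : ∀ (i : Fin n) (j : Fin n') (z : M ⊗[F] N), ∃ t, ∀ p q,
      homOuter (F := F) P.1 M Q.1 N t (toOuter P.1 Q.1 (p ⊗ₜ q)) =
        (g p i ⊗ₜ[F] g' q j : B ⊗[F] C) • toOuter M N z := by
    intro i j z
    induction z with
    | zero => exact ⟨0, fun p q => by simp⟩
    | add z z' hz hz' =>
      obtain ⟨t, ht⟩ := hz
      obtain ⟨t', ht'⟩ := hz'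
      exact ⟨t + t', fun p q => by rw [map_add, LinearMap.add_apply, ht, ht', map_add, smul_add]⟩
    | tmul x y =>
      exact ⟨((LinearMap.proj i ∘ₗ g).smulRight x) ⊗ₜ ((LinearMap.proj j ∘ₗ g').smulRight y),
        fun p q => rfl⟩
  choose t ht using hz
  refine ⟨∑ i, ∑ j, t i j ((toOuter M N).symm
    (h (toOuter P.1 Q.1 (f (Pi.single i 1) ⊗ₜ f' (Pi.single j 1))))), ?_⟩
  refine outer_hom_ext fun p q => ?_
  simp only [map_sum, LinearMap.sum_apply, ht, AddEquiv.apply_symm_apply]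
  conv_rhs => rw [hp p, hq q, TensorProduct.sum_tmul, map_sum, map_sum]
  refine Finset.sum_congr rfl fun i _ => ?_
  rw [TensorProduct.tmul_sum, map_sum, map_sum]
  refine Finset.sum_congr rfl fun j _ => ?_
  rw [← smul_toOuter_tmul, map_smul]

/-- For classes of modules this is multiplicativity of dimensions in `Hom(P ⊗ Q, M ⊗ N) ≅ Hom(P, M)
⊗ Hom(Q, N)`; everything else is additivity. -/
theorem pairing_kunneth (s : K0 B ⊗[ℤ] K0 C) (t : G0 B ⊗[ℤ] G0 C) :
    pairing F (B ⊗[F] C) (K0.kunneth F B C s) (G0.kunneth F B C t) =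
      tensorFormTwo (intBilin (pairing F B)) (intBilin (pairing F C)) s t := by
  induction s with
  | zero => simp
  | add s s' h h' => simp only [map_add, AddMonoidHom.add_apply, LinearMap.add_apply, h, h']
  | tmul a b =>
  induction a using K0.induction_on with
  | add a a' h h' =>
    simp only [TensorProduct.add_tmul, map_add, AddMonoidHom.add_apply, LinearMap.add_apply, h, h']
  | neg a h =>
    simp only [TensorProduct.neg_tmul, map_neg, AddMonoidHom.neg_apply, LinearMap.neg_apply, h]
  | cls P =>
  induction b using K0.induction_on with
  | add a a' h h' =>
    simp only [TensorProduct.tmul_add, map_add, AddMonoidHom.add_apply, LinearMap.add_apply, h, h']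
  | neg a h =>
    simp only [TensorProduct.tmul_neg, map_neg, AddMonoidHom.neg_apply, LinearMap.neg_apply, h]
  | cls Q =>
  induction t with
  | zero => simp
  | add s s' h h' => simp only [map_add, h, h']
  | tmul x y =>
  induction x using G0.induction_on with
  | add a a' h h' => simp only [TensorProduct.add_tmul, map_add, h, h']
  | neg a h => simp only [TensorProduct.neg_tmul, map_neg, h]
  | cls M =>
  induction y using G0.induction_on with
  | add a a' h h' => simp only [TensorProduct.tmul_add, map_add, h, h']
  | neg a h => simp only [TensorProduct.tmul_neg, map_neg, h]
  | cls N =>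
  have := LinearEquiv.finrank_eq (LinearEquiv.ofBijective _
    ⟨homOuter_injective (F := F) P.1 M Q.1 N, homOuter_surjective P M Q N⟩)
  rw [Module.finrank_tensorProduct] at this
  rw [tensorFormTwo_tmul, K0.kunneth_cls, G0.kunneth_cls, pairing_cls, ← this]
  push_cast
  rfl

section Perfect

theorem G0.kunneth_bijective (hB : Function.Bijective (pairing F B))
    (hC : Function.Bijective (pairing F C)) : Function.Bijective (G0.kunneth F B C) := by
  refine ⟨fun t t' h => ?_, G0.kunneth_surjective hB⟩
  refine ((pairing_hasDualBases hB).tensor (pairing_hasDualBases hC)).ext_right fun s => ?_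
  rw [← pairing_kunneth, ← pairing_kunneth, h]

/-- Surjectivity comes from duality. The functional defined by a class `y` is represented by a
tensor through the dual bases, and injectivity of the pairing over `B ⊗ C` identifies the image of
this tensor with `y`. -/
theorem K0.kunneth_bijective (hB : Function.Bijective (pairing F B))
    (hC : Function.Bijective (pairing F C)) : Function.Bijective (K0.kunneth F B C) := by
  have hd := (pairing_hasDualBases hB).tensor (pairing_hasDualBases hC)
  constructor
  · intro s s' h
    refine hd.ext_left fun t => ?_
    rw [← pairing_kunneth, ← pairing_kunneth, h]
  · intro y
    obtain ⟨_, _⟩ := G0.free_finite F B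
    obtain ⟨_, _⟩ := G0.free_finite F C
    obtain ⟨s, hs⟩ := hd.exists_left
      ((pairing F (B ⊗[F] C) y).toIntLinearMap ∘ₗ G0.kunneth F B C)
    refine ⟨s, pairing_injective F (AddMonoidHom.ext fun z => ?_)⟩
    obtain ⟨t, rfl⟩ := G0.kunneth_surjective hB z
    rw [pairing_kunneth, hs]
    rfl

end Perfect

end PairingKunneth

/-! ### Dimensions of Hom spaces under restriction, induction and adjunctions -/

section FunctorDimensions

variable {F : Type u} [Field F] {B C : Type u} [Ring B] [Algebra F B] [Ring C] [Algebra F C]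

/-- Restriction of homomorphisms along `φ`. -/
def resHom [Module.Finite F B] (φ : C →ₐ[F] B) (M N : FGModuleCat.{u} B) :
    (M →ₗ[B] N) →ₗ[F] ((Res φ).obj M →ₗ[C] (Res φ).obj N) where
  toFun f :=
    { toFun := fun x => toRes φ N (f ((toRes φ M).symm x))
      map_add' := fun x y => by rw [map_add, map_add, map_add]
      map_smul' := fun c x => by
        obtain ⟨x, rfl⟩ := (toRes φ M).surjective x
        rw [smul_toRes, AddEquiv.symm_apply_apply, AddEquiv.symm_apply_apply, map_smul,
          RingHom.id_apply, smul_toRes] }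
  map_add' f g := rfl
  map_smul' r f := by
    ext x
    exact (field_smul_toRes φ N r _).symm

theorem resHom_apply [Module.Finite F B] (φ : C →ₐ[F] B) (M N : FGModuleCat.{u} B) (f : M →ₗ[B] N)
    (x : M) : resHom φ M N f (toRes φ M x) = toRes φ N (f x) := rfl

/-- Restriction along a surjective homomorphism is fully faithful. -/
theorem finrank_hom_res [Module.Finite F B] (φ : C →ₐ[F] B) (hφ : Function.Surjective φ)
    (M N : FGModuleCat.{u} B) :
    Module.finrank F ((Res φ).obj M →ₗ[C] (Res φ).obj N) = Module.finrank F (M →ₗ[B] N) := by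
  refine (LinearEquiv.finrank_eq (LinearEquiv.ofBijective (resHom φ M N) ⟨fun f g h => ?_,
    fun f => ?_⟩)).symm
  · ext x
    apply (toRes φ N).injective
    rw [← resHom_apply, h, resHom_apply]
  · refine ⟨{ toFun := fun x => (toRes φ N).symm (f (toRes φ M x))
              map_add' := fun x y => by rw [map_add, map_add, map_add]
              map_smul' := fun b x => ?_ }, rfl⟩
    obtain ⟨c, rfl⟩ := hφ b
    rw [← smul_toRes, map_smul, RingHom.id_apply, AddEquiv.symm_apply_eq, ← smul_toRes,
      AddEquiv.apply_symm_apply]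

/-- The identity of the tensor product, with values in the induced module. -/
def toInd (φ : B →ₐ[F] C) (N : FGModuleCat.{u} B) :
    BalancedTensor φ.toRingHom N ≃ₗ[C] (Ind φ.toRingHom).obj N :=
  LinearEquiv.refl C (BalancedTensor φ.toRingHom N)

/-- Induction is left adjoint to restriction. -/
theorem finrank_hom_ind [Module.Finite F C] (φ : B →ₐ[F] C) (N : FGModuleCat.{u} B)
    (M : FGModuleCat.{u} C) :
    Module.finrank F ((Ind φ.toRingHom).obj N →ₗ[C] M) =
      Module.finrank F (N →ₗ[B] (Res φ).obj M) := by
  let Φ : ((Ind φ.toRingHom).obj N →ₗ[C] M) →ₗ[F] (N →ₗ[B] (Res φ).obj M) :=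
    { toFun := fun f =>
        { toFun := fun n => toRes φ M (f (toInd φ N (BalancedTensor.tmul _ 1 n)))
          map_add' := fun n n' => by rw [BalancedTensor.tmul_add, map_add, map_add, map_add]
          map_smul' := fun b n => by
            rw [← BalancedTensor.mul_tmul, one_mul, ← mul_one (φ.toRingHom b),
              ← BalancedTensor.smul_tmul', map_smul, map_smul, RingHom.id_apply, smul_toRes]
            rfl }
      map_add' := fun f g => rfl
      map_smul' := fun r f => by
        ext n
        exact (field_smul_toRes φ M r _).symm }
  have hΦ : ∀ f n, Φ f n = toRes φ M (f (toInd φ N (BalancedTensor.tmul _ 1 n))) :=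
    fun _ _ => rfl
  refine LinearEquiv.finrank_eq (LinearEquiv.ofBijective Φ ⟨fun f g h => ?_, fun g => ?_⟩)
  · ext x
    obtain ⟨x, rfl⟩ := (toInd φ N).surjective x
    induction x using BalancedTensor.induction_on with
    | zero =>
      have h0 : toInd φ N 0 = 0 := LinearEquiv.map_zero _
      rw [h0, map_zero, map_zero]
    | add x y hx hy => simp only [map_add, hx, hy]
    | tm a n =>
      rw [← mul_one a, ← BalancedTensor.smul_tmul', map_smul, map_smul, map_smul]
      congr 1
      exact (toRes φ M).injective (LinearMap.congr_fun h n)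
  · let h := BalancedTensor.lift φ.toRingHom
      ((toRes φ M).symm.toAddMonoidHom.comp g.toAddMonoidHom) (fun b n => by
        change (toRes φ M).symm (g (b • n)) = φ b • (toRes φ M).symm (g n)
        rw [map_smul, AddEquiv.symm_apply_eq, ← smul_toRes, AddEquiv.apply_symm_apply])
    have hh : ∀ n, h (BalancedTensor.tmul _ 1 n) = (toRes φ M).symm (g n) := fun n => by
      rw [BalancedTensor.lift_tmul, one_smul]
      rfl
    refine ⟨h ∘ₗ (toInd φ N).symm.toLinearMap, ?_⟩
    ext n
    rw [hΦ, LinearMap.comp_apply, LinearEquiv.coe_coe, LinearEquiv.symm_apply_apply, hh,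
      AddEquiv.apply_symm_apply]

/-- An adjunction of bare categories gives only bijections of Hom sets. Linearity of the left
adjoint on morphisms is what turns them into isomorphisms of vector spaces. -/
theorem finrank_hom_adjunction [Module.Finite F B] [Module.Finite F C]
    {φ : FGModuleCat.{u} C ⥤ FGModuleCat.{u} B} {G : FGModuleCat.{u} B ⥤ FGModuleCat.{u} C}
    (adj : φ ⊣ G) (hφ : ∀ (M N : FGModuleCat.{u} C) (r : F) (f : M →ₗ[C] N),
      (φ.map (FGModuleCat.ofHom (r • f))).hom.hom = r • (φ.map (FGModuleCat.ofHom f)).hom.hom)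
    (hadd : ∀ (M N : FGModuleCat.{u} C) (f g : M →ₗ[C] N),
      (φ.map (FGModuleCat.ofHom (f + g))).hom.hom =
        (φ.map (FGModuleCat.ofHom f)).hom.hom + (φ.map (FGModuleCat.ofHom g)).hom.hom)
    (P : FGModuleCat.{u} C) (M : FGModuleCat.{u} B) :
    Module.finrank F (φ.obj P →ₗ[B] M) = Module.finrank F (P →ₗ[C] G.obj M) := by
  let ev : φ.obj (G.obj M) →ₗ[B] M := (adj.counit.app M).hom.hom
  let Φ : (P →ₗ[C] G.obj M) →ₗ[F] (φ.obj P →ₗ[B] M) :=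
    { toFun := fun f => ev ∘ₗ (φ.map (FGModuleCat.ofHom f)).hom.hom
      map_add' := fun f g => by rw [hadd, LinearMap.comp_add]
      map_smul' := fun r f => by
        rw [hφ]
        ext x
        exact LinearMap.map_smul_of_tower ev r _ }
  have hΦ : ∀ f, Φ f = ((adj.homEquiv P M).symm (FGModuleCat.ofHom f)).hom.hom := fun f => by
    rw [Adjunction.homEquiv_counit]
    rfl
  refine (LinearEquiv.finrank_eq (LinearEquiv.ofBijective Φ ⟨fun f g h => ?_, fun g => ?_⟩)).symm
  · rw [hΦ, hΦ] at h
    have := (adj.homEquiv P M).symm.injective (FGModuleCat.hom_ext h)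
    exact congrArg (fun k => k.hom.hom) this
  · refine ⟨(adj.homEquiv P M (FGModuleCat.ofHom g)).hom.hom, ?_⟩
    rw [hΦ]
    exact congrArg (fun k => k.hom.hom) ((adj.homEquiv P M).symm_apply_apply (FGModuleCat.ofHom g))

theorem finrank_hom_pi [Module.Finite F B] {ι : Type} [Fintype ι] (X : ι → FGModuleCat.{u} B)
    (M : FGModuleCat.{u} B) :
    Module.finrank F ((∀ i, X i) →ₗ[B] M) = ∑ i, Module.finrank F (X i →ₗ[B] M) := by
  classical
  have := fun i => hom_finite (F := F) (X i) M
  rw [← LinearEquiv.finrank_eq (LinearMap.lsum (M := M) B (fun i => X i) F),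
    Module.finrank_pi_fintype]

end FunctorDimensions

/-! ### Restriction of outer tensor products; associativity and interchange of factors -/

section RestrictionEquivalences

section

variable {F : Type u} [Field F] {B C B' C' : Type u} [Ring B] [Algebra F B] [Module.Finite F B]
  [Ring C] [Algebra F C] [Ring B'] [Algebra F B'] [Ring C'] [Algebra F C']

/-- The identity of `M`, as a linear map over the field. -/
def toResLin (φ : C →ₐ[F] B) (M : FGModuleCat.{u} B) : M ≃ₗ[F] (Res φ).obj M :=
  { toRes φ M with map_smul' := fun r x => (field_smul_toRes φ M r x).symm }

theorem toResLin_apply (φ : C →ₐ[F] B) (M : FGModuleCat.{u} B) (x : M) :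
    toResLin φ M x = toRes φ M x := rfl

variable [Module.Finite F C]

/-- Semilinear bijections between outer tensor products can be checked on pure tensors. -/
theorem smul_outer_of_tmul {M : FGModuleCat.{u} B}
    {N : FGModuleCat.{u} C} {X : Type u}
    [AddCommGroup X] {R : Type u} [Ring R] [Algebra F R] [Module (B' ⊗[F] C') X]
    (φ : B' ⊗[F] C' →ₐ[F] R) [Module R (outer (F := F) M N)] (e : outer (F := F) M N →+ X)
    (he : ∀ (b : B') (c : C') (m : M) (n : N), e (φ (b ⊗ₜ c) • toOuter M N (m ⊗ₜ n)) =
      (b ⊗ₜ[F] c) • e (toOuter M N (m ⊗ₜ n)))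
    (r : B' ⊗[F] C') (x : outer (F := F) M N) : e (φ r • x) = r • e x := by
  obtain ⟨x, rfl⟩ := (toOuter M N).surjective x
  induction x with
  | zero => simp
  | add x y hx hy => simp only [map_add, smul_add, hx, hy]
  | tmul m n =>
    induction r with
    | zero => simp
    | add p q hp hq => simp only [map_add, add_smul, hp, hq]
    | tmul b c => exact he b c m n

end

variable {F : Type u} [Field F] {B C B' C' : Type u} [Ring B] [Algebra F B] [Module.Finite F B]
  [Ring C] [Algebra F C] [Module.Finite F C] [Ring B'] [Algebra F B'] [Module.Finite F B']
  [Ring C'] [Algebra F C'] [Module.Finite F C']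

/-- A bijection which is semilinear along `φ` is an isomorphism from the restriction. -/
def resEquiv (φ : C →ₐ[F] B) {X : FGModuleCat.{u} B} {Y : FGModuleCat.{u} C} (e : X ≃+ Y)
    (he : ∀ (c : C) (x : X), e (φ c • x) = c • e x) : (Res φ).obj X ≃ₗ[C] Y where
  toFun x := e ((toRes φ X).symm x)
  invFun y := toRes φ X (e.symm y)
  left_inv x := by simp
  right_inv y := by simp
  map_add' x y := by rw [map_add, map_add]
  map_smul' c x := by
    obtain ⟨x, rfl⟩ := (toRes φ X).surjective x
    rw [smul_toRes, AddEquiv.symm_apply_apply, AddEquiv.symm_apply_apply, he, RingHom.id_apply]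

/-- The restriction along a composition. -/
def resComp (φ : C →ₐ[F] B) (φ' : C' →ₐ[F] C) (X : FGModuleCat.{u} B) :
    (Res φ').obj ((Res φ).obj X) ≃ₗ[C'] (Res (φ.comp φ')).obj X :=
  resEquiv φ' ((toRes φ X).symm.trans (toRes (φ.comp φ') X)) fun c x => by
    obtain ⟨x, rfl⟩ := (toRes φ X).surjective x
    rw [AddEquiv.trans_apply, AddEquiv.trans_apply, smul_toRes, AddEquiv.symm_apply_apply,
      AddEquiv.symm_apply_apply, smul_toRes, AlgHom.comp_apply]

/-- The restriction along the identity. -/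
def resId (X : FGModuleCat.{u} B) : (Res (AlgHom.id F B)).obj X ≃ₗ[B] X :=
  resEquiv (AlgHom.id F B) (AddEquiv.refl X) fun _ _ => rfl

/-- Restriction of an outer tensor product. -/
def resOuter (φ : B' →ₐ[F] B) (χ : C' →ₐ[F] C) (M : FGModuleCat.{u} B) (N : FGModuleCat.{u} C) :
    (Res (Algebra.TensorProduct.map φ χ)).obj (outer (F := F) M N) ≃ₗ[B' ⊗[F] C']
      outer (F := F) ((Res φ).obj M) ((Res χ).obj N) :=
  resEquiv _ ((toOuter M N).symm.trans
    ((TensorProduct.congr (toResLin φ M) (toResLin χ N)).toAddEquiv.trans (toOuter _ _)))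
    fun r x => smul_outer_of_tmul (Algebra.TensorProduct.map φ χ) (AddEquiv.toAddMonoidHom _)
      (fun b c m n => by
        change toOuter _ _ ((toResLin φ M (φ b • m)) ⊗ₜ (toResLin χ N (χ c • n))) = 
          _ • toOuter _ _ ((toResLin φ M m) ⊗ₜ (toResLin χ N n))
        rw [smul_toOuter_tmul, toResLin_apply, toResLin_apply, toResLin_apply, toResLin_apply,
          smul_toRes, smul_toRes]) r x

/-- The identity of `M ⊗ N`, as a linear map over the field. -/
def toOuterLin (M : FGModuleCat.{u} B) (N : FGModuleCat.{u} C) :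
    M ⊗[F] N ≃ₗ[F] outer (F := F) M N :=
  { toOuter M N with map_smul' := fun r x => (field_smul_toOuter M N r x).symm }

/-- Stated as an existence so that later arguments depend only on the formula for pure tensors;
likewise for the interchange below. -/
theorem exists_outer_assoc (M : FGModuleCat.{u} B) (N : FGModuleCat.{u} C) (L : FGModuleCat.{u} B') :
    ∃ e : outer (F := F) M (outer (F := F) N L) ≃+ outer (F := F) (outer (F := F) M N) L,
      ∀ (m : M) (n : N) (l : L), e (toOuter _ _ (m ⊗ₜ toOuter _ _ (n ⊗ₜ l))) =
        toOuter _ _ (toOuter _ _ (m ⊗ₜ n) ⊗ₜ l) :=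
  ⟨((toOuterLin _ _).symm ≪≫ₗ TensorProduct.congr (LinearEquiv.refl F M) (toOuterLin N L).symm ≪≫ₗ
      (TensorProduct.assoc F M N L).symm ≪≫ₗ
      TensorProduct.congr (toOuterLin M N) (LinearEquiv.refl F L) ≪≫ₗ toOuterLin _ _).toAddEquiv,
    fun _ _ _ => rfl⟩

/-- The outer tensor product is associative. -/
theorem nonempty_resAssoc (M : FGModuleCat.{u} B) (N : FGModuleCat.{u} C) (L : FGModuleCat.{u} B') :
    Nonempty ((Res (Algebra.TensorProduct.assoc F F F B C B').toAlgHom).obj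
      (outer (F := F) M (outer (F := F) N L)) ≃ₗ[(B ⊗[F] C) ⊗[F] B']
        outer (F := F) (outer (F := F) M N) L) := by
  obtain ⟨e, he⟩ := exists_outer_assoc (F := F) M N L
  refine ⟨resEquiv _ e fun r x => smul_outer_of_tmul
    (Algebra.TensorProduct.assoc F F F B C B').toAlgHom e.toAddMonoidHom (fun b c m x => ?_) r x⟩
  change e ((Algebra.TensorProduct.assoc F F F B C B' (b ⊗ₜ c)) • _) = _ • e _
  obtain ⟨x, rfl⟩ := (toOuter N L).surjective x
  induction x with
  | zero => simp
  | add x y hx hy => simp only [map_add, TensorProduct.tmul_add, smul_add, hx, hy]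
  | tmul n l =>
    induction b with
    | zero =>
      simp only [TensorProduct.zero_tmul, map_zero, zero_smul]
      exact (congrArg e (zero_smul (B ⊗[F] (C ⊗[F] B')) _)).trans (map_zero e)
    | add p q hp hq => simp only [map_add, TensorProduct.add_tmul, add_smul, hp, hq]
    | tmul a b =>
      rw [Algebra.TensorProduct.assoc_tmul, smul_toOuter_tmul, smul_toOuter_tmul, he, he,
        smul_toOuter_tmul, smul_toOuter_tmul]

theorem exists_outer_tensorTensorTensorComm (M : FGModuleCat.{u} B) (N : FGModuleCat.{u} C)
    (K : FGModuleCat.{u} B') (L : FGModuleCat.{u} C') :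
    ∃ e : outer (F := F) (outer (F := F) M N) (outer (F := F) K L) ≃+
        outer (F := F) (outer (F := F) M K) (outer (F := F) N L),
      ∀ (m : M) (n : N) (k : K) (l : L),
        e (toOuter _ _ (toOuter _ _ (m ⊗ₜ n) ⊗ₜ toOuter _ _ (k ⊗ₜ l))) =
          toOuter _ _ (toOuter _ _ (m ⊗ₜ k) ⊗ₜ toOuter _ _ (n ⊗ₜ l)) :=
  ⟨((toOuterLin _ _).symm ≪≫ₗ TensorProduct.congr (toOuterLin M N).symm (toOuterLin K L).symm ≪≫ₗ
      TensorProduct.tensorTensorTensorComm F M N K L ≪≫ₗ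
      TensorProduct.congr (toOuterLin M K) (toOuterLin N L) ≪≫ₗ toOuterLin _ _).toAddEquiv,
    fun _ _ _ _ => rfl⟩

/-- The interchange of the inner factors of a fourfold outer tensor product. -/
theorem nonempty_resTensorTensorTensorComm (M : FGModuleCat.{u} B) (N : FGModuleCat.{u} C)
    (K : FGModuleCat.{u} B') (L : FGModuleCat.{u} C') :
    Nonempty ((Res (Algebra.TensorProduct.tensorTensorTensorComm F F F F B B' C C').toAlgHom).obj
      (outer (F := F) (outer (F := F) M N) (outer (F := F) K L)) ≃ₗ[(B ⊗[F] B') ⊗[F] (C ⊗[F] C')]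
        outer (F := F) (outer (F := F) M K) (outer (F := F) N L)) := by
  obtain ⟨e, he⟩ := exists_outer_tensorTensorTensorComm (F := F) M N K L
  refine ⟨resEquiv _ e fun r x => smul_outer_of_tmul
    (Algebra.TensorProduct.tensorTensorTensorComm F F F F B B' C C').toAlgHom e.toAddMonoidHom
    (fun b c x y => ?_) r x⟩
  change e ((Algebra.TensorProduct.tensorTensorTensorComm F F F F B B' C C' (b ⊗ₜ c)) • _) =
    _ • e _
  obtain ⟨x, rfl⟩ := (toOuter M N).surjective x
  obtain ⟨y, rfl⟩ := (toOuter K L).surjective y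
  induction x with
  | zero => simp
  | add x y hx hy => simp only [map_add, TensorProduct.add_tmul, smul_add, hx, hy]
  | tmul m n =>
  induction y with
  | zero => simp
  | add x y hx hy => simp only [map_add, TensorProduct.tmul_add, smul_add, hx, hy]
  | tmul k l =>
  induction b with
  | zero =>
    simp only [TensorProduct.zero_tmul, map_zero, zero_smul]
    exact (congrArg e (zero_smul ((B ⊗[F] C) ⊗[F] (B' ⊗[F] C')) _)).trans (map_zero e)
  | add p q hp hq => simp only [map_add, TensorProduct.add_tmul, add_smul, hp, hq]
  | tmul a b =>
  induction c with
  | zero =>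
    simp only [TensorProduct.tmul_zero, map_zero, zero_smul]
    exact (congrArg e (zero_smul ((B ⊗[F] C) ⊗[F] (B' ⊗[F] C')) _)).trans (map_zero e)
  | add p q hp hq => simp only [map_add, TensorProduct.tmul_add, add_smul, hp, hq]
  | tmul c d =>
    rw [Algebra.TensorProduct.tensorTensorTensorComm_tmul, smul_toOuter_tmul,
      smul_toOuter_tmul, smul_toOuter_tmul, he, he,
      smul_toOuter_tmul, smul_toOuter_tmul, smul_toOuter_tmul]

end RestrictionEquivalences

/-! ### Restriction maps on Grothendieck groups -/

section RestrictionMaps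

attribute [local instance] outerModule

theorem G0.tensor_ext {R S : Type u} [Ring R] [Ring S] {X : Type*} [AddCommGroup X]
    {f g : TensorHom ℤ (G0 R) (G0 S) X}
    (h : ∀ M N, f (G0.cls M ⊗ₜ G0.cls N) = g (G0.cls M ⊗ₜ G0.cls N)) : f = g := by
  refine TensorProduct.ext' fun x y => ?_
  induction x using G0.induction_on with
  | add a a' h h' => simp only [TensorProduct.add_tmul, map_add, h, h']
  | neg a h => simp only [TensorProduct.neg_tmul, map_neg, h]
  | cls M =>
  induction y using G0.induction_on with
  | add a a' h h' => simp only [TensorProduct.tmul_add, map_add, h, h']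
  | neg a h => simp only [TensorProduct.tmul_neg, map_neg, h]
  | cls N => exact h M N

theorem K0.tensor_ext {R S : Type u} [Ring R] [Ring S] {X : Type*} [AddCommGroup X]
    {f g : TensorHom ℤ (K0 R) (K0 S) X}
    (h : ∀ M N, f (K0.cls M ⊗ₜ K0.cls N) = g (K0.cls M ⊗ₜ K0.cls N)) : f = g := by
  refine TensorProduct.ext' fun x y => ?_
  induction x using K0.induction_on with
  | add a a' h h' => simp only [TensorProduct.add_tmul, map_add, h, h']
  | neg a h => simp only [TensorProduct.neg_tmul, map_neg, h]
  | cls M =>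
  induction y using K0.induction_on with
  | add a a' h h' => simp only [TensorProduct.tmul_add, map_add, h, h']
  | neg a h => simp only [TensorProduct.tmul_neg, map_neg, h]
  | cls N => exact h M N

theorem linearInverse_apply {k V W : Type*} [CommRing k] [AddCommGroup V] [Module k V]
    [AddCommGroup W] [Module k W] {f : V →ₗ[k] W} (hf : Function.Bijective f) (w : W) :
    f (linearInverse f w) = w := by
  rw [linearInverse, dif_pos hf]
  exact (LinearEquiv.ofBijective f hf).apply_symm_apply w

variable {F : Type u} [Field F] {B C B' C' D : Type u} [Ring B] [Algebra F B]
  [Ring C] [Algebra F C] [Ring B'] [Algebra F B'] [Ring C'] [Algebra F C'] [Ring D] [Algebra F D]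

/-- The target of `φ` is projective as a left module over the source. -/
abbrev IsLeftProjective (φ : C →ₐ[F] B) : Prop :=
  @Module.Projective C _ B _ (Module.compHom B φ.toRingHom)

theorem IsLeftProjective.id : IsLeftProjective (AlgHom.id F B) :=
  projective_of_equiv (AlgEquiv.refl : B ≃ₐ[F] B)

/-- The regular module. -/
def regular (B : Type u) [Ring B] : FGModuleCat.{u} B := FGModuleCat.of B B

/-- The identity of `B`, with values in the regular module. -/
def toRegLin (F B : Type u) [Field F] [Ring B] [Algebra F B] : B ≃ₗ[F] regular B where
  toFun b := b
  invFun b := b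
  left_inv _ := rfl
  right_inv _ := rfl
  map_add' _ _ := rfl
  map_smul' r b := Algebra.smul_def r b

theorem mul_toRegLin (b b' : B) : toRegLin F B (b * b') = b • toRegLin F B b' := rfl

variable [Module.Finite F B]

theorem IsLeftProjective.iff_res {φ : C →ₐ[F] B} : IsLeftProjective φ ↔
    Module.Projective C ((Res φ).obj (regular B)) := Iff.rfl

/-- The map on `G0` given by restriction. -/
def G0.res (φ : C →ₐ[F] B) : G0 B →ₗ[ℤ] G0 C :=
  (G0.map (Res φ).obj (Res_exact φ)).toIntLinearMap

/-- The map on `K0` given by restriction. -/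
def K0.res (φ : C →ₐ[F] B) (hφ : IsLeftProjective φ) : K0 B →ₗ[ℤ] K0 C :=
  (K0.map (Res φ).obj (Res_exact φ) (Res_projective φ hφ)).toIntLinearMap

theorem G0.res_cls (φ : C →ₐ[F] B) (M : FGModuleCat.{u} B) :
    G0.res φ (G0.cls M) = G0.cls ((Res φ).obj M) := rfl

theorem K0.res_cls (φ : C →ₐ[F] B) (hφ : IsLeftProjective φ) (P : FGProj B) :
    K0.res φ hφ (K0.cls P) = K0.cls ⟨(Res φ).obj P.1, Res_projective φ hφ P⟩ := rfl

variable [Module.Finite F C]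

theorem IsLeftProjective.comp {φ : C →ₐ[F] B} {φ' : D →ₐ[F] C} (h : IsLeftProjective φ)
    (h' : IsLeftProjective φ') : IsLeftProjective (φ.comp φ') := by
  rw [IsLeftProjective.iff_res] at h ⊢
  have := Res_projective φ' h' ⟨(Res φ).obj (regular B), h⟩
  exact Module.Projective.of_equiv (resComp φ φ' (regular B))

theorem G0.res_res (φ : C →ₐ[F] B) (φ' : D →ₐ[F] C) (x : G0 B) :
    G0.res φ' (G0.res φ x) = G0.res (φ.comp φ') x := by
  induction x using G0.induction_on with
  | add x y hx hy => simp only [map_add, hx, hy]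
  | neg x hx => simp only [map_neg, hx]
  | cls M =>
    rw [G0.res_cls, G0.res_cls, G0.res_cls]
    exact G0.cls_congr (resComp φ φ' M)

theorem K0.res_res (φ : C →ₐ[F] B) (hφ : IsLeftProjective φ) (φ' : D →ₐ[F] C)
    (hφ' : IsLeftProjective φ') (x : K0 B) :
    K0.res φ' hφ' (K0.res φ hφ x) = K0.res (φ.comp φ') (hφ.comp hφ') x := by
  induction x using K0.induction_on with
  | add x y hx hy => simp only [map_add, hx, hy]
  | neg x hx => simp only [map_neg, hx]
  | cls M =>
    rw [K0.res_cls, K0.res_cls, K0.res_cls]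
    exact K0.cls_congr (resComp φ φ' M.1)

variable [Module.Finite F B'] [Module.Finite F C'] [Module.Finite F D]

/-- As a module over `B' ⊗ C'`, the algebra `B ⊗ C` is the outer tensor product of the restricted
regular modules, each of them projective. -/
theorem IsLeftProjective.map {φ : B' →ₐ[F] B} {χ : C' →ₐ[F] C} (h : IsLeftProjective φ)
    (h' : IsLeftProjective χ) : IsLeftProjective (Algebra.TensorProduct.map φ χ) := by
  rw [IsLeftProjective.iff_res] at h h' ⊢
  have := outer_proj (F := F) ⟨_, h⟩ ⟨_, h'⟩
  let e : B ⊗[F] C ≃+ outer (F := F) ((Res φ).obj (regular B))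
      ((Res χ).obj (regular C)) :=
    (TensorProduct.congr (toRegLin F B ≪≫ₗ toResLin φ _)
      (toRegLin F C ≪≫ₗ toResLin χ _)).toAddEquiv.trans (toOuter _ _)
  have he : ∀ b c, e (b ⊗ₜ c) = toOuter _ _
      (toRes φ _ (toRegLin F B b) ⊗ₜ toRes χ _ (toRegLin F C c)) := fun _ _ => rfl
  refine Module.Projective.of_equiv (resEquiv (Algebra.TensorProduct.map φ χ)
    (X := regular (B ⊗[F] C)) e fun r x => ?_).symm
  obtain ⟨x, rfl⟩ := (toRegLin F (B ⊗[F] C)).surjective x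
  change e (Algebra.TensorProduct.map φ χ r * x) = r • e x
  induction x with
  | zero => simp
  | add x y hx hy => simp only [mul_add, map_add, smul_add, hx, hy]
  | tmul b c =>
    induction r with
    | zero => simp
    | add p q hp hq => simp only [map_add, add_mul, add_smul, hp, hq]
    | tmul b' c' =>
      rw [Algebra.TensorProduct.map_tmul, Algebra.TensorProduct.tmul_mul_tmul, he, he,
        smul_toOuter_tmul, mul_toRegLin, mul_toRegLin, smul_toRes, smul_toRes]

theorem G0.res_id : G0.res (AlgHom.id F B) = LinearMap.id := by
  ext x
  induction x using G0.induction_on with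
  | add x y hx hy => simp only [map_add, hx, hy]
  | neg x hx => simp only [map_neg, hx]
  | cls M => exact G0.cls_congr (resId M)

theorem K0.res_id : K0.res (AlgHom.id F B) .id = LinearMap.id := by
  ext x
  induction x using K0.induction_on with
  | add x y hx hy => simp only [map_add, hx, hy]
  | neg x hx => simp only [map_neg, hx]
  | cls M => exact K0.cls_congr (resId M.1)

theorem G0.res_kunneth (φ : B' →ₐ[F] B) (χ : C' →ₐ[F] C) (t : G0 B ⊗[ℤ] G0 C) :
    G0.res (Algebra.TensorProduct.map φ χ) (G0.kunneth F B C t) =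
      G0.kunneth F B' C' (TensorProduct.map (G0.res φ) (G0.res χ) t) := by
  rw [← LinearMap.comp_apply, ← LinearMap.comp_apply]
  refine LinearMap.congr_fun (G0.tensor_ext fun M N => ?_) t
  exact G0.cls_congr (resOuter φ χ M N)

theorem K0.res_kunneth (φ : B' →ₐ[F] B) (hφ : IsLeftProjective φ) (χ : C' →ₐ[F] C)
    (hχ : IsLeftProjective χ) (t : K0 B ⊗[ℤ] K0 C) :
    K0.res (Algebra.TensorProduct.map φ χ) (hφ.map hχ) (K0.kunneth F B C t) =
      K0.kunneth F B' C' (TensorProduct.map (K0.res φ hφ) (K0.res χ hχ) t) := by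
  rw [← LinearMap.comp_apply, ← LinearMap.comp_apply]
  refine LinearMap.congr_fun (K0.tensor_ext fun M N => ?_) t
  exact K0.cls_congr (resOuter φ χ M.1 N.1)

/-- Reassociation is expressed as restriction along an algebra isomorphism, so it composes with the
other restrictions by `G0.res_res`. -/
theorem G0.res_assoc_kunneth (x : G0 B) (y : G0 C) (z : G0 D) :
    G0.res (Algebra.TensorProduct.assoc F F F B C D).toAlgHom
        (G0.kunneth F B (C ⊗[F] D) (x ⊗ₜ G0.kunneth F C D (y ⊗ₜ z))) =
      G0.kunneth F (B ⊗[F] C) D (G0.kunneth F B C (x ⊗ₜ y) ⊗ₜ z) := by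
  induction x using G0.induction_on with
  | add a a' h h' => simp only [TensorProduct.add_tmul, map_add, h, h']
  | neg a h => simp only [TensorProduct.neg_tmul, map_neg, h]
  | cls M =>
  induction y using G0.induction_on with
  | add a a' h h' => simp only [TensorProduct.add_tmul, TensorProduct.tmul_add, map_add, h, h']
  | neg a h => simp only [TensorProduct.neg_tmul, TensorProduct.tmul_neg, map_neg, h]
  | cls N =>
  induction z using G0.induction_on with
  | add a a' h h' => simp only [TensorProduct.tmul_add, map_add, h, h']
  | neg a h => simp only [TensorProduct.tmul_neg, map_neg, h]
  | cls L => exact G0.cls_congr (nonempty_resAssoc M N L).some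

theorem K0.res_assoc_kunneth (x : K0 B) (y : K0 C) (z : K0 D) :
    K0.res (Algebra.TensorProduct.assoc F F F B C D).toAlgHom (projective_of_equiv _)
        (K0.kunneth F B (C ⊗[F] D) (x ⊗ₜ K0.kunneth F C D (y ⊗ₜ z))) =
      K0.kunneth F (B ⊗[F] C) D (K0.kunneth F B C (x ⊗ₜ y) ⊗ₜ z) := by
  induction x using K0.induction_on with
  | add a a' h h' => simp only [TensorProduct.add_tmul, map_add, h, h']
  | neg a h => simp only [TensorProduct.neg_tmul, map_neg, h]
  | cls M =>
  induction y using K0.induction_on with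
  | add a a' h h' => simp only [TensorProduct.add_tmul, TensorProduct.tmul_add, map_add, h, h']
  | neg a h => simp only [TensorProduct.neg_tmul, TensorProduct.tmul_neg, map_neg, h]
  | cls N =>
  induction z using K0.induction_on with
  | add a a' h h' => simp only [TensorProduct.tmul_add, map_add, h, h']
  | neg a h => simp only [TensorProduct.tmul_neg, map_neg, h]
  | cls L => exact K0.cls_congr (nonempty_resAssoc M.1 N.1 L.1).some

theorem K0.res_tensorTensorTensorComm_kunneth (x : K0 B) (y : K0 C) (z : K0 B') (w : K0 C') :
    K0.res (Algebra.TensorProduct.tensorTensorTensorComm F F F F B B' C C').toAlgHom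
        (projective_of_equiv _) (K0.kunneth F (B ⊗[F] C) (B' ⊗[F] C')
          (K0.kunneth F B C (x ⊗ₜ y) ⊗ₜ K0.kunneth F B' C' (z ⊗ₜ w))) =
      K0.kunneth F (B ⊗[F] B') (C ⊗[F] C') (K0.kunneth F B B' (x ⊗ₜ z) ⊗ₜ
        K0.kunneth F C C' (y ⊗ₜ w)) := by
  induction x using K0.induction_on with
  | add a a' h h' => simp only [TensorProduct.add_tmul, map_add, h, h']
  | neg a h => simp only [TensorProduct.neg_tmul, map_neg, h]
  | cls M =>
  induction y using K0.induction_on with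
  | add a a' h h' => simp only [TensorProduct.add_tmul, TensorProduct.tmul_add, map_add, h, h']
  | neg a h => simp only [TensorProduct.neg_tmul, TensorProduct.tmul_neg, map_neg, h]
  | cls N =>
  induction z using K0.induction_on with
  | add a a' h h' => simp only [TensorProduct.add_tmul, TensorProduct.tmul_add, map_add, h, h']
  | neg a h => simp only [TensorProduct.neg_tmul, TensorProduct.tmul_neg, map_neg, h]
  | cls K =>
  induction w using K0.induction_on with
  | add a a' h h' => simp only [TensorProduct.tmul_add, map_add, h, h']
  | neg a h => simp only [TensorProduct.tmul_neg, map_neg, h]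
  | cls L => exact K0.cls_congr (nonempty_resTensorTensorTensorComm M.1 N.1 K.1 L.1).some

theorem pairing_res (φ : C →ₐ[F] B) (hφ : IsLeftProjective φ) (hs : Function.Surjective φ)
    (a : K0 B) (x : G0 B) : pairing F C (K0.res φ hφ a) (G0.res φ x) = pairing F B a x := by
  induction a using K0.induction_on with
  | add a a' h h' => simp only [map_add, AddMonoidHom.add_apply, h, h']
  | neg a h => simp only [map_neg, AddMonoidHom.neg_apply, h]
  | cls P =>
  induction x using G0.induction_on with
  | add a a' h h' => simp only [map_add, h, h']
  | neg a h => simp only [map_neg, h]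
  | cls M => exact congrArg Nat.cast (finrank_hom_res φ hs P.1 M)

theorem pairing_ind (φ : B →ₐ[F] C) (h₁ : IsExactFun (Ind φ.toRingHom).obj) (a : K0 B) (x : G0 C) :
    pairing F C (K0.map (Ind φ.toRingHom).obj h₁ (Ind_projective _) a) x =
      pairing F B a (G0.res φ x) := by
  induction a using K0.induction_on with
  | add a a' h h' => simp only [map_add, AddMonoidHom.add_apply, h, h']
  | neg a h => simp only [map_neg, AddMonoidHom.neg_apply, h]
  | cls P =>
  induction x using G0.induction_on with
  | add a a' h h' => simp only [map_add, h, h']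
  | neg a h => simp only [map_neg, h]
  | cls M => exact congrArg Nat.cast (finrank_hom_ind φ P.1 M)

end RestrictionMaps

/-! ### Adjoints of restrictions and outer tensor products -/

section PairingRestriction

variable {F : Type u} [Field F] {B C B' C' : Type u} [Ring B] [Algebra F B] [Module.Finite F B]
  [Ring C] [Algebra F C] [Module.Finite F C] [Ring B'] [Algebra F B'] [Module.Finite F B']
  [Ring C'] [Algebra F C'] [Module.Finite F C']

theorem pairing_kunneth_tmul (a : K0 B) (b : K0 C) (x : G0 B) (y : G0 C) :
    pairing F (B ⊗[F] C) (K0.kunneth F B C (a ⊗ₜ b)) (G0.kunneth F B C (x ⊗ₜ y)) =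
      pairing F B a x * pairing F C b y := by
  rw [pairing_kunneth, tensorFormTwo_tmul]
  rfl

/-- Left adjoints of restrictions on `K0` are compatible with outer tensor products. -/
theorem pairing_kunneth_left_adjoint (hB : Function.Bijective (pairing F B)) (φ : B' →ₐ[F] B)
    (χ : C' →ₐ[F] C) {f : K0 B' → K0 B} {g : K0 C' → K0 C}
    (hf : ∀ a x, pairing F B (f a) x = pairing F B' a (G0.res φ x))
    (hg : ∀ a x, pairing F C (g a) x = pairing F C' a (G0.res χ x)) (a : K0 B') (b : K0 C')
    (z : G0 (B ⊗[F] C)) :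
    pairing F (B ⊗[F] C) (K0.kunneth F B C (f a ⊗ₜ g b)) z =
      pairing F (B' ⊗[F] C') (K0.kunneth F B' C' (a ⊗ₜ b))
        (G0.res (Algebra.TensorProduct.map φ χ) z) := by
  -- By surjectivity of the Künneth map only pure tensors have to be tested, and there the form is a
  -- product.
  obtain ⟨t, rfl⟩ := G0.kunneth_surjective hB z
  rw [G0.res_kunneth]
  induction t with
  | zero => simp only [map_zero]
  | add s t hs ht => simp only [map_add, hs, ht]
  | tmul x y => rw [pairing_kunneth_tmul, TensorProduct.map_tmul, pairing_kunneth_tmul, hf, hg]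

/-- Right adjoints of restrictions on `G0` are compatible with outer tensor products. -/
theorem pairing_kunneth_right_adjoint (hB : Function.Bijective (pairing F B))
    (hC : Function.Bijective (pairing F C)) (φ : B' →ₐ[F] B) (hφ : IsLeftProjective φ)
    (χ : C' →ₐ[F] C) (hχ : IsLeftProjective χ) {f : G0 B' → G0 B} {g : G0 C' → G0 C}
    (hf : ∀ a x, pairing F B a (f x) = pairing F B' (K0.res φ hφ a) x)
    (hg : ∀ a x, pairing F C a (g x) = pairing F C' (K0.res χ hχ a) x) (x : G0 B') (y : G0 C')
    (c : K0 (B ⊗[F] C)) :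
    pairing F (B ⊗[F] C) c (G0.kunneth F B C (f x ⊗ₜ g y)) =
      pairing F (B' ⊗[F] C') (K0.res (Algebra.TensorProduct.map φ χ) (hφ.map hχ) c)
        (G0.kunneth F B' C' (x ⊗ₜ y)) := by
  obtain ⟨t, rfl⟩ := (K0.kunneth_bijective hB hC).2 c
  rw [K0.res_kunneth]
  induction t with
  | zero => simp only [map_zero, AddMonoidHom.zero_apply]
  | add s t hs ht => simp only [map_add, AddMonoidHom.add_apply, hs, ht]
  | tmul x y => rw [pairing_kunneth_tmul, TensorProduct.map_tmul, pairing_kunneth_tmul, hf, hg]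

end PairingRestriction

/-! ### Grothendieck groups of a one-dimensional algebra -/

section OneDimensional

variable {F : Type u} [Field F] {B : Type u} [Ring B] [Algebra F B]

/-- The regular module, as a projective module. -/
def regularProj (B : Type u) [Ring B] : FGProj B :=
  ⟨regular B, inferInstanceAs (Module.Projective B B)⟩

theorem finrank_regular (e : B ≃ₐ[F] F) : Module.finrank F (regular B) = 1 := by
  rw [← (toRegLin F B).finrank_eq, e.toLinearEquiv.finrank_eq, Module.finrank_self]

theorem finrank_hom_regular (M : FGModuleCat.{u} B) :
    Module.finrank F (regular B →ₗ[B] M) = Module.finrank F M :=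
  (LinearMap.ringLmapEquivSelf B F M).finrank_eq

variable [Module.Finite F B]

/-- The regular module is simple, and every simple module is a quotient of it, hence isomorphic to
it. Thus each composition factor contributes the same class. -/
theorem G0.exists_eq_smul_cls_regular (e : B ≃ₐ[F] F) (x : G0 B) :
    ∃ c : ℤ, x = c • G0.cls (regular B) := by
  have hart : IsArtinianRing B := IsArtinianRing.of_finite F B
  have hr : IsSimpleModule B (regular B) :=
    (isSimpleModule_iff B (regular B)).2
      (is_simple_module_of_finrank_eq_one (A := B) (finrank_regular e))
  have key : ∀ M : FGModuleCat.{u} B, ∃ c : ℤ, G0.cls M = c • G0.cls (regular B) := by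
    intro M
    induction M using fg_induction with
    | zero M hM => exact ⟨0, by rw [G0.cls_of_subsingleton, zero_smul]⟩
    | ext K M T i q hex hT ih =>
      obtain ⟨c, hc⟩ := ih
      have := IsSimpleModule.nontrivial B T
      obtain ⟨t, ht⟩ := exists_ne (0 : T)
      let f : regular B →ₗ[B] T := LinearMap.toSpanSingleton B T t
      have hf : f ≠ 0 := fun h => ht (by
        have h1 : f (toRegLin F B 1) = t := one_smul B t
        rw [← h1, h, LinearMap.zero_apply])
      refine ⟨c + 1, ?_⟩
      rw [G0.cls_eq hex, hc, add_smul, one_smul,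
        G0.cls_congr (LinearEquiv.ofBijective f (LinearMap.bijective_of_ne_zero hf))]
  induction x using G0.induction_on with
  | cls M => exact key M
  | add x y hx hy =>
    obtain ⟨c, rfl⟩ := hx
    obtain ⟨d, rfl⟩ := hy
    exact ⟨c + d, (add_smul _ _ _).symm⟩
  | neg x hx =>
    obtain ⟨c, rfl⟩ := hx
    exact ⟨-c, (neg_smul _ _).symm⟩

end OneDimensional

/-! ### The operations of a tower in components, and the two adjunctions -/

namespace AlgebraTower

variable {F : Type u} [Field F] (T : AlgebraTower F)

/-- The graded components of the operations on `𝒢(A)`. -/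
def componentsG : ComponentOps ℤ (fun n => G0 (T.alg n)) where
  mul {m n _} h := TensorProduct.curry
    ((G0.map (T.ind h).obj (Ind_exact _ (T.biprojective h))).toIntLinearMap ∘ₗ
      G0.kunneth F (T.alg m) (T.alg n))
  one := G0.cls (regular (T.alg 0))
  comul {m n _} h := linearInverse (G0.kunneth F (T.alg m) (T.alg n)) ∘ₗ G0.res (T.ρ h)
  counit := (G0.dim F (T.alg 0)).toIntLinearMap

/-- The graded components of the operations on `𝒦(A)`. -/
def componentsK : ComponentOps ℤ (fun n => K0 (T.alg n)) where
  mul {m n _} h := TensorProduct.curry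
    ((K0.map (T.ind h).obj (Ind_exact _ (T.biprojective h))
        (Ind_projective _)).toIntLinearMap ∘ₗ
      K0.kunneth F (T.alg m) (T.alg n))
  one := K0.cls (regularProj (T.alg 0))
  comul {m n _} h := linearInverse (K0.kunneth F (T.alg m) (T.alg n)) ∘ₗ
    K0.res (T.ρ h) (T.biprojective h).left
  counit := (K0.dim F (T.alg 0)).toIntLinearMap

/-- The components allow a general target degree; at `N = m + n` they are definitionally those of
the original operations. -/
theorem componentsK_ops : T.componentsK.ops = T.opsK := rfl

section

variable {m n N : ℕ} (h : m + n = N)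

/-- The map on `G0` induced by induction. -/
def indG : G0 (T.alg m ⊗[F] T.alg n) →+ G0 (T.alg N) :=
  G0.map (T.ind h).obj (Ind_exact _ (T.biprojective h))

/-- The map on `K0` induced by induction. -/
def indK : K0 (T.alg m ⊗[F] T.alg n) →+ K0 (T.alg N) :=
  K0.map (T.ind h).obj (Ind_exact _ (T.biprojective h)) (Ind_projective _)

theorem mulG_apply (x : G0 (T.alg m)) (y : G0 (T.alg n)) :
    T.componentsG.mul h x y = T.indG h (G0.kunneth F (T.alg m) (T.alg n) (x ⊗ₜ y)) := rfl

theorem mulK_apply (a : K0 (T.alg m)) (b : K0 (T.alg n)) :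
    T.componentsK.mul h a b = T.indK h (K0.kunneth F (T.alg m) (T.alg n) (a ⊗ₜ b)) := rfl

theorem kunneth_comulG (x : G0 (T.alg N)) :
    G0.kunneth F (T.alg m) (T.alg n) (T.componentsG.comul h x) = G0.res (T.ρ h) x :=
  linearInverse_apply (G0.kunneth_bijective (T.perfect m) (T.perfect n)) _

theorem kunneth_comulK (a : K0 (T.alg N)) :
    K0.kunneth F (T.alg m) (T.alg n) (T.componentsK.comul h a) =
      K0.res (T.ρ h) (T.biprojective h).left a :=
  linearInverse_apply (K0.kunneth_bijective (T.perfect m) (T.perfect n)) _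

theorem pairing_indK (z : K0 (T.alg m ⊗[F] T.alg n)) (x : G0 (T.alg N)) :
    pairing F (T.alg N) (T.indK h z) x =
      pairing F (T.alg m ⊗[F] T.alg n) z (G0.res (T.ρ h) x) :=
  pairing_ind (T.ρ h) (Ind_exact _ (T.biprojective h)) _ x

variable (ψ : ∀ n, T.alg n ≃ₐ[F] T.alg n)

theorem isLeftProjective_equiv {B C : Type u} [Ring B] [Algebra F B] [Ring C] [Algebra F C]
    (e : B ≃ₐ[F] C) : IsLeftProjective (e : B →ₐ[F] C) := projective_of_equiv e

/-- The map on `K0` induced by `(Ψ ⊗ Ψ) Δ Ψ⁻¹`. -/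
def conjResK : K0 (T.alg N) →ₗ[ℤ] K0 (T.alg m ⊗[F] T.alg n) :=
  K0.res (Algebra.TensorProduct.map ((ψ m).symm : T.alg m →ₐ[F] T.alg m)
      ((ψ n).symm : T.alg n →ₐ[F] T.alg n))
      (.map (isLeftProjective_equiv _) (isLeftProjective_equiv _)) ∘ₗ
    K0.res (T.ρ h) (T.biprojective h).left ∘ₗ
    K0.res (ψ N : T.alg N →ₐ[F] T.alg N) (isLeftProjective_equiv _)

theorem conjRes_projective (P : FGProj (T.alg N)) :
    Module.Projective (T.alg m ⊗[F] T.alg n) ((T.conjRes ψ h).obj P.1) :=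
  Res_projective _ (IsLeftProjective.map (isLeftProjective_equiv _) (isLeftProjective_equiv _))
    ⟨_, Res_projective _ (T.biprojective h).left ⟨_, Res_projective _
      (isLeftProjective_equiv (ψ N)) P⟩⟩

variable {T ψ}

/-- On classes of modules this compares dimensions in `Hom(conjRes P, M) ≅ Hom(P, Ind M)`. It is the
only use of the adjunction in the definition of a strong tower. -/
theorem IsStrong.pairing_indG (hT : T.IsStrong ψ) (a : K0 (T.alg N))
    (z : G0 (T.alg m ⊗[F] T.alg n)) :
    pairing F (T.alg N) a (T.indG h z) =
      pairing F (T.alg m ⊗[F] T.alg n) (T.conjResK h ψ a) z := by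
  induction a using K0.induction_on with
  | add a a' h h' => simp only [map_add, AddMonoidHom.add_apply, h, h']
  | neg a h => simp only [map_neg, AddMonoidHom.neg_apply, h]
  | cls P =>
  induction z using G0.induction_on with
  | add a a' h h' => simp only [map_add, h, h']
  | neg a h => simp only [map_neg, h]
  | cls M =>
    obtain ⟨adj⟩ := hT.adjoint h
    refine congrArg Nat.cast (finrank_hom_adjunction adj ?_ ?_ P.1 M).symm
    -- The adjunction lemma asks for linearity over `F`. All three restrictions are along
    -- `F`-algebra maps, so the scalar action is unchanged at each stage.
    · intro X Y r f
      ext x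
      have h1 := field_smul_toRes (ψ N : T.alg N →ₐ[F] T.alg N) Y r (f x)
      have h2 := field_smul_toRes (T.ρ h) _ r (toRes (ψ N : T.alg N →ₐ[F] T.alg N) Y (f x))
      have h3 := field_smul_toRes (Algebra.TensorProduct.map
        ((ψ m).symm : T.alg m →ₐ[F] T.alg m) ((ψ n).symm : T.alg n →ₐ[F] T.alg n)) _ r
        (toRes (T.ρ h) _ (toRes (ψ N : T.alg N →ₐ[F] T.alg N) Y (f x)))
      rw [h2, h1] at h3
      exact h3.symm
    · intro X Y f g
      rfl

end

end AlgebraTower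

/-! ### Forms on four tensor factors -/

section FourForms

/-- The form on four tensor factors is determined by additivity and its values on pure tensors. -/
theorem tensorFormTwo_unique {k V₁ V₂ V₃ V₄ W₁ W₂ W₃ W₄ : Type*} [CommRing k]
    [AddCommGroup V₁] [Module k V₁] [AddCommGroup V₂] [Module k V₂]
    [AddCommGroup V₃] [Module k V₃] [AddCommGroup V₄] [Module k V₄]
    [AddCommGroup W₁] [Module k W₁] [AddCommGroup W₂] [Module k W₂]
    [AddCommGroup W₃] [Module k W₃] [AddCommGroup W₄] [Module k W₄]
    (β₁ : V₁ →ₗ[k] W₁ →ₗ[k] k) (β₂ : V₂ →ₗ[k] W₂ →ₗ[k] k) (β₃ : V₃ →ₗ[k] W₃ →ₗ[k] k)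
    (β₄ : V₄ →ₗ[k] W₄ →ₗ[k] k)
    (Θ : V₁ ⊗[k] V₂ → V₃ ⊗[k] V₄ → W₁ ⊗[k] W₃ → W₂ ⊗[k] W₄ → k)
    (h₁ : ∀ s s' t u v, Θ (s + s') t u v = Θ s t u v + Θ s' t u v)
    (h₂ : ∀ s t t' u v, Θ s (t + t') u v = Θ s t u v + Θ s t' u v)
    (h₃ : ∀ s t u u' v, Θ s t (u + u') v = Θ s t u v + Θ s t u' v)
    (h₄ : ∀ s t u v v', Θ s t u (v + v') = Θ s t u v + Θ s t u v')
    (h : ∀ a b c d x y z w, Θ (a ⊗ₜ b) (c ⊗ₜ d) (x ⊗ₜ z) (y ⊗ₜ w) =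
      β₁ a x * β₂ b y * (β₃ c z * β₄ d w))
    (s : V₁ ⊗[k] V₂) (t : V₃ ⊗[k] V₄) (u : W₁ ⊗[k] W₃) (v : W₂ ⊗[k] W₄) :
    Θ s t u v = tensorFormTwo (tensorFormTwo β₁ β₃) (tensorFormTwo β₂ β₄)
      (TensorProduct.tensorTensorTensorComm k V₁ V₂ V₃ V₄ (s ⊗ₜ t)) (u ⊗ₜ v) := by
  have z₁ : ∀ t u v, Θ 0 t u v = 0 := fun t u v => by simpa using h₁ 0 0 t u v
  have z₂ : ∀ s u v, Θ s 0 u v = 0 := fun s u v => by simpa using h₂ s 0 0 u v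
  have z₃ : ∀ s t v, Θ s t 0 v = 0 := fun s t v => by simpa using h₃ s t 0 0 v
  have z₄ : ∀ s t u, Θ s t u 0 = 0 := fun s t u => by simpa using h₄ s t u 0 0
  induction s with
  | zero => simp [z₁]
  | add s s' hs hs' =>
    rw [h₁, hs, hs', TensorProduct.add_tmul, map_add, map_add, LinearMap.add_apply]
  | tmul a b =>
  induction t with
  | zero => simp [z₂]
  | add s s' hs hs' =>
    rw [h₂, hs, hs', TensorProduct.tmul_add, map_add, map_add, LinearMap.add_apply]
  | tmul c d =>
  induction u with
  | zero => simp [z₃]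
  | add s s' hs hs' => rw [h₃, hs, hs', TensorProduct.add_tmul, map_add]
  | tmul x z =>
  induction v with
  | zero => simp [z₄]
  | add s s' hs hs' => rw [h₄, hs, hs', TensorProduct.tmul_add, map_add]
  | tmul y w =>
    rw [h, TensorProduct.tensorTensorTensorComm_tmul, tensorFormTwo_tmul, tensorFormTwo_tmul,
      tensorFormTwo_tmul]
    ring

end FourForms

/-! ### Associativity and unit laws -/

namespace AlgebraTower

variable {F : Type u} [Field F] (T : AlgebraTower F)

section Associativity

variable {l m n lm mn N : ℕ} (h₁ : l + m = lm) (h₂ : lm + n = N) (h₃ : m + n = mn)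
  (h₄ : l + mn = N)

theorem ρ_comp_assoc :
    (T.ρ h₂).comp (Algebra.TensorProduct.map (T.ρ h₁) (AlgHom.id F (T.alg n))) =
      ((T.ρ h₄).comp (Algebra.TensorProduct.map (AlgHom.id F (T.alg l)) (T.ρ h₃))).comp
        (Algebra.TensorProduct.assoc F F F (T.alg l) (T.alg m) (T.alg n)).toAlgHom := by
  apply AlgHom.toLinearMap_injective
  refine TensorProduct.ext_threefold fun a b c => ?_
  exact T.ρ_assoc h₁ h₂ h₃ h₄ a b c

/-- Against a class `x`, both products turn into restriction of `x` to a threefold tensor product,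
once for each bracketing. These agree by `ρ_comp_assoc`, and reassociation does not change the
pairing. The identity factors are treated as restrictions along the identity. -/
theorem mulK_assoc (a : K0 (T.alg l)) (b : K0 (T.alg m)) (c : K0 (T.alg n)) :
    T.componentsK.mul h₂ (T.componentsK.mul h₁ a b) c =
      T.componentsK.mul h₄ a (T.componentsK.mul h₃ b c) := by
  have hid : ∀ (n : ℕ) (a : K0 (T.alg n)) (x : G0 (T.alg n)), pairing F (T.alg n) (id a) x =
      pairing F (T.alg n) a (G0.res (AlgHom.id F (T.alg n)) x) := fun n a x => by
    rw [G0.res_id]; rfl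
  refine pairing_injective F (AddMonoidHom.ext fun x => ?_)
  simp only [mulK_apply]
  rw [pairing_indK, pairing_indK]
  have e₁ := pairing_kunneth_left_adjoint (T.perfect lm) (T.ρ h₁) (AlgHom.id F (T.alg n))
    (T.pairing_indK h₁) (hid n) (K0.kunneth F _ _ (a ⊗ₜ b)) c (G0.res (T.ρ h₂) x)
  have e₂ := pairing_kunneth_left_adjoint (T.perfect l) (AlgHom.id F (T.alg l)) (T.ρ h₃)
    (hid l) (T.pairing_indK h₃) a (K0.kunneth F _ _ (b ⊗ₜ c)) (G0.res (T.ρ h₄) x)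
  rw [id] at e₁ e₂
  rw [e₁, e₂, G0.res_res, G0.res_res, T.ρ_comp_assoc h₁ h₂ h₃ h₄, ← G0.res_res,
    ← K0.res_assoc_kunneth, pairing_res _ _ (AlgEquiv.surjective _)]

end Associativity

variable {T} {ψ : ∀ n, T.alg n ≃ₐ[F] T.alg n}

variable (T ψ) in
/-- The maps on `K0` induced by `(Ψ ⊗ Ψ) Δ Ψ⁻¹` and by `Δ` agree. -/
def IsConjInvariant : Prop :=
  ∀ {m n N : ℕ} (h : m + n = N) (a : K0 (T.alg N)),
    T.conjResK h ψ a = K0.res (T.ρ h) (T.biprojective h).left a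

/-- Invariance enters the construction of the dual pair only through this formula: `∇` on `𝒢(A)` is
adjoint to `Δ` itself. -/
theorem IsStrong.pairing_indG_res (hT : T.IsStrong ψ) (hK : T.IsConjInvariant ψ) {m n N : ℕ}
    (h : m + n = N) (a : K0 (T.alg N)) (z : G0 (T.alg m ⊗[F] T.alg n)) :
    pairing F (T.alg N) a (T.indG h z) =
      pairing F (T.alg m ⊗[F] T.alg n) (K0.res (T.ρ h) (T.biprojective h).left a) z := by
  rw [hT.pairing_indG, hK]

/-- The mirror image of `mulK_assoc`, with projective classes as test elements. The right adjunction
is needed because the product now stands in the second argument of the form. -/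
theorem IsStrong.mulG_assoc (hT : T.IsStrong ψ) (hK : T.IsConjInvariant ψ)
    {l m n lm mn N : ℕ} (h₁ : l + m = lm) (h₂ : lm + n = N) (h₃ : m + n = mn)
    (h₄ : l + mn = N) (x : G0 (T.alg l)) (y : G0 (T.alg m)) (z : G0 (T.alg n)) :
    T.componentsG.mul h₂ (T.componentsG.mul h₁ x y) z =
      T.componentsG.mul h₄ x (T.componentsG.mul h₃ y z) := by
  have hid : ∀ (n : ℕ) (a : K0 (T.alg n)) (x : G0 (T.alg n)), pairing F (T.alg n) a (id x) =
      pairing F (T.alg n) (K0.res (AlgHom.id F (T.alg n)) .id a) x := fun n a x => by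
    rw [K0.res_id]; rfl
  refine (pairing_hasDualBases (T.perfect N)).ext_right fun a => ?_
  change pairing F (T.alg N) a _ = pairing F (T.alg N) a _
  simp only [mulG_apply]
  rw [hT.pairing_indG_res hK, hT.pairing_indG_res hK]
  have e₁ := pairing_kunneth_right_adjoint (T.perfect lm) (T.perfect n) (T.ρ h₁)
    (T.biprojective h₁).left (AlgHom.id F (T.alg n)) .id
    (hT.pairing_indG_res hK h₁) (hid n) (G0.kunneth F _ _ (x ⊗ₜ y)) z
    (K0.res (T.ρ h₂) (T.biprojective h₂).left a)
  have e₂ := pairing_kunneth_right_adjoint (T.perfect l) (T.perfect mn) (AlgHom.id F (T.alg l))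
    .id (T.ρ h₃) (T.biprojective h₃).left
    (hid l) (hT.pairing_indG_res hK h₃) x (G0.kunneth F _ _ (y ⊗ₜ z))
    (K0.res (T.ρ h₄) (T.biprojective h₄).left a)
  rw [id] at e₁ e₂
  rw [e₁, e₂, K0.res_res, K0.res_res]
  simp only [T.ρ_comp_assoc h₁ h₂ h₃ h₄]
  rw [← G0.res_assoc_kunneth, ← K0.res_res _ (IsLeftProjective.comp (T.biprojective h₄).left
    (.map .id (T.biprojective h₃).left)) _ (isLeftProjective_equiv _), pairing_res _ _ (AlgEquiv.surjective _)]

section Unit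

/-- Because `A_0 ≅ F`, the unit of the graded algebra and the unit of `A_0` coincide, so multiplying
by degree `0` is multiplying by scalars. -/
theorem exists_augmentation (T : AlgebraTower F) :
    ∃ χ : T.alg 0 ≃ₐ[F] F, ∀ (n : ℕ) (b : T.alg 0) (a : T.alg n),
    T.ρ (zero_add n) (b ⊗ₜ a) = χ b • a ∧ T.ρ (add_zero n) (a ⊗ₜ b) = χ b • a := by
  obtain ⟨χ⟩ := T.alg_zero
  obtain ⟨e, he⟩ := T.ρ_unit
  have hχ : ∀ b, b = χ b • (1 : T.alg 0) := fun b => χ.injective (by simp)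
  -- The product `ρ (e ⊗ 1)` is `1` by the unit law, and `χ e • 1 = e` because `ρ` is a unital
  -- algebra homomorphism.
  have h1 : e = 1 := by
    have h := (he 0 1).1
    rw [hχ e, ← TensorProduct.smul_tmul', map_smul, ← Algebra.TensorProduct.one_def, map_one,
      ← hχ e] at h
    exact h
  subst h1
  refine ⟨χ, fun n b a => ⟨?_, ?_⟩⟩
  · conv_lhs => rw [hχ b]
    rw [← TensorProduct.smul_tmul', map_smul, (he n a).1]
  · conv_lhs => rw [hχ b]
    rw [TensorProduct.tmul_smul, map_smul, (he n a).2]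

theorem nonempty_res_zero_add (T : AlgebraTower F) (n : ℕ) (M : FGModuleCat.{u} (T.alg n)) :
    Nonempty ((Res (T.ρ (zero_add n))).obj M ≃ₗ[T.alg 0 ⊗[F] T.alg n]
      outer (F := F) (regular (T.alg 0)) M) := by
  obtain ⟨χ, hχ⟩ := T.exists_augmentation
  obtain ⟨e, he⟩ : ∃ e : M ≃+ outer (F := F) (regular (T.alg 0)) M,
      ∀ b x, e (χ b • x) = toOuter _ _ (toRegLin F (T.alg 0) b ⊗ₜ x) :=
    ⟨((TensorProduct.lid F M).symm ≪≫ₗ TensorProduct.congr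
      (χ.symm.toLinearEquiv ≪≫ₗ toRegLin F (T.alg 0)) (LinearEquiv.refl F M)).toAddEquiv.trans
        (toOuter _ _), fun b x => by
      change toOuter _ _ (toRegLin F (T.alg 0) (χ.symm 1) ⊗ₜ (χ b • x)) = _
      rw [← TensorProduct.smul_tmul, ← map_smul, ← map_smul, smul_eq_mul, mul_one,
        AlgEquiv.symm_apply_apply]⟩
  refine ⟨resEquiv _ e fun r x => ?_⟩
  induction r with
  | zero => simp
  | add p q hp hq => simp only [map_add, add_smul, hp, hq]
  | tmul b a =>
    have h1 := he 1 x
    rw [map_one, one_smul] at h1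
    rw [(hχ n b a).1, smul_assoc, he, h1, smul_toOuter_tmul, ← mul_toRegLin, mul_one]

theorem nonempty_res_add_zero (T : AlgebraTower F) (n : ℕ) (M : FGModuleCat.{u} (T.alg n)) :
    Nonempty ((Res (T.ρ (add_zero n))).obj M ≃ₗ[T.alg n ⊗[F] T.alg 0]
      outer (F := F) M (regular (T.alg 0))) := by
  obtain ⟨χ, hχ⟩ := T.exists_augmentation
  obtain ⟨e, he⟩ : ∃ e : M ≃+ outer (F := F) M (regular (T.alg 0)),
      ∀ b x, e (χ b • x) = toOuter _ _ (x ⊗ₜ toRegLin F (T.alg 0) b) :=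
    ⟨((TensorProduct.rid F M).symm ≪≫ₗ TensorProduct.congr (LinearEquiv.refl F M)
      (χ.symm.toLinearEquiv ≪≫ₗ toRegLin F (T.alg 0))).toAddEquiv.trans
        (toOuter _ _), fun b x => by
      change toOuter _ _ ((χ b • x) ⊗ₜ toRegLin F (T.alg 0) (χ.symm 1)) = _
      rw [TensorProduct.smul_tmul, ← map_smul, ← map_smul, smul_eq_mul, mul_one,
        AlgEquiv.symm_apply_apply]⟩
  refine ⟨resEquiv _ e fun r x => ?_⟩
  induction r with
  | zero => simp
  | add p q hp hq => simp only [map_add, add_smul, hp, hq]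
  | tmul a b =>
    have h1 := he 1 x
    rw [map_one, one_smul] at h1
    rw [(hχ n b a).2, smul_assoc, he, h1, smul_toOuter_tmul, ← mul_toRegLin, mul_one]

/-- The components of `Δ` with a factor of degree `0` are dual to multiplication by the unit; they
yield the unit laws on the other side of the form. -/
theorem comulG_zero_add (T : AlgebraTower F) {n : ℕ} (x : G0 (T.alg n)) :
    T.componentsG.comul (zero_add n) x = T.componentsG.one ⊗ₜ x := by
  apply (G0.kunneth_bijective (T.perfect 0) (T.perfect n)).1
  rw [kunneth_comulG]
  induction x using G0.induction_on with
  | add a a' h h' => simp only [TensorProduct.tmul_add, map_add, h, h']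
  | neg a h => simp only [TensorProduct.tmul_neg, map_neg, h]
  | cls M => exact G0.cls_congr (T.nonempty_res_zero_add n M).some

theorem comulG_add_zero (T : AlgebraTower F) {n : ℕ} (x : G0 (T.alg n)) :
    T.componentsG.comul (add_zero n) x = x ⊗ₜ T.componentsG.one := by
  apply (G0.kunneth_bijective (T.perfect n) (T.perfect 0)).1
  rw [kunneth_comulG]
  induction x using G0.induction_on with
  | add a a' h h' => simp only [TensorProduct.add_tmul, map_add, h, h']
  | neg a h => simp only [TensorProduct.neg_tmul, map_neg, h]
  | cls M => exact G0.cls_congr (T.nonempty_res_add_zero n M).some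

theorem comulK_zero_add (T : AlgebraTower F) {n : ℕ} (x : K0 (T.alg n)) :
    T.componentsK.comul (zero_add n) x = T.componentsK.one ⊗ₜ x := by
  apply (K0.kunneth_bijective (T.perfect 0) (T.perfect n)).1
  rw [kunneth_comulK]
  induction x using K0.induction_on with
  | add a a' h h' => simp only [TensorProduct.tmul_add, map_add, h, h']
  | neg a h => simp only [TensorProduct.tmul_neg, map_neg, h]
  | cls M => exact K0.cls_congr (T.nonempty_res_zero_add n M.1).some

theorem comulK_add_zero (T : AlgebraTower F) {n : ℕ} (x : K0 (T.alg n)) :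
    T.componentsK.comul (add_zero n) x = x ⊗ₜ T.componentsK.one := by
  apply (K0.kunneth_bijective (T.perfect n) (T.perfect 0)).1
  rw [kunneth_comulK]
  induction x using K0.induction_on with
  | add a a' h h' => simp only [TensorProduct.add_tmul, map_add, h, h']
  | neg a h => simp only [TensorProduct.neg_tmul, map_neg, h]
  | cls M => exact K0.cls_congr (T.nonempty_res_add_zero n M.1).some

end Unit

end AlgebraTower

/-! ### The Mackey isomorphism under the pairing -/

namespace AlgebraTower

section Mackey

variable {F : Type u} [Field F] {T : AlgebraTower F} {ψ : ∀ n, T.alg n ≃ₐ[F] T.alg n}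

theorem mackeyMap_projective {m n i j : ℕ} (p : MackeyIndex m n i j) :
    IsLeftProjective (Algebra.TensorProduct.map (T.ρ p.hm) (T.ρ p.hn)) :=
  .map (T.biprojective p.hm).left (T.biprojective p.hn).left

/-- The isomorphism of functors is evaluated at a projective module. Hom out of the finite direct
sum gives the sum, and each induction is moved across the form as a restriction. -/
theorem IsStrong.pairing_res_indK (hT : T.IsStrong ψ) {m n i j N : ℕ} (h : m + n = N)
    (h' : i + j = N) (z : K0 (T.alg m ⊗[F] T.alg n)) (w : G0 (T.alg i ⊗[F] T.alg j)) :
    pairing F (T.alg i ⊗[F] T.alg j) (K0.res (T.ρ h') (T.biprojective h').left (T.indK h z)) w =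
      ∑ p : MackeyIndex m n i j, pairing F _
        (K0.res (Algebra.TensorProduct.tensorTensorTensorComm F F F F (T.alg p.r) (T.alg p.t)
            (T.alg p.s) (T.alg p.q)).toAlgHom (isLeftProjective_equiv _)
          (K0.res (Algebra.TensorProduct.map (T.ρ p.hm) (T.ρ p.hn)) (mackeyMap_projective p) z))
        (G0.res (Algebra.TensorProduct.map (T.ρ p.hk) (T.ρ p.hl)) w) := by
  induction z using K0.induction_on with
  | add a a' h h' => simp only [map_add, AddMonoidHom.add_apply, h, h', Finset.sum_add_distrib]
  | neg a h => simp only [map_neg, AddMonoidHom.neg_apply, h, Finset.sum_neg_distrib]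
  | cls P =>
  induction w using G0.induction_on with
  | add a a' h h' => simp only [map_add, h, h', Finset.sum_add_distrib]
  | neg a h => simp only [map_neg, h, Finset.sum_neg_distrib]
  | cls M =>
    obtain ⟨e⟩ := hT.mackey h h'
    let X : MackeyIndex m n i j → FGModuleCat.{u} (T.alg i ⊗[F] T.alg j) := fun p =>
      (T.resTwo p ⋙ T.swapTwoThree p ⋙ T.indTwo p).obj P.1
    have e' : (T.res h').obj ((T.ind h).obj P.1) ≃ₗ[T.alg i ⊗[F] T.alg j] (∀ p, X p) :=
      FGModuleCat.isoToLinearEquiv (e.app P.1)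
    have h1 := (finrank_hom_congr (F := F) e' M).trans (finrank_hom_pi X M)
    have h2 : ∀ p, Module.finrank F (X p →ₗ[T.alg i ⊗[F] T.alg j] M) = Module.finrank F
        ((T.swapTwoThree p).obj ((T.resTwo p).obj P.1) →ₗ[_]
          (Res (Algebra.TensorProduct.map (T.ρ p.hk) (T.ρ p.hl))).obj M) := fun p =>
      finrank_hom_ind (Algebra.TensorProduct.map (T.ρ p.hk) (T.ρ p.hl))
        ((T.swapTwoThree p).obj ((T.resTwo p).obj P.1)) M
    rw [Finset.sum_congr rfl fun p _ => h2 p] at h1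
    refine (congrArg Nat.cast h1).trans ?_
    rw [Nat.cast_sum]
    rfl

/-- The right-hand product crosses the form and becomes `Δ` applied to `ab`, which is an instance of
`Δ∇`. -/
theorem IsStrong.mackey_pairing (hT : T.IsStrong ψ) (hK : T.IsConjInvariant ψ) {m n i j N : ℕ}
    (h : m + n = N) (h' : i + j = N) (a : K0 (T.alg m)) (b : K0 (T.alg n)) (x : G0 (T.alg i))
    (y : G0 (T.alg j)) :
    pairing F (T.alg N) (T.componentsK.mul h a b) (T.componentsG.mul h' x y) =
      ∑ p : MackeyIndex m n i j, pairing F _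
        (K0.res (Algebra.TensorProduct.tensorTensorTensorComm F F F F (T.alg p.r) (T.alg p.t)
            (T.alg p.s) (T.alg p.q)).toAlgHom (isLeftProjective_equiv _)
          (K0.kunneth F _ _ (K0.kunneth F _ _ (T.componentsK.comul p.hm a) ⊗ₜ
            K0.kunneth F _ _ (T.componentsK.comul p.hn b))))
        (G0.kunneth F _ _ (G0.kunneth F _ _ (T.componentsG.comul p.hk x) ⊗ₜ
          G0.kunneth F _ _ (T.componentsG.comul p.hl y))) := by
  rw [mulG_apply, mulK_apply, hT.pairing_indG_res hK, hT.pairing_res_indK]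
  refine Finset.sum_congr rfl fun p _ => ?_
  rw [K0.res_kunneth _ (T.biprojective p.hm).left _ (T.biprojective p.hn).left, G0.res_kunneth,
    TensorProduct.map_tmul, TensorProduct.map_tmul, kunneth_comulG, kunneth_comulG,
    kunneth_comulK, kunneth_comulK]

end Mackey

/-! ### Invariance implies that the tower is dualizing -/

section Dualizing

variable {F : Type u} [Field F] {T : AlgebraTower F} {ψ : ∀ n, T.alg n ≃ₐ[F] T.alg n}

theorem pairing_one (T : AlgebraTower F) : pairing F (T.alg 0) T.componentsK.one T.componentsG.one = 1 := by
  obtain ⟨χ⟩ := T.alg_zero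
  refine (congrArg Nat.cast ((finrank_hom_regular _).trans (finrank_regular χ))).trans ?_
  exact Nat.cast_one

theorem exists_eq_smul_oneG (T : AlgebraTower F) (x : G0 (T.alg 0)) :
    ∃ c : ℤ, x = c • T.componentsG.one :=
  G0.exists_eq_smul_cls_regular T.alg_zero.some x

/-- The coefficient is the pairing with the regular class, which generates `G0 (A_0)`. -/
theorem exists_eq_smul_oneK (T : AlgebraTower F) (a : K0 (T.alg 0)) :
    ∃ c : ℤ, a = c • T.componentsK.one := by
  refine ⟨pairing F (T.alg 0) a T.componentsG.one, pairing_injective F (AddMonoidHom.ext fun x => ?_)⟩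
  obtain ⟨c, rfl⟩ := T.exists_eq_smul_oneG x
  rw [map_zsmul, map_zsmul, map_zsmul, AddMonoidHom.smul_apply, T.pairing_one, smul_eq_mul,
    smul_eq_mul, smul_eq_mul, mul_one, mul_comm]

theorem pairing_one_left (T : AlgebraTower F) (x : G0 (T.alg 0)) :
    pairing F (T.alg 0) T.componentsK.one x = T.componentsG.counit x := by
  obtain ⟨c, rfl⟩ := T.exists_eq_smul_oneG x
  have h : T.componentsG.counit T.componentsG.one = 1 :=
    (congrArg Nat.cast (finrank_regular T.alg_zero.some)).trans Nat.cast_one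
  rw [map_zsmul, T.pairing_one, map_zsmul, h]

theorem pairing_one_right (T : AlgebraTower F) (a : K0 (T.alg 0)) :
    pairing F (T.alg 0) a T.componentsG.one = T.componentsK.counit a := by
  obtain ⟨c, rfl⟩ := T.exists_eq_smul_oneK a
  have h : T.componentsK.counit T.componentsK.one = 1 :=
    (congrArg Nat.cast (finrank_regular T.alg_zero.some)).trans Nat.cast_one
  rw [map_zsmul, AddMonoidHom.smul_apply, T.pairing_one, map_zsmul, h]

/-- Collects the hypotheses of `ComponentOps.isDualPair`: two adjunctions, associativity and units
on both sides, and the Mackey identity in components. -/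
theorem IsStrong.isDualizing (hT : T.IsStrong ψ) (hK : T.IsConjInvariant ψ) : T.IsDualizing := by
  have hG := fun n => G0.free_finite F (T.alg n)
  have hKf := fun n => K0.free_finite (T.perfect n)
  have := fun n => (hG n).1
  have := fun n => (hG n).2
  have := fun n => (hKf n).1
  have := fun n => (hKf n).2
  have ext_right : ∀ {n : ℕ} {x y : G0 (T.alg n)},
      (∀ a, pairing F (T.alg n) a x = pairing F (T.alg n) a y) → x = y := fun h =>
    (pairing_hasDualBases (T.perfect _)).ext_right h
  have ext_left : ∀ {n : ℕ} {a b : K0 (T.alg n)},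
      (∀ x, pairing F (T.alg n) a x = pairing F (T.alg n) b x) → a = b := fun h =>
    (pairing_hasDualBases (T.perfect _)).ext_left h
  have adj : ∀ {m n N : ℕ} (h : m + n = N) a b x,
      pairing F (T.alg N) (T.componentsK.mul h a b) x =
        tensorFormTwo (intBilin (pairing F (T.alg m))) (intBilin (pairing F (T.alg n))) (a ⊗ₜ b)
          (T.componentsG.comul h x) := fun h a b x => by
    rw [mulK_apply, pairing_indK, ← kunneth_comulG, pairing_kunneth]
  have adj' : ∀ {m n N : ℕ} (h : m + n = N) a x y,
      pairing F (T.alg N) a (T.componentsG.mul h x y) =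
        tensorFormTwo (intBilin (pairing F (T.alg m))) (intBilin (pairing F (T.alg n)))
          (T.componentsK.comul h a) (x ⊗ₜ y) := fun h a x y => by
    rw [mulG_apply, hT.pairing_indG_res hK, ← kunneth_comulK, pairing_kunneth]
  have h1 : intBilin (pairing F (T.alg 0)) T.componentsK.one T.componentsG.one = 1 := T.pairing_one
  exact ComponentOps.isDualPair (fun n => intBilin (pairing F (T.alg n))) T.componentsG
    T.componentsK (fun n => pairing_hasDualBases (T.perfect n))
    (fun n => pairing_isPerfPair (T.perfect n)) adj adj' T.pairing_one_left T.pairing_one_right h1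
    T.exists_eq_smul_oneG T.exists_eq_smul_oneK (hT.mulG_assoc hK) T.mulK_assoc
    -- The four unit laws: each is tested through the form, where the coproduct on the other side
    -- splits off the unit class, and `⟨1, 1⟩ = 1`.
    (fun x => ext_right fun a => by
      rw [adj', comulK_zero_add, tensorFormTwo_tmul, h1, one_mul]; rfl)
    (fun x => ext_right fun a => by
      rw [adj', comulK_add_zero, tensorFormTwo_tmul, h1, mul_one]; rfl)
    (fun a => ext_left fun x => by
      rw [adj, comulG_zero_add, tensorFormTwo_tmul, h1, one_mul]; rfl)
    (fun a => ext_left fun x => by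
      rw [adj, comulG_add_zero, tensorFormTwo_tmul, h1, mul_one]; rfl)
    (T.comulG_zero_add _) (T.comulK_zero_add _)
    (fun {m n i j N} h h' a b x y => by
      refine (hT.mackey_pairing hK h h' a b x y).trans (Finset.sum_congr rfl fun p _ => ?_)
      -- The summand is additive in each of the four coproducts, so it suffices to compare with the
      -- product form on pure tensors.
      refine tensorFormTwo_unique _ _ _ _ (fun s t u v => pairing F _ (K0.res
        (Algebra.TensorProduct.tensorTensorTensorComm F F F F (T.alg p.r)
          (T.alg p.t) (T.alg p.s) (T.alg p.q)).toAlgHom (isLeftProjective_equiv _)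
          (K0.kunneth F _ _ (K0.kunneth F _ _ s ⊗ₜ K0.kunneth F _ _ t)))
        (G0.kunneth F _ _ (G0.kunneth F _ _ u ⊗ₜ G0.kunneth F _ _ v))) ?_ ?_ ?_ ?_ ?_ _ _ _ _
      · intros; simp only [map_add, TensorProduct.add_tmul, AddMonoidHom.add_apply]
      · intros; simp only [map_add, TensorProduct.tmul_add, AddMonoidHom.add_apply]
      · intros; simp only [map_add, TensorProduct.add_tmul]
      · intros; simp only [map_add, TensorProduct.tmul_add]
      · intro a b c d x y z w
        rw [K0.res_tensorTensorTensorComm_kunneth, pairing_kunneth_tmul, pairing_kunneth_tmul,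
          pairing_kunneth_tmul]
        change _ = pairing F _ a x * pairing F _ b y * (pairing F _ c z * pairing F _ d w)
        ring)

end Dualizing

end AlgebraTower

/-! ### Recovering components from assembled operations -/

section ComponentUniqueness

universe v w

open DirectSum

/-- Projection to the factors of degrees `m` and `n` recovers the component of the coproduct in that
bidegree. -/
theorem ComponentOps.comul_eq_iff {k : Type v} [CommRing k] {H : ℕ → Type w}
    [∀ n, AddCommGroup (H n)] [∀ n, Module k (H n)] (G G' : ComponentOps k H) :
    G.ops.comul = G'.ops.comul ↔
      ∀ {m n N : ℕ} (h : m + n = N) (x : H N), G.comul h x = G'.comul h x := by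
  have key : ∀ (G : ComponentOps k H) {m n N : ℕ} (h : m + n = N) (x : H N),
      TensorProduct.map (component k ℕ H m) (component k ℕ H n) (G.ops.comul (lof k ℕ H N x)) =
        G.comul h x := by
    intro G m n N h x
    rw [G.ops_comul_lof, map_sum,
      Finset.sum_eq_single ⟨(m, n), Finset.HasAntidiagonal.mem_antidiagonal.2 h⟩]
    · rw [← LinearMap.comp_apply, ← TensorProduct.map_comp]
      have hc : ∀ i, component k ℕ H i ∘ₗ lof k ℕ H i = LinearMap.id := fun i =>
        LinearMap.ext fun y => component.lof_self k i y
      simp only [hc, TensorProduct.map_id, LinearMap.id_apply]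
    · rintro ⟨⟨i, j⟩, hij⟩ - hne
      rw [← LinearMap.comp_apply, ← TensorProduct.map_comp]
      have hij' := Finset.HasAntidiagonal.mem_antidiagonal.1 hij
      have hi : i ≠ m := by
        rintro rfl
        exact hne (Subtype.ext (Prod.ext rfl (by dsimp at hij' ⊢; omega)))
      have h0 : component k ℕ H m ∘ₗ lof k ℕ H i = 0 := LinearMap.ext fun y => by
        rw [LinearMap.comp_apply, component.of, dif_neg hi, LinearMap.zero_apply]
      rw [h0, TensorProduct.map_zero_left, LinearMap.zero_apply]
    · intro hn; exact absurd (Finset.mem_univ _) hn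
  constructor
  · intro e m n N h x
    rw [← key G, ← key G', e]
  · intro e
    refine DirectSum.linearMap_ext k fun N => LinearMap.ext fun x => ?_
    rw [LinearMap.comp_apply, LinearMap.comp_apply, G.ops_comul_lof, G'.ops_comul_lof]
    simp only [e]

/-- The operations with conjugated comultiplication. -/
def ComponentOps.conj {k : Type v} [CommRing k] {H : ℕ → Type w}
    [∀ n, AddCommGroup (H n)] [∀ n, Module k (H n)] (G : ComponentOps k H)
    (f g : ∀ n, H n →ₗ[k] H n) : ComponentOps k H where
  mul := G.mul
  one := G.one
  comul {m n N} h := TensorProduct.map (f m) (f n) ∘ₗ G.comul h ∘ₗ g N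
  counit := G.counit

theorem ComponentOps.conj_comul {k : Type v} [CommRing k] {H : ℕ → Type w}
    [∀ n, AddCommGroup (H n)] [∀ n, Module k (H n)] (G : ComponentOps k H)
    (f g : ∀ n, H n →ₗ[k] H n) {m n N : ℕ} (h : m + n = N) (x : H N) :
    (G.conj f g).comul h x = TensorProduct.map (f m) (f n) (G.comul h (g N x)) := rfl

theorem ComponentOps.conj_comul_id {k : Type v} [CommRing k] {H : ℕ → Type w}
    [∀ n, AddCommGroup (H n)] [∀ n, Module k (H n)] (G : ComponentOps k H)
    {f g : ∀ n, H n →ₗ[k] H n} (hf : ∀ n, f n = LinearMap.id) (hg : ∀ n, g n = LinearMap.id)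
    {m n N : ℕ} (h : m + n = N) (x : H N) :
    (G.conj f g).comul h x = G.comul h x := by
  rw [ComponentOps.conj_comul, hf, hf, hg, TensorProduct.map_id]
  rfl

/-- Conjugation of a comultiplication, in terms of graded components. -/
theorem ComponentOps.conjComul_ops {k : Type v} [CommRing k] {H : ℕ → Type w}
    [∀ n, AddCommGroup (H n)] [∀ n, Module k (H n)] (G : ComponentOps k H)
    (f g : ∀ n, H n →ₗ[k] H n) :
    conjComul G.ops (assembleEnd f) (assembleEnd g) = (G.conj f g).ops.comul := by
  refine DirectSum.linearMap_ext k fun N => LinearMap.ext fun x => ?_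
  have hl : ∀ (f : ∀ n, H n →ₗ[k] H n) n, assembleEnd f ∘ₗ lof k ℕ H n = lof k ℕ H n ∘ₗ f n :=
    fun f n => LinearMap.ext fun x => DirectSum.lmap_lof _ _ _
  have hg : assembleEnd g (lof k ℕ H N x) = lof k ℕ H N (g N x) := LinearMap.congr_fun (hl g N) x
  rw [LinearMap.comp_apply, LinearMap.comp_apply, ComponentOps.ops_comul_lof, conjComul,
    LinearMap.comp_apply, LinearMap.comp_apply, hg, ComponentOps.ops_comul_lof, map_sum]
  refine Finset.sum_congr rfl fun p _ => ?_
  rw [← LinearMap.comp_apply, ← TensorProduct.map_comp, hl, hl, TensorProduct.map_comp]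
  rfl

/-- A Hopf pairing evaluated on homogeneous elements. This extracts from a dualizing tower the
adjointness that is compared with the twisted one. -/
theorem ComponentOps.component_mul_right {k : Type v} [CommRing k] {H H' : ℕ → Type w}
    [∀ n, AddCommGroup (H n)] [∀ n, Module k (H n)] [∀ n, AddCommGroup (H' n)]
    [∀ n, Module k (H' n)] (β : ∀ n, H' n →ₗ[k] H n →ₗ[k] k) (G : ComponentOps k H)
    (G' : ComponentOps k H') (hp : IsHopfPairing G'.ops G.ops (assembleForm β)) {m n N : ℕ}
    (h : m + n = N) (a : H' N) (x : H m) (y : H n) :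
    β N a (G.mul h x y) = tensorFormTwo (β m) (β n) (G'.comul h a) (x ⊗ₜ y) := by
  have h1 := hp.mul_right (lof k ℕ H' N a) (lof k ℕ H m x) (lof k ℕ H n y)
  rw [ComponentOps.ops_mul_lof G h, assembleForm_lof, ComponentOps.ops_comul_lof,
    ← TensorProduct.map_tmul, map_sum, LinearMap.sum_apply, Finset.sum_eq_single
    ⟨(m, n), Finset.HasAntidiagonal.mem_antidiagonal.2 h⟩, tensorForm_assembleForm_map] at h1
  · exact h1
  · rintro ⟨⟨i, j⟩, hij⟩ - hne
    refine tensorForm_assembleForm_map_of_ne β ?_ _ _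
    rintro ⟨rfl, rfl⟩
    exact hne rfl
  · intro hn; exact absurd (Finset.mem_univ _) hn

theorem assembleEnd_eq_id {k : Type v} [CommRing k] {H : ℕ → Type w}
    [∀ n, AddCommGroup (H n)] [∀ n, Module k (H n)] {f : ∀ n, H n →ₗ[k] H n}
    (h : assembleEnd f = LinearMap.id) (n : ℕ) (x : H n) : f n x = x := by
  have h1 := LinearMap.congr_fun h (lof k ℕ H n x)
  rw [assembleEnd, DirectSum.lmap_lof] at h1
  exact DirectSum.of_injective n h1

theorem nonempty_iso_of_equiv {R : Type u} [Ring R] {X Y : FGModuleCat.{u} R} (e : X ≃ₗ[R] Y) :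
    Nonempty (X ≅ Y) :=
  ⟨LinearEquiv.toFGModuleCatIso e⟩

/-- The projectivity proof depends on the homomorphism, so replacing the homomorphism needs its own
lemma. -/
theorem K0.res_congr {F : Type u} [Field F] {B C : Type u} [Ring B] [Algebra F B]
    [Module.Finite F B] [Ring C] [Algebra F C] {φ φ' : C →ₐ[F] B} (h : φ = φ')
    (hφ : IsLeftProjective φ) (hφ' : IsLeftProjective φ') : K0.res φ hφ = K0.res φ' hφ' := by
  subst h; rfl

end ComponentUniqueness

/-! ### Equivalent forms of invariance and sufficient conditions -/

namespace AlgebraTower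

variable {F : Type u} [Field F] {T : AlgebraTower F} {ψ : ∀ n, T.alg n ≃ₐ[F] T.alg n}

variable (T ψ) in
/-- The operations on `𝒦(A)` with comultiplication `(Ψ ⊗ Ψ) Δ Ψ⁻¹`. -/
def conjComponents : ComponentOps ℤ (fun n => K0 (T.alg n)) :=
  T.componentsK.conj
    (fun n => K0.res ((ψ n).symm : T.alg n →ₐ[F] T.alg n) (isLeftProjective_equiv _))
    (fun n => K0.res (ψ n : T.alg n →ₐ[F] T.alg n) (isLeftProjective_equiv _))

theorem kunneth_conjComponents {m n N : ℕ} (h : m + n = N) (a : K0 (T.alg N)) :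
    K0.kunneth F (T.alg m) (T.alg n) ((T.conjComponents ψ).comul h a) = T.conjResK h ψ a := by
  rw [conjComponents, ComponentOps.conj_comul, conjResK, LinearMap.comp_apply,
    LinearMap.comp_apply, ← T.kunneth_comulK, K0.res_kunneth]

theorem isConjInvariant_iff_conjComponents : T.IsConjInvariant ψ ↔
    ∀ {m n N : ℕ} (h : m + n = N) (a : K0 (T.alg N)),
      (T.conjComponents ψ).comul h a = T.componentsK.comul h a := by
  constructor
  · intro hK m n N h a
    apply (K0.kunneth_bijective (T.perfect m) (T.perfect n)).1
    rw [kunneth_conjComponents, kunneth_comulK, hK]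
  · intro hK m n N h a
    rw [← kunneth_conjComponents, hK, kunneth_comulK]

theorem isConjInvariant_iff_conjComulK :
    T.IsConjInvariant ψ ↔ T.conjComulK ψ = T.opsK.comul := by
  have e : T.conjComulK ψ = (T.conjComponents ψ).ops.comul :=
    ComponentOps.conjComul_ops T.componentsK _ _
  rw [e, ← componentsK_ops, ComponentOps.comul_eq_iff, isConjInvariant_iff_conjComponents]

/-- Isomorphic projectives have equal classes; conversely equal classes give isomorphic projectives,
by `K0.nonempty_equiv`. -/
theorem isConjInvariant_iff_iso : T.IsConjInvariant ψ ↔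
    ∀ (m n N : ℕ) (h : m + n = N) (P : FGProj (T.alg N)),
      Nonempty ((T.conjRes ψ h).obj P.1 ≅ (T.res h).obj P.1) := by
  constructor
  · intro hK m n N h P
    obtain ⟨e⟩ := K0.nonempty_equiv F (hK h (K0.cls P))
    exact nonempty_iso_of_equiv e
  · intro hK m n N h a
    induction a using K0.induction_on with
    | cls P =>
      exact K0.cls_congr (P := ⟨(T.conjRes ψ h).obj P.1, T.conjRes_projective h ψ P⟩)
        (Q := ⟨(T.res h).obj P.1, Res_projective _ (T.biprojective h).left P⟩)
        (FGModuleCat.isoToLinearEquiv (hK m n N h P).some)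
    | add a b ha hb => rw [map_add, map_add, ha, hb]
    | neg a ha => rw [map_neg, map_neg, ha]

/-- Both `(Ψ ⊗ Ψ) Δ Ψ⁻¹ a` and `Δ a` pair with `x ⊗ y` to `⟨a, xy⟩`, the first by strength and the
second by the Hopf pairing. Pure tensors suffice, and the form separates classes. -/
theorem IsStrong.isConjInvariant_of_isDualizing (hT : T.IsStrong ψ) (hd : T.IsDualizing) :
    T.IsConjInvariant ψ := by
  intro m n N h a
  refine pairing_injective F (AddMonoidHom.ext fun z => ?_)
  obtain ⟨t, rfl⟩ := G0.kunneth_surjective (T.perfect m) z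
  induction t with
  | zero => simp only [map_zero]
  | add s t hs ht => simp only [map_add, hs, ht]
  | tmul x y =>
    rw [← hT.pairing_indG, ← mulG_apply, ← kunneth_comulK, pairing_kunneth]
    exact ComponentOps.component_mul_right (fun n => intBilin (pairing F (T.alg n)))
      T.componentsG T.componentsK hd.hopf_pairing h a x y

theorem isConjInvariant_of_eq_refl (h : ∀ n, ψ n = AlgEquiv.refl) : T.IsConjInvariant ψ := by
  obtain rfl : ψ = fun n => AlgEquiv.refl := funext h
  intro m n N h a
  have h1 : K0.res ((AlgEquiv.refl : T.alg N ≃ₐ[F] T.alg N) : T.alg N →ₐ[F] T.alg N)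
      (isLeftProjective_equiv _) = LinearMap.id := K0.res_id
  have h2 : Algebra.TensorProduct.map
      ((AlgEquiv.refl : T.alg m ≃ₐ[F] T.alg m).symm : T.alg m →ₐ[F] T.alg m)
      ((AlgEquiv.refl : T.alg n ≃ₐ[F] T.alg n).symm : T.alg n →ₐ[F] T.alg n) = AlgHom.id F _ :=
    Algebra.TensorProduct.map_id
  rw [conjResK, LinearMap.comp_apply, LinearMap.comp_apply, h1, K0.res_congr h2 _ .id, K0.res_id]
  rfl

theorem isConjInvariant_of_twistK_eq_id (h : T.twistK ψ = LinearMap.id) :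
    T.IsConjInvariant ψ := by
  have h1 : ∀ n (a : K0 (T.alg n)), K0.res ((ψ n).symm : T.alg n →ₐ[F] T.alg n)
      (isLeftProjective_equiv _) a = a := fun n a => assembleEnd_eq_id h n a
  -- Only `Ψ` is assumed to act trivially; `Ψ⁻¹` then does so as its inverse.
  have h2 : ∀ n (a : K0 (T.alg n)), K0.res (ψ n : T.alg n →ₐ[F] T.alg n)
      (isLeftProjective_equiv _) a = a := fun n a => by
    conv_lhs => rw [← h1 n a]
    rw [K0.res_res, K0.res_congr (φ' := AlgHom.id F _) (by ext; simp) _ .id, K0.res_id]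
    rfl
  rw [isConjInvariant_iff_conjComponents]
  intro m n N h a
  exact ComponentOps.conj_comul_id _ (fun n => LinearMap.ext (h1 n))
    (fun n => LinearMap.ext (h2 n)) h a

end AlgebraTower

/-! ### Symmetric algebras -/

section SymmetricAlgebras

variable {F : Type u} [Field F] {B C : Type u} [Ring B] [Algebra F B] [Ring C] [Algebra F C]

/-- Over a symmetric algebra every linear form on a module is the trace of a homomorphism. -/
theorem exists_trace_comp_eq [Module.Finite F B] {tr : B →ₗ[F] F}
    (hsym : ∀ a b, tr (a * b) = tr (b * a)) (hnd : ∀ a, (∀ b, tr (a * b) = 0) → a = 0)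
    (M : FGModuleCat.{u} B) (l : M →ₗ[F] F) : ∃ f : M →ₗ[B] B, ∀ m, tr (f m) = l m := by
  have hinj : Function.Injective ((LinearMap.mul F B).compr₂ tr) := by
    rw [injective_iff_map_eq_zero]
    exact fun a ha => hnd a fun b => LinearMap.congr_fun ha b
  have hsurj : Function.Surjective ((LinearMap.mul F B).compr₂ tr) :=
    (LinearMap.injective_iff_surjective_of_finrank_eq_finrank
      (Subspace.dual_finrank_eq (K := F) (V := B)).symm).1 hinj
  -- Nondegeneracy represents `b ↦ l (b • m)` by a unique `c`. Uniqueness makes `m ↦ c` additive,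
  -- and symmetry of the trace makes it `B`-linear.
  have hex : ∀ m : M, ∃ c : B, ∀ b : B, tr (c * b) = l (b • m) := fun m => by
    obtain ⟨c, hc⟩ := hsurj (l ∘ₗ (LinearMap.toSpanSingleton B M m).restrictScalars F)
    exact ⟨c, fun b => LinearMap.congr_fun hc b⟩
  choose f hf using hex
  have huniq : ∀ c c' : B, (∀ b, tr (c * b) = tr (c' * b)) → c = c' := fun c c' h =>
    hinj (LinearMap.ext h)
  refine ⟨{ toFun := f
            map_add' := fun m m' => huniq _ _ fun b => ?_
            map_smul' := fun a m => huniq _ _ fun b => ?_ }, fun m => ?_⟩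
  · rw [add_mul, map_add, hf, hf, hf, smul_add, map_add]
  · rw [hf, RingHom.id_apply, smul_eq_mul, mul_assoc, hsym, mul_assoc, hf, mul_smul]
  · change tr (f m) = l m
    rw [← mul_one (f m), hf, one_smul]

/-- Homomorphisms from and to a projective module over a symmetric algebra. -/
theorem IsSymmetricAlgebra.finrank_hom_comm (hB : IsSymmetricAlgebra F B) (P : FGProj B)
    (M : FGModuleCat.{u} B) :
    Module.finrank F (P.1 →ₗ[B] M) = Module.finrank F (M →ₗ[B] P.1) := by
  obtain ⟨_, tr, hsym, hnd⟩ := hB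
  have := hom_finite (F := F) P.1 M
  have := hom_finite (F := F) M P.1
  classical
  obtain ⟨n, f, g, -, -, hfg⟩ := Module.Finite.exists_comp_eq_id_of_projective B P.1
  have hq : ∀ q : P.1, q = ∑ i, g q i • f (Pi.single i 1) := fun q => by
    conv_lhs => rw [← LinearMap.id_apply (R := B) q, ← hfg, LinearMap.comp_apply,
      LinearMap.pi_apply_eq_sum_univ f]
    refine Finset.sum_congr rfl fun i _ => ?_
    congr 2
    ext j
    simp only [Pi.single_apply, eq_comm]
  -- The form is `tr` of the matrix trace of the endomorphism `h φ` of the projective module `P`. It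
  -- is nondegenerate on both sides, which gives the two inequalities of dimensions.
  let t : (P.1 →ₗ[B] M) →ₗ[F] (M →ₗ[B] P.1) →ₗ[F] F := LinearMap.mk₂ F
    (fun φ h => ∑ i, tr (g (h (φ (f (Pi.single i 1)))) i))
    (fun φ φ' h => by
      simp only [LinearMap.add_apply, map_add, Pi.add_apply, Finset.sum_add_distrib])
    (fun r φ h => by
      rw [Finset.smul_sum]
      refine Finset.sum_congr rfl fun i _ => ?_
      rw [LinearMap.smul_apply, LinearMap.map_smul_of_tower, LinearMap.map_smul_of_tower,
        Pi.smul_apply, map_smul])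
    (fun φ h h' => by
      simp only [LinearMap.add_apply, map_add, Pi.add_apply, Finset.sum_add_distrib])
    (fun r φ h => by
      rw [Finset.smul_sum]
      refine Finset.sum_congr rfl fun i _ => ?_
      rw [LinearMap.smul_apply, LinearMap.map_smul_of_tower, Pi.smul_apply, map_smul])
  have ht : ∀ φ h, t φ h = ∑ i, tr (g (h (φ (f (Pi.single i 1)))) i) := fun _ _ => rfl
  have h1 : Function.Injective t := by
    rw [injective_iff_map_eq_zero]
    intro φ hφ
    ext q
    rw [LinearMap.zero_apply]
    have hl : ∀ l : M →ₗ[F] F, l (φ q) = 0 := by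
      intro l
      obtain ⟨u, hu⟩ := exists_trace_comp_eq hsym hnd M l
      -- Testing `φ` against `m ↦ u m • q` gives `tr (u (φ q)) = l (φ q)`.
      have h0 := LinearMap.congr_fun hφ (u.smulRight q)
      rw [ht, LinearMap.zero_apply] at h0
      rw [← hu, ← h0]
      conv_lhs => rw [hq q, map_sum, map_sum, map_sum]
      refine Finset.sum_congr rfl fun i _ => ?_
      rw [φ.map_smul, u.map_smul, LinearMap.smulRight_apply, g.map_smul, Pi.smul_apply,
        smul_eq_mul, smul_eq_mul, hsym]
    exact (Module.forall_dual_apply_eq_zero_iff F (φ q)).1 hl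
  have h2 : Function.Injective t.flip := by
    rw [injective_iff_map_eq_zero]
    intro h hh
    ext m
    rw [LinearMap.zero_apply]
    have hz : ∀ i, g (h m) i = 0 := fun i => hnd _ fun b => by
      -- Testing `h` against `p ↦ (g p i * b) • m` isolates `tr (g (h m) i * b)`.
      have h0 := LinearMap.congr_fun hh
        ((LinearMap.toSpanSingleton B B b ∘ₗ LinearMap.proj i ∘ₗ g).smulRight m)
      rw [LinearMap.flip_apply, ht, LinearMap.zero_apply] at h0
      rw [← h0]
      conv_lhs => rw [hq (h m), map_sum, Finset.sum_apply, Finset.sum_mul, map_sum]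
      refine Finset.sum_congr rfl fun j _ => ?_
      rw [LinearMap.smulRight_apply, map_smul, map_smul, Pi.smul_apply, map_smul, Pi.smul_apply,
        smul_eq_mul, smul_eq_mul, mul_assoc, hsym]
      rfl
    rw [hq (h m)]
    simp only [hz, zero_smul, Finset.sum_const_zero]
  refine le_antisymm ?_ ?_
  · have := LinearMap.finrank_le_finrank_of_injective h1
    rwa [Subspace.dual_finrank_eq] at this
  · have := LinearMap.finrank_le_finrank_of_injective h2
    rwa [Subspace.dual_finrank_eq] at this

/-- The product of the two traces works. For nondegeneracy, expand along a basis of `C`: testing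
against `b ⊗ c` for all `c` kills the combination of basis vectors with coefficients `tr (t i * b)`,
hence each coefficient, hence each `t i`. -/
theorem IsSymmetricAlgebra.tensorProduct (hB : IsSymmetricAlgebra F B)
    (hC : IsSymmetricAlgebra F C) : IsSymmetricAlgebra F (B ⊗[F] C) := by
  obtain ⟨_, tr, hsym, hnd⟩ := hB
  obtain ⟨_, tr', hsym', hnd'⟩ := hC
  let τ : B ⊗[F] C →ₗ[F] F := LinearMap.mul' F F ∘ₗ TensorProduct.map tr tr'
  have hτ : ∀ b c, τ (b ⊗ₜ c) = tr b * tr' c := fun _ _ => rfl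
  refine ⟨inferInstance, τ, fun x y => ?_, fun z hz => ?_⟩
  · induction x with
    | zero => simp
    | add a b ha hb => rw [add_mul, mul_add, map_add, map_add, ha, hb]
    | tmul b c =>
    induction y with
    | zero => simp
    | add a b ha hb => rw [add_mul, mul_add, map_add, map_add, ha, hb]
    | tmul b' c' =>
      rw [Algebra.TensorProduct.tmul_mul_tmul, Algebra.TensorProduct.tmul_mul_tmul, hτ, hτ, hsym,
        hsym']
  · let bC := Module.finBasis F C
    obtain ⟨t, rfl⟩ := TensorProduct.eq_repr_basis_right bC z
    have hsum : (t.sum fun i m => m ⊗ₜ[F] bC i) = ∑ i, t i ⊗ₜ[F] bC i :=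
      Finsupp.sum_fintype _ _ fun i => TensorProduct.zero_tmul _ _
    have h0 : ∀ b, ∑ i, tr (t i * b) • bC i = 0 := fun b => hnd' _ fun c => by
      have h1 := hz (b ⊗ₜ c)
      rw [hsum, Finset.sum_mul, map_sum] at h1
      rw [Finset.sum_mul, map_sum, ← h1]
      refine Finset.sum_congr rfl fun i _ => ?_
      rw [Algebra.TensorProduct.tmul_mul_tmul, hτ, smul_mul_assoc, map_smul, smul_eq_mul]
    have ht : t = 0 := Finsupp.ext fun i => hnd _ fun b =>
      Fintype.linearIndependent_iff.1 bC.linearIndependent _ (h0 b) i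
    rw [ht, Finsupp.sum_zero_index]

/-- The dimensions of `Hom(P, Ind M)`, `Hom(Ind M, P)`, `Hom(M, Res P)` and `Hom(Res P, M)` agree,
by symmetry of `A_N`, by the usual adjunction, and by symmetry of `A_m ⊗ A_n`. So `Res P` and its
twist have the same pairing with every class. -/
theorem AlgebraTower.IsStrong.isConjInvariant_of_isSymmetricAlgebra {T : AlgebraTower F}
    {ψ : ∀ n, T.alg n ≃ₐ[F] T.alg n} (hT : T.IsStrong ψ)
    (hs : ∀ n, IsSymmetricAlgebra F (T.alg n)) : T.IsConjInvariant ψ := by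
  intro m n N h a
  refine pairing_injective F (AddMonoidHom.ext fun z => ?_)
  rw [← hT.pairing_indG]
  induction a using K0.induction_on with
  | add a b ha hb => simp only [map_add, AddMonoidHom.add_apply, ha, hb]
  | neg a ha => simp only [map_neg, AddMonoidHom.neg_apply, ha]
  | cls P =>
  induction z using G0.induction_on with
  | add a b ha hb => simp only [map_add, ha, hb]
  | neg a ha => simp only [map_neg, ha]
  | cls M =>
    refine congrArg Nat.cast (((hs N).finrank_hom_comm P ((T.ind h).obj M)).trans ?_)
    refine (finrank_hom_ind (T.ρ h) M P.1).trans ?_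
    exact (((hs m).tensorProduct (hs n)).finrank_hom_comm
      ⟨(T.res h).obj P.1, Res_projective _ (T.biprojective h).left P⟩ M).symm

end SymmetricAlgebras

end

end AlgTower

/-! ### The proposition -/

theorem proposition3 {F : Type u} [Field F] (T : AlgTower.AlgebraTower F)
    (ψ : ∀ n, T.alg n ≃ₐ[F] T.alg n) (hT : T.IsStrong ψ) :
    List.TFAE [
      T.IsDualizing,
      ∀ (m n N : ℕ) (h : m + n = N) (P : AlgTower.FGProj (T.alg N)),
        Nonempty ((T.conjRes ψ h).obj P.1 ≅ (T.res h).obj P.1),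
      T.conjComulK ψ = T.opsK.comul] ∧
    ((∀ n, AlgTower.IsSymmetricAlgebra F (T.alg n)) → T.IsDualizing) ∧
    ((∀ n, ψ n = AlgEquiv.refl) → T.IsDualizing) ∧
    (T.twistK ψ = LinearMap.id → T.IsDualizing) := by
  refine ⟨?_, fun hs => hT.isDualizing (hT.isConjInvariant_of_isSymmetricAlgebra hs),
    fun h => hT.isDualizing (AlgTower.AlgebraTower.isConjInvariant_of_eq_refl h),
    fun h => hT.isDualizing (AlgTower.AlgebraTower.isConjInvariant_of_twistK_eq_id h)⟩
  tfae_have 1 → 2 := fun h =>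
    AlgTower.AlgebraTower.isConjInvariant_iff_iso.1 (hT.isConjInvariant_of_isDualizing h)
  tfae_have 2 → 3 := fun h => AlgTower.AlgebraTower.isConjInvariant_iff_conjComulK.1
    (AlgTower.AlgebraTower.isConjInvariant_iff_iso.2 h)
  tfae_have 3 → 1 := fun h =>
    hT.isDualizing (AlgTower.AlgebraTower.isConjInvariant_iff_conjComulK.2 h)
  tfae_finish
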